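/- For an integer $g\ge 0$ let $S_g$ be the closed, connected, orientable surface of genus $g$, and let $\mathrm{Mod}(S_g)$ be its mapping class group, that is, the group of homotopy classes of orientation-preserving homeomorphisms of $S_g$. Let $k\ge 2$ and $g>0$ be integers such that $g=ak+b(k-1)$ for some integers $a,b\ge 0$, or $g=ak+1$ for some integer $a>0$. Then $\mathrm{Mod}(S_g)$ contains an element of order exactly $k$. Moreover, such an element can be chosen so that it is realized by a rotation: there are a topological embedding $e:S_g\to\mathbb{R}^3$ whose image is invariant under the rotation $R$ of $\mathbb{R}^3$ by the angle $2\pi/k$ about a coordinate axis, and an element of order $k$ of $\mathrm{Mod}(S_g)$ that is represented by the orientation-preserving homeomorphism $e^{-1}\circ R\circ e$ of $S_g$. -/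

import Mathlib

open Topology

/-- The closed orientable surface of genus `g` in its standard model: the double of a closed disc
with `g` holes, realized in Euclidean space as the set `z² = P(x, y)`. Here
`P = (9 (g + 1)² - x² - y²) · ∏ⱼ ((x - 3 j)² + y² - 1)`, so that `{P ≥ 0}` is the closed disc of
radius `3 (g + 1)` about the origin minus the `g` disjoint open unit discs about `(3 j, 0)`,
`j = 1, …, g`, and `{P = 0}` is the union of the `g + 1` boundary circles. -/
def standardSurface (g : ℕ) : Set (EuclideanSpace ℝ (Fin 3)) :=
  {p | p 2 ^ 2 = (9 * ((g : ℝ) + 1) ^ 2 - p 0 ^ 2 - p 1 ^ 2) *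
    ∏ j ∈ Finset.Icc 1 g, ((p 0 - 3 * (j : ℝ)) ^ 2 + p 1 ^ 2 - 1)}

/-- `S` is a closed connected orientable surface of genus `g`, i.e. a sphere with `g` handles. -/
def IsClosedSurfaceOfGenus (g : ℕ) (S : Type*) [TopologicalSpace S] : Prop :=
  Nonempty (S ≃ₜ standardSurface g)

/-- The planar map `h` has local degree one at `p`: along every small circle about `p`, run through
once counterclockwise, the vector `h - h p` does not vanish and has winding number one about the
origin, as witnessed by a continuous choice `θ` of its argument. -/
def PositiveAt (h : ℂ → ℂ) (p : ℂ) : Prop :=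
  ∀ᶠ r : ℝ in 𝓝[>] 0, ∃ θ : ℝ → ℝ, Continuous θ ∧
    (∀ t, θ (t + 2 * Real.pi) = θ t + 2 * Real.pi) ∧
    ∀ t : ℝ, ∃ ρ : ℝ, 0 < ρ ∧
      h (p + r * Complex.exp (t * Complex.I)) - h p = ρ * Complex.exp (θ t * Complex.I)

/-- An oriented atlas on a surface: planar charts that cover the surface and all of whose
transition maps preserve the orientation of the plane. -/
structure IsOrientedAtlas {S : Type*} [TopologicalSpace S]
    (A : Set (OpenPartialHomeomorph S ℂ)) : Prop where
  covers : ∀ x : S, ∃ c ∈ A, x ∈ c.source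
  compatible : ∀ c ∈ A, ∀ d ∈ A, ∀ x ∈ c.source ∩ d.source, PositiveAt (d ∘ c.symm) (c x)

/-- An orientation of a surface: a maximal oriented atlas. -/
def IsOrientation {S : Type*} [TopologicalSpace S]
    (A : Set (OpenPartialHomeomorph S ℂ)) : Prop :=
  Maximal IsOrientedAtlas A

/-- The group of orientation-preserving homeomorphisms of `S`: those that carry each orientation
of `S` to itself. (A connected orientable surface has two orientations, opposite to each other, and
a homeomorphism that preserves one of them preserves the other.) -/
def HomeoPlus (S : Type*) [TopologicalSpace S] : Subgroup (S ≃ₜ S) where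
  carrier := {f | ∀ A : Set (OpenPartialHomeomorph S ℂ), IsOrientation A →
    ∀ c, f.transOpenPartialHomeomorph c ∈ A ↔ c ∈ A}
  one_mem' := by
    intro A _ c
    have : (1 : S ≃ₜ S).transOpenPartialHomeomorph c = c := by
      ext <;> simp <;> rfl
    rw [this]
  mul_mem' := by
    intro f f' hf hf' A hA c
    have : (f * f').transOpenPartialHomeomorph c =
        f'.transOpenPartialHomeomorph (f.transOpenPartialHomeomorph c) := by
      ext <;> simp [← Homeomorph.mul_apply] <;> rfl
    rw [this, hf' A hA, hf A hA]
  inv_mem' := by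
    intro f hf A hA c
    have : f.transOpenPartialHomeomorph (f⁻¹.transOpenPartialHomeomorph c) = c := by
      ext x
      · exact congrArg c (f.symm_apply_apply x)
      · exact f.symm_apply_apply (c.symm x)
      · simp
    rw [← hf A hA, this]

/-- The orientation-preserving homeomorphisms that are homotopic to the identity. -/
def HomotopicToId (S : Type*) [TopologicalSpace S] : Subgroup (HomeoPlus S) where
  carrier := {f | ContinuousMap.Homotopic (f.1 : C(S, S)) (ContinuousMap.id S)}
  one_mem' := ContinuousMap.Homotopic.refl _
  mul_mem' := fun hf hf' => ContinuousMap.Homotopic.comp hf hf'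
  inv_mem' := by
    intro f hf
    have h := ContinuousMap.Homotopic.comp
      (ContinuousMap.Homotopic.refl ((f⁻¹).1 : C(S, S))) hf
    have e : ContinuousMap.comp ((f⁻¹).1 : C(S, S)) (f.1 : C(S, S)) = ContinuousMap.id S := by
      ext x
      exact f.1.symm_apply_apply x
    rw [e] at h
    exact h.symm

instance (S : Type*) [TopologicalSpace S] : (HomotopicToId S).Normal where
  conj_mem := by
    intro n hn f
    have h := ContinuousMap.Homotopic.comp (ContinuousMap.Homotopic.comp
      (ContinuousMap.Homotopic.refl (f.1 : C(S, S))) hn)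
      (ContinuousMap.Homotopic.refl ((f⁻¹).1 : C(S, S)))
    have e : ContinuousMap.comp (ContinuousMap.comp (f.1 : C(S, S)) (ContinuousMap.id S))
        ((f⁻¹).1 : C(S, S)) = ContinuousMap.id S := by
      ext x
      exact f.1.apply_symm_apply x
    rw [e] at h
    exact h

/-- The mapping class group `Mod(S)`: homotopy classes of orientation-preserving
homeomorphisms. -/
abbrev MappingClassGroup (S : Type*) [TopologicalSpace S] : Type _ :=
  HomeoPlus S ⧸ HomotopicToId S

/-- The rotation of Euclidean 3-space by the angle `φ` about the third coordinate axis. -/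
noncomputable def axialRotation (φ : ℝ) (p : EuclideanSpace ℝ (Fin 3)) : EuclideanSpace ℝ (Fin 3) :=
  !₂[Real.cos φ * p 0 - Real.sin φ * p 1, Real.sin φ * p 0 + Real.cos φ * p 1, p 2]

/-- The mapping class `m` is realized by the rotation by the angle `φ` of an embedded copy of `S`
in Euclidean 3-space: the rotation maps the embedded surface to itself, and the homeomorphism of
`S` so obtained represents `m`. -/
def IsRealizedByRotation {S : Type*} [TopologicalSpace S] (φ : ℝ) (m : MappingClassGroup S) :
    Prop :=
  ∃ (e : S → EuclideanSpace ℝ (Fin 3)) (f : HomeoPlus S),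
    IsEmbedding e ∧ (∀ x, e (f.1 x) = axialRotation φ (e x)) ∧ (f : MappingClassGroup S) = m

/-! The proof realizes the surface in space so that the symmetry is visible. If `g = ak` or `g = ak
+ 1` with `a > 0`, the model is the double of a round disc with holes about the `ak`-th roots of
unity and, in the second case, about the origin. If `g = ak + b(k - 1)` with `b > 0`, the model is a
stack of `b + 1` balls along the axis, consecutive ones being joined by tubes about roots of unity:
`(a + 1)k` tubes once and `k` tubes the other `b - 1` times. Joining by `n` tubes contributes `n -
1` to the genus, and `(a + 1)k - 1 + (b - 1)(k - 1) = g`. Both models are invariant under the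
rotation by `2π/k`. By `exists_mappingClass_of_rotation` it remains to determine the genus of the
model, to see that the rotation preserves orientation, and to see that no proper power of it is
homotopic to the identity.

Genus. A double `z² = P` depends only on the signs of `P`, up to a homeomorphism of the plane
(`doubleOf_homeomorph`), and any round holes can be carried to any others
(`IsHoleConfiguration.exists_carriesDomain`). Hence the double of a disc with `g` holes is the
standard surface. In a stack, the tubes of each slab are first moved onto a line
(`tubeStack_homeomorph`). Seen from the front, the resulting surface is the double of a disc whose
holes are the `n - 1` gaps between the `n` tubes of each slab (`doubleOf_stackFunction_homeomorph`).

Orientation. Some open piece of the model stays in the model under all rotations about the axis, so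
there the rotation is isotopic to the inclusion. The local degree is constant along the isotopy and
then along the connected surface (`mem_homeoPlus_of_locallyIsotopicToId`).

Order. A proper power of the rotation moves some tube `a'` to another tube `a`. Let `φ` have as real
part the signed distance to a circle about the tube `a`, and as imaginary part the height above its
middle; `φ` has no zeros. A loop that runs from `a` to `a'` on one side and returns on the other has
winding number `±1` under `φ` and the opposite number after the rotation. Homotopic maps would give
equal numbers (`not_homotopic_of_tubes`). -/

/-! ### Winding numbers and the local degree of planar maps -/

/-- The closed curve `γ` winds once around the origin. -/
def WindsOnce (γ : ℝ → ℂ) : Prop :=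
  ∃ θ : ℝ → ℝ, Continuous θ ∧ (∀ t, θ (t + 2 * Real.pi) = θ t + 2 * Real.pi) ∧
    ∀ t : ℝ, ∃ ρ : ℝ, 0 < ρ ∧ γ t = ρ * Complex.exp (θ t * Complex.I)

/-- The image under `h` of the circle of radius `r` about `p`, seen from `h p`. -/
noncomputable def circleImage (h : ℂ → ℂ) (p : ℂ) (r t : ℝ) : ℂ :=
  h (p + r * Complex.exp (t * Complex.I)) - h p

theorem positiveAt_def (h : ℂ → ℂ) (p : ℂ) :
    PositiveAt h p ↔ ∀ᶠ r : ℝ in 𝓝[>] 0, WindsOnce (circleImage h p r) := Iff.rfl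

/-- The quotient `γ' / γ` stays in the unit disc about `1`, so its principal argument is continuous
and periodic. Adding it to an argument of `γ` gives one of `γ'`. -/
theorem WindsOnce.of_close {γ γ' : ℝ → ℂ} (h : WindsOnce γ) (hc : Continuous γ)
    (hc' : Continuous γ') (hp : ∀ t, γ (t + 2 * Real.pi) = γ t)
    (hp' : ∀ t, γ' (t + 2 * Real.pi) = γ' t) (hd : ∀ t, ‖γ' t - γ t‖ < ‖γ t‖) :
    WindsOnce γ' := by
  obtain ⟨θ, hθ, hθp, hθγ⟩ := h
  have hne : ∀ t, γ t ≠ 0 := fun t h0 => by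
    have := hd t
    rw [h0, norm_zero] at this
    exact absurd this (not_lt.2 (norm_nonneg _))
  have hslit : ∀ t, γ' t / γ t ∈ Complex.slitPlane := fun t => by
    have e : γ' t / γ t = 1 + (γ' t - γ t) / γ t := by
      field_simp [hne t]
      ring
    rw [e]
    apply Complex.mem_slitPlane_of_norm_lt_one
    rw [norm_div, div_lt_one (norm_pos_iff.2 (hne t))]
    exact hd t
  refine ⟨fun t => θ t + Complex.arg (γ' t / γ t), ?_, ?_, ?_⟩
  · refine hθ.add (continuous_iff_continuousAt.2 fun t => ?_)
    exact (Complex.continuousAt_arg (hslit t)).comp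
      (f := fun t => γ' t / γ t) (hc'.div hc hne).continuousAt
  · intro t
    simp only [hθp, hp, hp']
    ring
  · intro t
    obtain ⟨ρ, hρ, e⟩ := hθγ t
    refine ⟨ρ * ‖γ' t / γ t‖, mul_pos hρ
      (norm_pos_iff.2 (Complex.slitPlane_ne_zero (hslit t))), ?_⟩
    have e2 : γ' t = γ t * (γ' t / γ t) := by field_simp [hne t]
    have e3 := Complex.norm_mul_exp_arg_mul_I (γ' t / γ t)
    push_cast
    rw [add_mul, Complex.exp_add]
    calc γ' t = γ t * (γ' t / γ t) := e2
      _ = (ρ * Complex.exp (θ t * Complex.I)) *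
          (‖γ' t / γ t‖ * Complex.exp (Complex.arg (γ' t / γ t) * Complex.I)) := by rw [e3, ← e]
      _ = _ := by ring

/-- Compactness of a period makes the closeness uniform in `t`. The factor `2` in `key` makes it
usable in both directions, since it bounds the difference by the norm of either curve. -/
theorem eventually_windsOnce_iff {Y : Type*} [TopologicalSpace Y] {γ : Y → ℝ → ℂ} {y₀ : Y}
    (hc : ∀ t, ContinuousAt (fun q : Y × ℝ => γ q.1 q.2) (y₀, t))
    (hcy : ∀ᶠ y in 𝓝 y₀, Continuous (γ y)) (hp : ∀ y t, γ y (t + 2 * Real.pi) = γ y t)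
    (h0 : ∀ t, γ y₀ t ≠ 0) :
    ∀ᶠ y in 𝓝 y₀, (WindsOnce (γ y) ↔ WindsOnce (γ y₀)) := by
  have hc0 : Continuous (γ y₀) := hcy.self_of_nhds
  have key : ∀ᶠ y in 𝓝 y₀, ∀ t ∈ Set.Icc 0 (2 * Real.pi),
      2 * ‖γ y t - γ y₀ t‖ < ‖γ y₀ t‖ := by
    refine isCompact_Icc.eventually_forall_of_forall_eventually fun t _ => ?_
    have h1 : ContinuousAt (fun q : Y × ℝ => 2 * ‖γ q.1 q.2 - γ y₀ q.2‖) (y₀, t) :=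
      continuousAt_const.mul ((hc t).sub (hc0.comp continuous_snd).continuousAt).norm
    have h2 : ContinuousAt (fun q : Y × ℝ => ‖γ y₀ q.2‖) (y₀, t) :=
      (hc0.comp continuous_snd).norm.continuousAt
    refine h1.eventually_lt h2 ?_
    simpa using h0 t
  filter_upwards [key, hcy] with y hy hcy
  have all : ∀ t, 2 * ‖γ y t - γ y₀ t‖ < ‖γ y₀ t‖ := fun t => by
    have per : Function.Periodic (fun t => (γ y t, γ y₀ t)) (2 * Real.pi) := fun t => by
      simp [hp]
    obtain ⟨s, hs, e⟩ := per.exists_mem_Ico₀ Real.two_pi_pos t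
    have e1 : γ y t = γ y s := congrArg Prod.fst e
    have e2 : γ y₀ t = γ y₀ s := congrArg Prod.snd e
    rw [e1, e2]
    exact hy s ⟨hs.1, hs.2.le⟩
  constructor
  · intro h
    refine h.of_close hcy hc0 (hp y) (hp y₀) fun t => ?_
    have := all t
    have h3 := norm_sub_norm_le (γ y₀ t) (γ y₀ t - γ y t)
    rw [sub_sub_cancel] at h3
    rw [norm_sub_rev (γ y t)] at this
    linarith
  · intro h
    refine h.of_close hc0 hcy (hp y₀) (hp y) fun t => ?_
    have := all t
    have := norm_nonneg (γ y t - γ y₀ t)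
    linarith

/-- Homotopy invariance: winding once is a locally constant property of the parameter. -/
theorem windsOnce_family {Y : Type*} [TopologicalSpace Y] [PreconnectedSpace Y]
    {γ : Y → ℝ → ℂ} (hc : Continuous (fun q : Y × ℝ => γ q.1 q.2))
    (hp : ∀ y t, γ y (t + 2 * Real.pi) = γ y t) (h0 : ∀ y t, γ y t ≠ 0) (y y' : Y)
    (h : WindsOnce (γ y)) : WindsOnce (γ y') := by
  have loc : ∀ y₀, ∀ᶠ y in 𝓝 y₀, (WindsOnce (γ y) ↔ WindsOnce (γ y₀)) := fun y₀ =>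
    eventually_windsOnce_iff (fun t => hc.continuousAt)
      (Filter.Eventually.of_forall fun y => hc.comp (by fun_prop : Continuous fun t : ℝ => (y, t)))
      hp (h0 y₀)
  have hclopen : IsClopen {y | WindsOnce (γ y)} := by
    constructor
    · rw [← isOpen_compl_iff, isOpen_iff_mem_nhds]
      intro z hz
      filter_upwards [loc z] with w hw hw'
      exact hz (hw.1 hw')
    · rw [isOpen_iff_mem_nhds]
      intro z hz
      filter_upwards [loc z] with w hw
      exact hw.2 hz
  rcases isClopen_iff.1 hclopen with e | e
  · exact absurd (show y ∈ {y | WindsOnce (γ y)} from h) (by rw [e]; exact id)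
  · exact (e ▸ Set.mem_univ y' : y' ∈ {y | WindsOnce (γ y)})

theorem circlePoint_periodic (t : ℝ) :
    Complex.exp (((t + 2 * Real.pi : ℝ) : ℂ) * Complex.I) = Complex.exp (t * Complex.I) := by
  push_cast
  rw [add_mul]
  exact Complex.exp_periodic _

theorem circleImage_periodic (h : ℂ → ℂ) (p : ℂ) (r t : ℝ) :
    circleImage h p r (t + 2 * Real.pi) = circleImage h p r t := by
  unfold circleImage
  rw [circlePoint_periodic]

theorem circlePoint_mem_ball {p : ℂ} {r R : ℝ} (hr : 0 ≤ r) (hR : r < R) (t : ℝ) :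
    p + r * Complex.exp (t * Complex.I) ∈ Metric.ball p R := by
  rw [mem_ball_iff_norm, add_sub_cancel_left, norm_mul, Complex.norm_exp_ofReal_mul_I, mul_one,
    Complex.norm_real, Real.norm_of_nonneg hr]
  exact hR

theorem circlePoint_ne {p : ℂ} {r : ℝ} (hr : 0 < r) (t : ℝ) :
    p + r * Complex.exp (t * Complex.I) ≠ p := by
  intro h
  rw [add_eq_left, mul_eq_zero] at h
  rcases h with h | h
  · exact hr.ne' (Complex.ofReal_eq_zero.1 h)
  · exact Complex.exp_ne_zero _ h

theorem circleImage_ne_zero {h : ℂ → ℂ} {p : ℂ} {R r : ℝ} (hi : Set.InjOn h (Metric.ball p R))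
    (hr : 0 < r) (hR : r < R) (t : ℝ) : circleImage h p r t ≠ 0 := by
  intro e
  exact circlePoint_ne hr t (hi (circlePoint_mem_ball hr.le hR t)
    (Metric.mem_ball_self (hr.trans hR)) (sub_eq_zero.1 e))

/-- For an injective map the images of all circles about `p` inside the ball avoid `h p`, and their
radii form an interval. One radius therefore decides about all small ones. -/
theorem positiveAt_iff_windsOnce {h : ℂ → ℂ} {p : ℂ} {R r : ℝ}
    (hc : ContinuousOn h (Metric.ball p R)) (hi : Set.InjOn h (Metric.ball p R))
    (hr : 0 < r) (hR : r < R) : PositiveAt h p ↔ WindsOnce (circleImage h p r) := by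
  have : PreconnectedSpace (Set.Ioo 0 R) := Subtype.preconnectedSpace isPreconnected_Ioo
  have key : ∀ a b : Set.Ioo 0 R, WindsOnce (circleImage h p a) → WindsOnce (circleImage h p b) := by
    refine windsOnce_family (γ := fun (a : Set.Ioo 0 R) => circleImage h p a) ?_
      (fun a t => circleImage_periodic h p a t)
      (fun a t => circleImage_ne_zero hi a.2.1 a.2.2 t)
    refine Continuous.sub ?_ continuous_const
    refine hc.comp_continuous (f := fun q : Set.Ioo 0 R × ℝ =>
      p + ((q.1 : ℝ) : ℂ) * Complex.exp (q.2 * Complex.I)) (by fun_prop) fun q => ?_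
    exact circlePoint_mem_ball q.1.2.1.le q.1.2.2 q.2
  rw [positiveAt_def]
  constructor
  · intro hev
    obtain ⟨a, ha, ha'⟩ := (hev.and (Ioo_mem_nhdsGT (hr.trans hR))).exists
    exact key ⟨a, ha'⟩ ⟨r, hr, hR⟩ ha
  · intro hw
    filter_upwards [Ioo_mem_nhdsGT (hr.trans hR)] with a ha
    exact key ⟨r, hr, hR⟩ ⟨a, ha⟩ hw

theorem PositiveAt.congr {h h' : ℂ → ℂ} {p : ℂ} (H : PositiveAt h p) (e : h =ᶠ[𝓝 p] h') :
    PositiveAt h' p := by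
  rw [positiveAt_def] at *
  obtain ⟨R, hR, hb⟩ := Metric.eventually_nhds_iff_ball.1 e
  filter_upwards [H, Ioo_mem_nhdsGT hR] with r hr hr'
  have : circleImage h' p r = circleImage h p r := by
    funext t
    unfold circleImage
    rw [hb _ (circlePoint_mem_ball hr'.1.le hr'.2 t), hb p (Metric.mem_ball_self hR)]
  rwa [this]

/-- `h` is continuous and injective near `p`. -/
def LocallyEmbeds (h : ℂ → ℂ) (p : ℂ) : Prop :=
  ∃ U ∈ 𝓝 p, ContinuousOn h U ∧ Set.InjOn h U

theorem LocallyEmbeds.exists_ball {h : ℂ → ℂ} {p : ℂ} (H : LocallyEmbeds h p) :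
    ∃ R > 0, ContinuousOn h (Metric.ball p R) ∧ Set.InjOn h (Metric.ball p R) := by
  obtain ⟨U, hU, hc, hi⟩ := H
  obtain ⟨R, hR, hb⟩ := Metric.mem_nhds_iff.1 hU
  exact ⟨R, hR, hc.mono hb, hi.mono hb⟩

theorem LocallyEmbeds.comp {g h : ℂ → ℂ} {p : ℂ} (hg : LocallyEmbeds g (h p))
    (hh : LocallyEmbeds h p) : LocallyEmbeds (g ∘ h) p := by
  obtain ⟨U, hU, hc, hi⟩ := hg
  obtain ⟨V, hV, hc', hi'⟩ := hh
  refine ⟨V ∩ h ⁻¹' U, Filter.inter_mem hV ((hc'.continuousAt hV) hU), ?_, ?_⟩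
  · exact hc.comp (hc'.mono Set.inter_subset_left) fun x hx => hx.2
  · exact hi.comp (hi'.mono Set.inter_subset_left) fun x hx => hx.2

/-- In polar coordinates about `h p`, the image of a small circle under `h` is `(ρ t, θ t)`, with
`θ` increasing by `2π` over a period. It deforms linearly to the round circle `(R / 2, t)` inside
the punctured ball on which `g` is injective, and `g` carries this deformation along. -/
theorem PositiveAt.comp {g h : ℂ → ℂ} {p : ℂ} (Hg : PositiveAt g (h p)) (Hh : PositiveAt h p)
    (hg : LocallyEmbeds g (h p)) (hh : LocallyEmbeds h p) : PositiveAt (g ∘ h) p := by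
  obtain ⟨R, hR, hgc, hgi⟩ := hg.exists_ball
  obtain ⟨R', hR', hhc, hhi⟩ := hh.exists_ball
  have hcont : ContinuousAt h p := hhc.continuousAt (Metric.ball_mem_nhds _ hR')
  obtain ⟨δ, hδ, hδb⟩ := Metric.continuousAt_iff.1 hcont R hR
  have hwg := (positiveAt_iff_windsOnce hgc hgi (half_pos hR) (half_lt_self hR)).1 Hg
  rw [positiveAt_def] at Hh ⊢
  filter_upwards [Hh, Ioo_mem_nhdsGT hR', Ioo_mem_nhdsGT hδ] with r hw hrR hrδ
  obtain ⟨θ, hθ, hθp, hθγ⟩ := hw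
  have hγc : Continuous (circleImage h p r) := by
    refine Continuous.sub ?_ continuous_const
    exact hhc.comp_continuous (by fun_prop) fun t => circlePoint_mem_ball hrR.1.le hrR.2 t
  have hρ0 : ∀ t, 0 < ‖circleImage h p r t‖ := fun t =>
    norm_pos_iff.2 (circleImage_ne_zero hhi hrR.1 hrR.2 t)
  have hρR : ∀ t, ‖circleImage h p r t‖ < R := fun t => by
    have := hδb (circlePoint_mem_ball (p := p) hrδ.1.le hrδ.2 t)
    rwa [dist_eq_norm] at this
  have hpol : ∀ t, circleImage h p r t =
      (‖circleImage h p r t‖ : ℂ) * Complex.exp (θ t * Complex.I) := fun t => by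
    obtain ⟨ρ, hρ, e⟩ := hθγ t
    have e' : circleImage h p r t = ρ * Complex.exp (θ t * Complex.I) := e
    rw [e', norm_mul, Complex.norm_exp_ofReal_mul_I, Complex.norm_real,
      Real.norm_of_nonneg hρ.le, mul_one]
  set ρ : ℝ → ℝ := fun t => ‖circleImage h p r t‖ with hρdef
  have hρc : Continuous ρ := hγc.norm
  let rad : unitInterval → ℝ → ℝ := fun y t => (1 - y) * ρ t + y * (R / 2)
  let ang : unitInterval → ℝ → ℝ := fun y t => (1 - y) * θ t + y * t
  have hrad0 : ∀ y t, 0 < rad y t := fun y t => by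
    rcases eq_or_lt_of_le y.2.2 with e | e
    · simp only [rad, e]
      linarith
    · have h1 : 0 < (1 - (y : ℝ)) * ρ t := mul_pos (by linarith) (hρ0 t)
      have h2 : 0 ≤ (y : ℝ) * (R / 2) := mul_nonneg y.2.1 (by linarith)
      exact add_pos_of_pos_of_nonneg h1 h2
  have hradR : ∀ y t, rad y t < R := fun y t => by
    have h0 := y.2.1
    have h1 := y.2.2
    have h2 := hρR t
    have : rad y t ≤ (1 - y) * max (ρ t) (R / 2) + y * max (ρ t) (R / 2) :=
      add_le_add (mul_le_mul_of_nonneg_left (le_max_left _ _) (by linarith))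
        (mul_le_mul_of_nonneg_left (le_max_right _ _) h0)
    have h3 : max (ρ t) (R / 2) < R := max_lt h2 (by linarith)
    linarith
  have hfam : WindsOnce (fun t => circleImage g (h p) (rad 0 t) (ang 0 t)) := by
    refine windsOnce_family (γ := fun (y : unitInterval) t => circleImage g (h p) (rad y t) (ang y t))
      ?_ ?_ ?_ 1 0 ?_
    · refine Continuous.sub ?_ continuous_const
      refine hgc.comp_continuous (f := fun q : unitInterval × ℝ => h p + ((rad q.1 q.2 : ℝ) : ℂ) *
        Complex.exp ((ang q.1 q.2 : ℝ) * Complex.I)) ?_ fun q => ?_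
      · have h1 : Continuous fun q : unitInterval × ℝ => rad q.1 q.2 := by
          simp only [rad]
          fun_prop
        have h2 : Continuous fun q : unitInterval × ℝ => ang q.1 q.2 := by
          simp only [ang]
          fun_prop
        fun_prop
      · exact circlePoint_mem_ball (hrad0 _ _).le (hradR _ _) _
    · intro y t
      have e1 : rad y (t + 2 * Real.pi) = rad y t := by
        simp only [rad, hρdef, circleImage_periodic]
      have e2 : ang y (t + 2 * Real.pi) = ang y t + 2 * Real.pi := by
        simp only [ang, hθp]
        ring
      simp only [e1, e2, circleImage_periodic]
    · intro y t
      exact circleImage_ne_zero hgi (hrad0 y t) (hradR y t) _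
    · simpa [rad, ang] using hwg
  have e : (fun t => circleImage g (h p) (rad 0 t) (ang 0 t)) = circleImage (g ∘ h) p r := by
    funext t
    have e1 : rad 0 t = ρ t := by simp [rad]
    have e2 : ang 0 t = θ t := by simp [ang]
    simp only [e1, e2]
    have e3 : h p + (ρ t : ℂ) * Complex.exp (θ t * Complex.I) =
        h (p + r * Complex.exp (t * Complex.I)) := by
      rw [← hpol t]
      simp [circleImage]
    unfold circleImage
    rw [e3]
    rfl
  rwa [e] at hfam

/-- The ball of radius `R / 2` about a nearby base point lies in the given ball, so the single
radius `R / 4` tests the degree for all nearby parameters. There the winding number is locally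
constant. -/
theorem eventually_positiveAt_iff {Y : Type*} [TopologicalSpace Y] {H : Y → ℂ → ℂ} {p : Y → ℂ}
    {y₀ : Y} {N : Set Y} {R : ℝ} (hN : N ∈ 𝓝 y₀) (hR : 0 < R)
    (hc : ContinuousOn (fun q : Y × ℂ => H q.1 q.2) (N ×ˢ Metric.ball (p y₀) R))
    (hi : ∀ y ∈ N, Set.InjOn (H y) (Metric.ball (p y₀) R)) (hp : ContinuousAt p y₀) :
    ∀ᶠ y in 𝓝 y₀, (PositiveAt (H y) (p y) ↔ PositiveAt (H y₀) (p y₀)) := by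
  have hR4 : 0 < R / 4 := by linarith
  have hR2 : R / 4 < R / 2 := by linarith
  have hcH : ∀ y ∈ N, ContinuousOn (H y) (Metric.ball (p y₀) R) := fun y hy =>
    hc.comp (f := fun z => (y, z)) (by fun_prop) fun z hz => ⟨hy, hz⟩
  have near : ∀ᶠ y in 𝓝 y₀, y ∈ N ∧ Metric.ball (p y) (R / 2) ⊆ Metric.ball (p y₀) R := by
    filter_upwards [hN, hp (Metric.ball_mem_nhds _ (half_pos hR))] with y hy hpy
    refine ⟨hy, Metric.ball_subset_ball' ?_⟩
    have : dist (p y) (p y₀) < R / 2 := hpy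
    linarith
  have iff1 : ∀ᶠ y in 𝓝 y₀, (PositiveAt (H y) (p y) ↔
      WindsOnce (circleImage (H y) (p y) (R / 4))) := by
    filter_upwards [near] with y hy
    exact positiveAt_iff_windsOnce ((hcH y hy.1).mono hy.2) ((hi y hy.1).mono hy.2) hR4 hR2
  have iff2 : ∀ᶠ y in 𝓝 y₀, (WindsOnce (circleImage (H y) (p y) (R / 4)) ↔
      WindsOnce (circleImage (H y₀) (p y₀) (R / 4))) := by
    refine eventually_windsOnce_iff (γ := fun y t => circleImage (H y) (p y) (R / 4) t) ?_ ?_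
      (fun y t => circleImage_periodic _ _ _ _) ?_
    · intro t
      have hm : ∀ z ∈ Metric.ball (p y₀) R,
          ContinuousAt (fun q : Y × ℂ => H q.1 q.2) (y₀, z) := fun z hz =>
        hc.continuousAt (prod_mem_nhds hN (Metric.isOpen_ball.mem_nhds hz))
      have hpt : ContinuousAt (fun q : Y × ℝ => p q.1) (y₀, t) :=
        ContinuousAt.comp (f := Prod.fst) (x := (y₀, t)) hp continuousAt_fst
      refine ContinuousAt.sub ?_ ?_
      · refine ContinuousAt.comp (g := fun q : Y × ℂ => H q.1 q.2)
          (f := fun q : Y × ℝ => (q.1, p q.1 + ((R / 4 : ℝ) : ℂ) *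
            Complex.exp (q.2 * Complex.I))) (x := (y₀, t)) (hm _ ?_) ?_
        · exact circlePoint_mem_ball hR4.le (by linarith) t
        · exact continuousAt_fst.prodMk (hpt.add (by fun_prop))
      · refine ContinuousAt.comp (g := fun q : Y × ℂ => H q.1 q.2)
          (f := fun q : Y × ℝ => (q.1, p q.1)) (x := (y₀, t))
          (hm _ (Metric.mem_ball_self hR)) (continuousAt_fst.prodMk hpt)
    · filter_upwards [near] with y hy
      refine Continuous.sub ?_ continuous_const
      exact (hcH y hy.1).comp_continuous (by fun_prop)
        fun t => hy.2 (circlePoint_mem_ball hR4.le hR2 t)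
    · intro t
      exact circleImage_ne_zero (hi y₀ (mem_of_mem_nhds hN)) hR4 (by linarith) t
  filter_upwards [iff1, iff2] with y h1 h2
  rw [h1, h2, iff1.self_of_nhds]

/-! ### Local isotopy to the identity implies preservation of orientation -/

section Orientation

variable {S : Type*} [TopologicalSpace S]

/-- In the charts of the atlas `A`, the map `g` has local degree one at `x`. -/
def PreservesAt (A : Set (OpenPartialHomeomorph S ℂ)) (g : S → S) (x : S) : Prop :=
  ∀ c ∈ A, x ∈ c.source → ∀ d ∈ A, g x ∈ d.source → PositiveAt (d ∘ g ∘ c.symm) (c x)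

theorem locallyEmbeds_chart {c d : OpenPartialHomeomorph S ℂ} {g : S → S} {x : S} {U : Set S}
    (hU : U ∈ 𝓝 x) (hg : ContinuousOn g U) (hi : Set.InjOn g U) (hx : x ∈ c.source)
    (hgx : g x ∈ d.source) : LocallyEmbeds (d ∘ g ∘ c.symm) (c x) := by
  have hcs : ContinuousAt c.symm (c x) := c.continuousAt_symm (c.map_source hx)
  have hcx : c.symm (c x) = x := c.left_inv hx
  have hV : {z | z ∈ U ∧ g z ∈ d.source} ∈ 𝓝 x :=
    Filter.inter_mem hU ((hg.continuousAt hU) (d.open_source.mem_nhds hgx))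
  refine ⟨c.target ∩ c.symm ⁻¹' {z | z ∈ U ∧ g z ∈ d.source},
    Filter.inter_mem (c.open_target.mem_nhds (c.map_source hx)) (hcs (by rwa [hcx])), ?_, ?_⟩
  · refine d.continuousOn.comp (hg.comp (c.continuousOn_symm.mono Set.inter_subset_left) ?_) ?_
    · exact fun z hz => hz.2.1
    · exact fun z hz => hz.2.2
  · intro z hz w hw e
    have e1 : g (c.symm z) = g (c.symm w) := d.injOn hz.2.2 hw.2.2 e
    exact c.symm.injOn hz.1 hw.1 (hi hz.2.1 hw.2.1 e1)

/-- One pair of charts suffices: any other expression of `g` arises by composing with two transition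
maps, which have local degree one. -/
theorem IsOrientedAtlas.preservesAt {A : Set (OpenPartialHomeomorph S ℂ)}
    (hA : IsOrientedAtlas A) {c d : OpenPartialHomeomorph S ℂ} (hc : c ∈ A) (hd : d ∈ A)
    {g : S → S} {x : S} {U : Set S} (hU : U ∈ 𝓝 x) (hg : ContinuousOn g U) (hi : Set.InjOn g U)
    (hx : x ∈ c.source) (hgx : g x ∈ d.source) (h : PositiveAt (d ∘ g ∘ c.symm) (c x)) :
    PreservesAt A g x := by
  intro c' hc' hx' d' hd' hgx'
  have e0 : (c ∘ c'.symm) (c' x) = c x := by simp [c'.left_inv hx']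
  have e1 : (d ∘ g ∘ c.symm) (c x) = d (g x) := by simp [c.left_inv hx]
  have p1 := hA.compatible c' hc' c hc x ⟨hx', hx⟩
  have l1 : LocallyEmbeds (c ∘ c'.symm) (c' x) :=
    locallyEmbeds_chart (g := id) Filter.univ_mem continuousOn_id Function.injective_id.injOn hx' hx
  have l2 := locallyEmbeds_chart hU hg hi hx hgx
  have p2 : PositiveAt ((d ∘ g ∘ c.symm) ∘ (c ∘ c'.symm)) (c' x) :=
    PositiveAt.comp (by rwa [e0]) p1 (by rwa [e0]) l1
  have l3 : LocallyEmbeds ((d ∘ g ∘ c.symm) ∘ (c ∘ c'.symm)) (c' x) :=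
    LocallyEmbeds.comp (by rwa [e0]) l1
  have e2 : ((d ∘ g ∘ c.symm) ∘ (c ∘ c'.symm)) (c' x) = d (g x) := by
    rw [Function.comp_apply, e0, e1]
  have p3 : PositiveAt ((d' ∘ d.symm) ∘ ((d ∘ g ∘ c.symm) ∘ (c ∘ c'.symm))) (c' x) := by
    refine PositiveAt.comp ?_ p2 ?_ l3
    · rw [e2]
      exact hA.compatible d hd d' hd' (g x) ⟨hgx, hgx'⟩
    · rw [e2]
      exact locallyEmbeds_chart (g := id) Filter.univ_mem continuousOn_id
        Function.injective_id.injOn hgx hgx'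
  refine p3.congr ?_
  have hcs : ContinuousAt c'.symm (c' x) := c'.continuousAt_symm (c'.map_source hx')
  have hV : {z | z ∈ c.source ∧ g z ∈ d.source} ∈ 𝓝 (c'.symm (c' x)) := by
    rw [c'.left_inv hx']
    exact Filter.inter_mem (c.open_source.mem_nhds hx)
      ((hg.continuousAt hU) (d.open_source.mem_nhds hgx))
  filter_upwards [hcs hV] with z hz
  simp only [Function.comp_apply]
  rw [c.left_inv hz.1, d.left_inv hz.2]

/-- Both the map and the point may vary. This serves once for an isotopy at a fixed point and once
for a fixed map at a point that travels over the surface. -/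
theorem IsOrientedAtlas.preservesAt_family {A : Set (OpenPartialHomeomorph S ℂ)}
    (hA : IsOrientedAtlas A) {Y : Type*} [TopologicalSpace Y] [PreconnectedSpace Y]
    {G : Y → S → S} {x : Y → S} {U : Set S} (hU : IsOpen U)
    (hG : ContinuousOn (fun q : Y × S => G q.1 q.2) (Set.univ ×ˢ U))
    (hi : ∀ y, Set.InjOn (G y) U) (hx : Continuous x) (hxU : ∀ y, x y ∈ U) (y y' : Y)
    (h : PreservesAt A (G y) (x y)) : PreservesAt A (G y') (x y') := by
  have hGy : ∀ y, ContinuousOn (G y) U := fun y =>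
    hG.comp (f := fun z => (y, z)) (by fun_prop) fun z hz => ⟨trivial, hz⟩
  have loc : ∀ y₀, ∀ᶠ y in 𝓝 y₀, (PreservesAt A (G y) (x y) ↔ PreservesAt A (G y₀) (x y₀)) := by
    intro y₀
    obtain ⟨c, hc, hcx⟩ := hA.covers (x y₀)
    obtain ⟨d, hd, hdx⟩ := hA.covers (G y₀ (x y₀))
    have hGat : ContinuousAt (fun q : Y × S => G q.1 q.2) (y₀, x y₀) :=
      hG.continuousAt (prod_mem_nhds Filter.univ_mem (hU.mem_nhds (hxU y₀)))
    have hcs : ContinuousAt c.symm (c (x y₀)) := c.continuousAt_symm (c.map_source hcx)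
    have hcomp : ContinuousAt (fun q : Y × ℂ => G q.1 (c.symm q.2)) (y₀, c (x y₀)) := by
      refine ContinuousAt.comp (g := fun q : Y × S => G q.1 q.2)
        (f := fun q : Y × ℂ => (q.1, c.symm q.2)) ?_ ?_
      · simpa [c.left_inv hcx] using hGat
      · refine continuousAt_fst.prodMk ?_
        exact ContinuousAt.comp (g := c.symm) (f := Prod.snd) (x := (y₀, c (x y₀))) hcs
          continuousAt_snd
    have hgood : {q : Y × ℂ | (q.2 ∈ c.target ∧ c.symm q.2 ∈ U) ∧ G q.1 (c.symm q.2) ∈ d.source}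
        ∈ 𝓝 (y₀, c (x y₀)) := by
      refine Filter.inter_mem (Filter.inter_mem ?_ ?_) ?_
      · exact continuousAt_snd (c.open_target.mem_nhds (c.map_source hcx))
      · refine ContinuousAt.comp (g := c.symm) (f := Prod.snd) (x := (y₀, c (x y₀))) hcs
          continuousAt_snd (hU.mem_nhds ?_)
        simpa [c.left_inv hcx] using hxU y₀
      · refine hcomp (d.open_source.mem_nhds ?_)
        simpa [c.left_inv hcx] using hdx
    obtain ⟨N, hN, V, hV, hNV⟩ := mem_nhds_prod_iff.1 hgood
    obtain ⟨R, hR, hb⟩ := Metric.mem_nhds_iff.1 hV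
    have hsub : ∀ y ∈ N, ∀ z ∈ Metric.ball (c (x y₀)) R,
        (z ∈ c.target ∧ c.symm z ∈ U) ∧ G y (c.symm z) ∈ d.source :=
      fun y hy z hz => hNV (Set.mk_mem_prod hy (hb hz))
    have hcx' : ContinuousAt (fun y => c (x y)) y₀ :=
      ContinuousAt.comp (g := c) (f := x) (c.continuousAt hcx) hx.continuousAt
    have key := eventually_positiveAt_iff (H := fun y => d ∘ G y ∘ c.symm)
      (p := fun y => c (x y)) hN hR ?_ ?_ hcx'
    · have n1 : ∀ᶠ y in 𝓝 y₀, x y ∈ c.source := hx.continuousAt (c.open_source.mem_nhds hcx)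
      have n2 : ∀ᶠ y in 𝓝 y₀, G y (x y) ∈ d.source := by
        refine ContinuousAt.comp (g := fun q : Y × S => G q.1 q.2) (f := fun y => (y, x y)) hGat
          (continuousAt_id.prodMk hx.continuousAt) (d.open_source.mem_nhds hdx)
      filter_upwards [key, n1, n2] with y hy h1 h2
      have equ : ∀ z, x z ∈ c.source → G z (x z) ∈ d.source →
          (PreservesAt A (G z) (x z) ↔ PositiveAt (d ∘ G z ∘ c.symm) (c (x z))) :=
        fun z hz1 hz2 => ⟨fun H => H c hc hz1 d hd hz2,
          fun H => hA.preservesAt hc hd (hU.mem_nhds (hxU z)) (hGy z) (hi z) hz1 hz2 H⟩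
      rw [equ y h1 h2, equ y₀ hcx hdx]
      exact hy
    · refine d.continuousOn.comp (hG.comp (f := fun q : Y × ℂ => (q.1, c.symm q.2)) ?_ ?_) ?_
      · refine continuousOn_fst.prodMk (c.continuousOn_symm.comp continuousOn_snd ?_)
        exact fun q hq => (hsub q.1 hq.1 q.2 hq.2).1.1
      · exact fun q hq => ⟨trivial, (hsub q.1 hq.1 q.2 hq.2).1.2⟩
      · exact fun q hq => (hsub q.1 hq.1 q.2 hq.2).2
    · intro z hz a ha b hb' e
      have sa := hsub z hz a ha
      have sb := hsub z hz b hb'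
      exact c.symm.injOn sa.1.1 sb.1.1 (hi z sa.1.2 sb.1.2 (d.injOn sa.2 sb.2 e))
  have hclopen : IsClopen {y | PreservesAt A (G y) (x y)} := by
    constructor
    · rw [← isOpen_compl_iff, isOpen_iff_mem_nhds]
      intro z hz
      filter_upwards [loc z] with w hw hw'
      exact hz (hw.1 hw')
    · rw [isOpen_iff_mem_nhds]
      intro z hz
      filter_upwards [loc z] with w hw
      exact hw.2 hz
  rcases isClopen_iff.1 hclopen with e | e
  · exact absurd (show y ∈ {y | PreservesAt A (G y) (x y)} from h) (by rw [e]; exact id)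
  · exact (e ▸ Set.mem_univ y' : y' ∈ {y | PreservesAt A (G y) (x y)})

/-- On some nonempty open set, the inclusion can be deformed to `f` through injective maps. -/
def LocallyIsotopicToId (f : S → S) : Prop :=
  ∃ U : Set S, IsOpen U ∧ U.Nonempty ∧ ∃ G : unitInterval → S → S,
    ContinuousOn (fun q : unitInterval × S => G q.1 q.2) (Set.univ ×ˢ U) ∧
    (∀ s, Set.InjOn (G s) U) ∧ Set.EqOn (G 0) id U ∧ Set.EqOn (G 1) f U

/-- The degree is one at a point `x₀` of the open set, by following the isotopy from the inclusion.
It is then one everywhere, by moving the point through the connected surface. -/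
theorem IsOrientedAtlas.preservesAt_of_isotopic [PreconnectedSpace S]
    {A : Set (OpenPartialHomeomorph S ℂ)} (hA : IsOrientedAtlas A) {f : S → S}
    (hf : Continuous f) (hfi : Function.Injective f) (h : LocallyIsotopicToId f) (x : S) :
    PreservesAt A f x := by
  obtain ⟨U, hU, ⟨x₀, hx₀⟩, G, hG, hGi, hG0, hG1⟩ := h
  have h0 : PreservesAt A (G 0) x₀ := by
    obtain ⟨c, hc, hcx⟩ := hA.covers x₀
    have e : G 0 x₀ = x₀ := hG0 hx₀
    have hG0c : ContinuousOn (G 0) U := continuousOn_id.congr hG0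
    refine hA.preservesAt hc hc (hU.mem_nhds hx₀) hG0c (hGi 0) hcx (by rwa [e]) ?_
    refine (hA.compatible c hc c hc x₀ ⟨hcx, hcx⟩).congr ?_
    have hcs : ContinuousAt c.symm (c x₀) := c.continuousAt_symm (c.map_source hcx)
    filter_upwards [hcs (by rw [c.left_inv hcx]; exact hU.mem_nhds hx₀)] with z hz
    simp only [Function.comp_apply]
    rw [hG0 hz]
    rfl
  have h1 : PreservesAt A (G 1) x₀ :=
    hA.preservesAt_family hU hG hGi (x := fun _ => x₀) continuous_const (fun _ => hx₀) 0 1 h0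
  have h2 : PreservesAt A f x₀ := by
    obtain ⟨c, hc, hcx⟩ := hA.covers x₀
    obtain ⟨d, hd, hdx⟩ := hA.covers (f x₀)
    have e : G 1 x₀ = f x₀ := hG1 hx₀
    refine hA.preservesAt hc hd Filter.univ_mem hf.continuousOn hfi.injOn hcx hdx ?_
    refine (h1 c hc hcx d hd (by rwa [e])).congr ?_
    have hcs : ContinuousAt c.symm (c x₀) := c.continuousAt_symm (c.map_source hcx)
    filter_upwards [hcs (by rw [c.left_inv hcx]; exact hU.mem_nhds hx₀)] with z hz
    simp only [Function.comp_apply]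
    rw [hG1 hz]
  exact hA.preservesAt_family (Y := S) (G := fun _ => f) (x := id) isOpen_univ
    (hf.comp continuous_snd).continuousOn (fun _ => hfi.injOn) continuous_id
    (fun _ => trivial) x₀ x h2

/-- The charts of `A` together with their pullbacks under `f` again form an oriented atlas: the
mixed transitions are `f` and its inverse in charts of `A`. Maximality of `A` then absorbs the
pullbacks. -/
theorem IsOrientation.trans_mem [PreconnectedSpace S] {A : Set (OpenPartialHomeomorph S ℂ)}
    (hA : IsOrientation A) {f : S ≃ₜ S} (h : LocallyIsotopicToId f)
    (h' : LocallyIsotopicToId f.symm) {c : OpenPartialHomeomorph S ℂ} (hc : c ∈ A) :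
    f.transOpenPartialHomeomorph c ∈ A := by
  have hf := hA.1.preservesAt_of_isotopic f.continuous f.injective h
  have hf' := hA.1.preservesAt_of_isotopic f.symm.continuous f.symm.injective h'
  have hB : IsOrientedAtlas (A ∪ (f.transOpenPartialHomeomorph ·) '' A) := by
    constructor
    · intro x
      obtain ⟨c, hc, hx⟩ := hA.1.covers x
      exact ⟨c, Or.inl hc, hx⟩
    · rintro c (hc | ⟨c, hc, rfl⟩) d (hd | ⟨d, hd, rfl⟩) x ⟨hx, hx'⟩
      · exact hA.1.compatible c hc d hd x ⟨hx, hx'⟩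
      · exact hf x c hc hx d hd hx'
      · have := hf' (f x) c hc hx d hd (by simpa using hx')
        exact this
      · have := hA.1.compatible c hc d hd (f x) ⟨hx, hx'⟩
        refine this.congr (Filter.Eventually.of_forall fun z => ?_)
        simp
  exact hA.2 hB Set.subset_union_left (Or.inr ⟨c, hc, rfl⟩)

/-- A homeomorphism of a connected surface that is locally isotopic to the identity somewhere
preserves orientation. -/
theorem mem_homeoPlus_of_locallyIsotopicToId [PreconnectedSpace S] {f : S ≃ₜ S}
    (h : LocallyIsotopicToId f) (h' : LocallyIsotopicToId f.symm) : f ∈ HomeoPlus S := by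
  intro A hA c
  refine ⟨fun hc => ?_, fun hc => hA.trans_mem h h' hc⟩
  have := hA.trans_mem (f := f.symm) h' h hc
  have e : f.symm.transOpenPartialHomeomorph (f.transOpenPartialHomeomorph c) = c := by
    ext x
    · exact congrArg c (f.apply_symm_apply x)
    · exact f.apply_symm_apply (c.symm x)
    · simp
  rwa [e] at this

end Orientation

/-! ### Radial homeomorphisms of the plane and changes of radius -/

theorem exists_orderIso_fix_ge {m a b : ℝ} (ha : a < m) (hb : b < m) :
    ∃ G : ℝ ≃o ℝ, (∀ s, m ≤ s → G s = s) ∧ G a = b := by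
  -- The map is the identity above `m` and has slope `κ` below. The slope `(m - b) / (m - a)` sends
  -- `a` to `b`, and the inverse has slope `κ⁻¹`.
  have h : ∀ κ : ℝ, 0 < κ → StrictMono fun s : ℝ => max (s - m) 0 + κ * min (s - m) 0 + m := by
    intro κ hκ s t hst
    rcases le_total m s with h1 | h1
    · have h2 : m ≤ t := h1.trans hst.le
      simp only [max_eq_left (sub_nonneg.2 h1), max_eq_left (sub_nonneg.2 h2),
        min_eq_right (sub_nonneg.2 h1), min_eq_right (sub_nonneg.2 h2)]
      linarith
    · have h3 : κ * min (s - m) 0 ≤ κ * min (t - m) 0 :=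
        mul_le_mul_of_nonneg_left (min_le_min_right _ (by linarith)) hκ.le
      rcases le_total m t with h2 | h2
      · simp only [max_eq_right (sub_nonpos.2 h1), max_eq_left (sub_nonneg.2 h2),
          min_eq_left (sub_nonpos.2 h1), min_eq_right (sub_nonneg.2 h2)]
        have : κ * (s - m) ≤ 0 := mul_nonpos_of_nonneg_of_nonpos hκ.le (by linarith)
        rcases eq_or_lt_of_le h1 with h4 | h4
        · subst h4
          linarith
        · have : κ * (s - m) < 0 := mul_neg_of_pos_of_neg hκ (by linarith)
          linarith
      · simp only [max_eq_right (sub_nonpos.2 h1), max_eq_right (sub_nonpos.2 h2),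
          min_eq_left (sub_nonpos.2 h1), min_eq_left (sub_nonpos.2 h2)]
        have : κ * (s - m) < κ * (t - m) := mul_lt_mul_of_pos_left (by linarith) hκ
        linarith
  have hκ : 0 < (m - b) / (m - a) := div_pos (by linarith) (by linarith)
  set κ := (m - b) / (m - a) with hκdef
  refine ⟨(h κ hκ).orderIsoOfRightInverse _ (fun s => max (s - m) 0 + κ⁻¹ * min (s - m) 0 + m) ?_,
    ?_, ?_⟩
  · intro s
    rcases le_total m s with h1 | h1
    · simp only [max_eq_left (sub_nonneg.2 h1), min_eq_right (sub_nonneg.2 h1), mul_zero, add_zero,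
        sub_add_cancel]
    · have h2 : κ⁻¹ * (s - m) ≤ 0 :=
        mul_nonpos_of_nonneg_of_nonpos (inv_pos.2 hκ).le (by linarith)
      simp only [max_eq_right (sub_nonpos.2 h1), min_eq_left (sub_nonpos.2 h1), zero_add,
        add_sub_cancel_right, max_eq_right h2, min_eq_left h2]
      field_simp
      ring
  · intro s hs
    change max (s - m) 0 + κ * min (s - m) 0 + m = s
    simp only [max_eq_left (sub_nonneg.2 hs), min_eq_right (sub_nonneg.2 hs)]
    ring
  · change max (a - m) 0 + κ * min (a - m) 0 + m = b
    simp only [max_eq_right (sub_nonpos.2 ha.le), min_eq_left (sub_nonpos.2 ha.le)]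
    have : m - a ≠ 0 := by linarith
    rw [hκdef]
    field_simp
    ring

theorem exists_orderIso_fix_le {m a b : ℝ} (ha : m < a) (hb : m < b) :
    ∃ G : ℝ ≃o ℝ, (∀ s, s ≤ m → G s = s) ∧ G a = b := by
  obtain ⟨G, hG, hGa⟩ := exists_orderIso_fix_ge (neg_lt_neg ha) (neg_lt_neg hb)
  refine ⟨(OrderIso.neg ℝ).trans (G.dual.trans (OrderIso.neg ℝ).symm), fun s hs => ?_, ?_⟩
  · change -(G (-s)) = s
    rw [hG _ (by linarith), neg_neg]
  · change -(G (-a)) = b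
    rw [hGa, neg_neg]

/-- A first map takes `a` to `b` but may displace `0`. A second one, fixed from `b` on, brings the
image of `0` back. -/
theorem exists_orderIso_rescale {m a b : ℝ} (ha : 0 < a) (hb : 0 < b) (ham : a < m) (hbm : b < m) :
    ∃ G : ℝ ≃o ℝ, (∀ s, m ≤ s → G s = s) ∧ G a = b ∧ G 0 = 0 := by
  obtain ⟨G₁, h1, h1a⟩ := exists_orderIso_fix_ge ham hbm
  have h10 : G₁ 0 < b := by
    rw [← h1a]
    exact G₁.strictMono ha
  obtain ⟨G₂, h2, h20⟩ := exists_orderIso_fix_ge h10 hb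
  refine ⟨G₁.trans G₂, fun s hs => ?_, ?_, h20⟩
  · rw [OrderIso.trans_apply, h1 s hs, h2 s (by linarith)]
  · rw [OrderIso.trans_apply, h1a, h2 b le_rfl]

/-- The map of the plane that acts by `G` on the distance to the origin. -/
noncomputable def radialMap (G : ℝ → ℝ) (p : ℂ) : ℂ := ((G ‖p‖ / ‖p‖ : ℝ) : ℂ) * p

theorem norm_radialMap {G : ℝ ≃o ℝ} (h0 : G 0 = 0) (p : ℂ) : ‖radialMap G p‖ = G ‖p‖ := by
  rcases eq_or_ne p 0 with rfl | hp
  · simp [radialMap, h0]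
  · have h1 : 0 < ‖p‖ := norm_pos_iff.2 hp
    have h2 : 0 < G ‖p‖ := by
      rw [← h0]
      exact G.strictMono h1
    rw [radialMap, norm_mul, Complex.norm_real, Real.norm_of_nonneg (div_pos h2 h1).le,
      div_mul_cancel₀ _ h1.ne']

theorem radialMap_of_eq {G : ℝ → ℝ} {p : ℂ} (h : G ‖p‖ = ‖p‖) : radialMap G p = p := by
  rcases eq_or_ne p 0 with rfl | hp
  · simp [radialMap]
  · rw [radialMap, h, div_self (norm_ne_zero_iff.2 hp)]
    simp

theorem continuous_radialMap {G : ℝ ≃o ℝ} (h0 : G 0 = 0) : Continuous (radialMap G) := by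
  rw [continuous_iff_continuousAt]
  intro p
  have hG : Continuous G := G.continuous
  rcases eq_or_ne p 0 with rfl | hp
  · have e : radialMap G 0 = 0 := by simp [radialMap]
    rw [ContinuousAt, e, tendsto_zero_iff_norm_tendsto_zero]
    simp only [norm_radialMap h0]
    have : Continuous fun p : ℂ => G ‖p‖ := hG.comp continuous_norm
    have h1 := this.tendsto 0
    rwa [norm_zero, h0] at h1
  · have h1 : ‖p‖ ≠ 0 := norm_ne_zero_iff.2 hp
    refine ContinuousAt.mul ?_ continuousAt_id
    refine Complex.continuous_ofReal.continuousAt.comp (f := fun p : ℂ => G ‖p‖ / ‖p‖) ?_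
    exact (hG.comp continuous_norm).continuousAt.div continuous_norm.continuousAt h1

theorem radialMap_symm_radialMap {G : ℝ ≃o ℝ} (h0 : G 0 = 0) (p : ℂ) :
    radialMap G.symm (radialMap G p) = p := by
  rcases eq_or_ne p 0 with rfl | hp
  · simp [radialMap]
  · have h1 : 0 < ‖p‖ := norm_pos_iff.2 hp
    have h2 : 0 < G ‖p‖ := by
      rw [← h0]
      exact G.strictMono h1
    rw [radialMap, norm_radialMap h0, G.symm_apply_apply, radialMap, ← mul_assoc,
      ← Complex.ofReal_mul]
    have : ‖p‖ / G ‖p‖ * (G ‖p‖ / ‖p‖) = 1 := by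
      field_simp [h1.ne', h2.ne']
    rw [this]
    simp

/-- The homeomorphism of the plane that acts by `G` on the distance to the origin. -/
noncomputable def radialHomeo (G : ℝ ≃o ℝ) (h0 : G 0 = 0) : ℂ ≃ₜ ℂ where
  toFun := radialMap G
  invFun := radialMap G.symm
  left_inv := radialMap_symm_radialMap h0
  right_inv := by
    have h0' : G.symm 0 = 0 := by rw [G.symm_apply_eq, h0]
    intro p
    simpa using radialMap_symm_radialMap (G := G.symm) h0' p
  continuous_toFun := continuous_radialMap h0
  continuous_invFun := continuous_radialMap (by rw [G.symm_apply_eq, h0])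

/-- A homeomorphism of the plane that carries the disc of radius `R` about the origin with holes of
radius `r` about the points `c i` to another such domain. -/
structure CarriesDomain {ι : Type*} (h : ℂ ≃ₜ ℂ) (R r : ℝ) (c : ι → ℂ) (R' r' : ℝ) (c' : ι → ℂ) :
    Prop where
  outer_lt : ∀ p, ‖h p‖ < R' ↔ ‖p‖ < R
  outer_le : ∀ p, ‖h p‖ ≤ R' ↔ ‖p‖ ≤ R
  inner_lt : ∀ i p, ‖h p - c' i‖ < r' ↔ ‖p - c i‖ < r
  inner_le : ∀ i p, ‖h p - c' i‖ ≤ r' ↔ ‖p - c i‖ ≤ r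

theorem CarriesDomain.trans {ι : Type*} {h h' : ℂ ≃ₜ ℂ} {R r : ℝ} {c : ι → ℂ} {R' r' : ℝ}
    {c' : ι → ℂ} {R'' r'' : ℝ} {c'' : ι → ℂ} (H : CarriesDomain h R r c R' r' c')
    (H' : CarriesDomain h' R' r' c' R'' r'' c'') :
    CarriesDomain (h.trans h') R r c R'' r'' c'' where
  outer_lt p := (H'.outer_lt (h p)).trans (H.outer_lt p)
  outer_le p := (H'.outer_le (h p)).trans (H.outer_le p)
  inner_lt i p := (H'.inner_lt i (h p)).trans (H.inner_lt i p)
  inner_le i p := (H'.inner_le i (h p)).trans (H.inner_le i p)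

/-- The radial map fixes the disc of radius `ρ`, which contains all holes, and changes only
distances beyond it. -/
theorem exists_carriesDomain_outer {ι : Type*} {R R' r ρ : ℝ} {c : ι → ℂ}
    (hc : ∀ i, ‖c i‖ + r < ρ) (hρ0 : 0 ≤ ρ) (hR : ρ < R) (hR' : ρ < R') :
    ∃ h, CarriesDomain h R r c R' r c := by
  obtain ⟨G, hG, hGR⟩ := exists_orderIso_fix_le hR hR'
  have h0 : G 0 = 0 := hG 0 hρ0
  have hn : ∀ p, ‖radialHomeo G h0 p‖ = G ‖p‖ := norm_radialMap h0
  have hfix : ∀ p, ‖p‖ ≤ ρ → radialHomeo G h0 p = p := fun p hp => radialMap_of_eq (hG _ hp)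
  have far : ∀ i p, ρ < ‖p‖ → r < ‖p - c i‖ := fun i p hp => by
    have := norm_sub_norm_le p (c i)
    have := hc i
    linarith
  have far' : ∀ i p, ρ < ‖p‖ → r < ‖radialHomeo G h0 p - c i‖ := fun i p hp => by
    refine far i _ ?_
    rw [hn, ← hG ρ le_rfl]
    exact G.strictMono hp
  refine ⟨radialHomeo G h0, ?_, ?_, ?_, ?_⟩
  · intro p
    rw [hn, ← hGR, G.lt_iff_lt]
  · intro p
    rw [hn, ← hGR, G.le_iff_le]
  · intro i p
    rcases le_or_gt ‖p‖ ρ with hp | hp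
    · rw [hfix p hp]
    · exact iff_of_false (not_lt.2 (far' i p hp).le) (not_lt.2 (far i p hp).le)
  · intro i p
    rcases le_or_gt ‖p‖ ρ with hp | hp
    · rw [hfix p hp]
    · exact iff_of_false (not_le.2 (far' i p hp)) (not_le.2 (far i p hp))

section Rescale

variable {ι : Type*} [Fintype ι]

/-- Acts as the radial map of `G` about each of the points `c i`, if `G` is the identity beyond
half of the least distance of two of these points. -/
noncomputable def multiRadialMap (G : ℝ → ℝ) (c : ι → ℂ) (p : ℂ) : ℂ :=
  p + ∑ i, (radialMap G (p - c i) - (p - c i))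

variable {G : ℝ ≃o ℝ} {m : ℝ} {c : ι → ℂ}

theorem multiRadialMap_of_mem (hG : ∀ s, m ≤ s → G s = s) (hc : ∀ i j, i ≠ j → 2 * m ≤ ‖c i - c j‖)
    {p : ℂ} {i : ι} (hp : ‖p - c i‖ ≤ m) :
    multiRadialMap G c p = c i + radialMap G (p - c i) := by
  classical
  unfold multiRadialMap
  rw [Finset.sum_eq_single i]
  · ring
  · intro j _ hj
    rw [radialMap_of_eq, sub_self]
    apply hG
    have h1 := hc i j hj.symm
    have h2 : ‖c i - c j‖ ≤ ‖p - c i‖ + ‖p - c j‖ := by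
      have := norm_sub_le (p - c j) (p - c i)
      rw [sub_sub_sub_cancel_left] at this
      linarith
    linarith
  · simp

theorem multiRadialMap_of_notMem (hG : ∀ s, m ≤ s → G s = s) {p : ℂ}
    (hp : ∀ i, m ≤ ‖p - c i‖) : multiRadialMap G c p = p := by
  unfold multiRadialMap
  rw [Finset.sum_eq_zero, add_zero]
  intro i _
  rw [radialMap_of_eq (hG _ (hp i)), sub_self]

theorem norm_multiRadialMap_sub (hG : ∀ s, m ≤ s → G s = s) (h0 : G 0 = 0)
    (hc : ∀ i j, i ≠ j → 2 * m ≤ ‖c i - c j‖) {p : ℂ} {i : ι} (hp : ‖p - c i‖ ≤ m) :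
    ‖multiRadialMap G c p - c i‖ = G ‖p - c i‖ := by
  rw [multiRadialMap_of_mem hG hc hp, add_sub_cancel_left, norm_radialMap h0]

theorem multiRadialMap_symm (hG : ∀ s, m ≤ s → G s = s) (h0 : G 0 = 0)
    (hc : ∀ i j, i ≠ j → 2 * m ≤ ‖c i - c j‖) (p : ℂ) :
    multiRadialMap G.symm c (multiRadialMap G c p) = p := by
  have hG' : ∀ s, m ≤ s → G.symm s = s := fun s hs => by rw [G.symm_apply_eq, hG s hs]
  by_cases h : ∃ i, ‖p - c i‖ ≤ m
  · obtain ⟨i, hi⟩ := h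
    have h1 : ‖multiRadialMap G c p - c i‖ ≤ m := by
      rw [norm_multiRadialMap_sub hG h0 hc hi, ← hG m le_rfl]
      exact G.monotone hi
    rw [multiRadialMap_of_mem hG' hc h1, multiRadialMap_of_mem hG hc hi, add_sub_cancel_left,
      radialMap_symm_radialMap h0, add_sub_cancel]
  · push Not at h
    rw [multiRadialMap_of_notMem hG fun i => (h i).le,
      multiRadialMap_of_notMem hG' fun i => (h i).le]

/-- The change of hole radius takes place in the discs of radius `m` about the centers. These do not
overlap and lie inside the outer circle, so the radial maps do not interfere. -/
theorem exists_carriesDomain_rescale {R a b : ℝ} (ha : 0 < a) (hb : 0 < b) (ham : a < m)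
    (hbm : b < m) (hc : ∀ i j, i ≠ j → 2 * m ≤ ‖c i - c j‖) (hR : ∀ i, ‖c i‖ + m < R) :
    ∃ h, CarriesDomain h R a c R b c := by
  obtain ⟨G, hG, hGa, h0⟩ := exists_orderIso_rescale ha hb ham hbm
  have h0' : G.symm 0 = 0 := by rw [G.symm_apply_eq, h0]
  have hG' : ∀ s, m ≤ s → G.symm s = s := fun s hs => by rw [G.symm_apply_eq, hG s hs]
  have hcont : ∀ G : ℝ ≃o ℝ, G 0 = 0 → Continuous (multiRadialMap G c) := fun G h0 => by
    have := continuous_radialMap h0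
    unfold multiRadialMap
    fun_prop
  let H : ℂ ≃ₜ ℂ :=
    { toFun := multiRadialMap G c
      invFun := multiRadialMap G.symm c
      left_inv := multiRadialMap_symm hG h0 hc
      right_inv := by
        intro p
        simpa using multiRadialMap_symm (G := G.symm) hG' h0' hc p
      continuous_toFun := hcont G h0
      continuous_invFun := hcont G.symm h0' }
  have hH : ∀ p, H p = multiRadialMap G c p := fun _ => rfl
  have near : ∀ p i, ‖p - c i‖ ≤ m → ‖H p - c i‖ = G ‖p - c i‖ := fun p i hp =>
    norm_multiRadialMap_sub hG h0 hc hp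
  have fixed : ∀ p, (∀ i, m ≤ ‖p - c i‖) → H p = p := fun p hp => multiRadialMap_of_notMem hG hp
  have out : ∀ p i, m < ‖p - c i‖ → m < ‖H p - c i‖ := fun p i hp => by
    by_contra hcon
    push Not at hcon
    have e : multiRadialMap G.symm c (H p) = p := multiRadialMap_symm hG h0 hc p
    have h1 := norm_multiRadialMap_sub hG' h0' hc hcon
    rw [e] at h1
    have h2 : G.symm ‖H p - c i‖ ≤ G.symm m := G.symm.monotone hcon
    rw [hG' m le_rfl] at h2
    linarith
  have inside : ∀ p i, ‖p - c i‖ ≤ m → ‖p‖ < R := fun p i hp => by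
    have h1 := norm_sub_norm_le p (c i)
    have := hR i
    linarith
  have outer : ∀ p, H p = p ∨ (‖p‖ < R ∧ ‖H p‖ < R) := fun p => by
    by_cases h : ∃ i, ‖p - c i‖ ≤ m
    · obtain ⟨i, hi⟩ := h
      refine Or.inr ⟨inside p i hi, inside _ i ?_⟩
      rw [near p i hi, ← hG m le_rfl]
      exact G.monotone hi
    · push Not at h
      exact Or.inl (fixed p fun i => (h i).le)
  refine ⟨H, ?_, ?_, ?_, ?_⟩
  · intro p
    rcases outer p with h | ⟨h, h'⟩
    · rw [h]
    · exact iff_of_true h' h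
  · intro p
    rcases outer p with h | ⟨h, h'⟩
    · rw [h]
    · exact iff_of_true h'.le h.le
  · intro i p
    rcases le_or_gt ‖p - c i‖ m with h | h
    · rw [near p i h, ← hGa, G.lt_iff_lt]
    · exact iff_of_false (not_lt.2 (hbm.trans (out p i h)).le) (not_lt.2 (ham.trans h).le)
  · intro i p
    rcases le_or_gt ‖p - c i‖ m with h | h
    · rw [near p i h, ← hGa, G.le_iff_le]
    · exact iff_of_false (not_le.2 (hbm.trans (out p i h))) (not_le.2 (ham.trans h))

end Rescale

/-! ### Moving points and holes in the plane -/

/-- Some homeomorphism of the plane with bounded support carries each `c i` to `c' i` and is a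
translation near `c i`. -/
def Translates {ι : Type*} (c c' : ι → ℂ) : Prop :=
  ∃ (h : ℂ ≃ₜ ℂ) (R r : ℝ), 0 < r ∧ (∀ x, R ≤ ‖x‖ → h x = x) ∧
    ∀ i v, ‖v‖ ≤ r → h (c i + v) = c' i + v

theorem Translates.refl {ι : Type*} (c : ι → ℂ) : Translates c c :=
  ⟨Homeomorph.refl ℂ, 0, 1, one_pos, fun _ _ => rfl, fun _ _ _ => rfl⟩

theorem Translates.symm {ι : Type*} {c c' : ι → ℂ} (H : Translates c c') : Translates c' c := by
  obtain ⟨h, R, r, hr, hR, hh⟩ := H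
  refine ⟨h.symm, R, r, hr, fun x hx => ?_, fun i v hv => ?_⟩
  · rw [h.symm_apply_eq, hR x hx]
  · rw [h.symm_apply_eq, hh i v hv]

theorem Translates.trans {ι : Type*} {c c' c'' : ι → ℂ} (H : Translates c c')
    (H' : Translates c' c'') : Translates c c'' := by
  obtain ⟨h, R, r, hr, hR, hh⟩ := H
  obtain ⟨h', R', r', hr', hR', hh'⟩ := H'
  refine ⟨h.trans h', max R R', min r r', lt_min hr hr', fun x hx => ?_, fun i v hv => ?_⟩
  · rw [Homeomorph.trans_apply, hR x ((le_max_left _ _).trans hx),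
      hR' x ((le_max_right _ _).trans hx)]
  · rw [Homeomorph.trans_apply, hh i v (hv.trans (min_le_left _ _)),
      hh' i v (hv.trans (min_le_right _ _))]

theorem exists_small_push (p q : ℂ) {δ : ℝ} (hδ : 0 < δ) (hq : ‖q - p‖ ≤ δ / 8) :
    ∃ h : ℂ ≃ₜ ℂ, (∀ x, δ / 2 ≤ ‖x - p‖ → h x = x) ∧
      ∀ v, ‖v‖ ≤ δ / 4 → h (p + v) = q + v := by
  -- A cutoff that is `1` up to `δ / 4` and `0` from `δ / 2` on. Its slope is at most `4 / δ` and
  -- `‖q - p‖ ≤ δ / 8`, so the perturbation of the identity has Lipschitz constant `1 / 2`, which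
  -- makes the map a homeomorphism.
  let χ : ℝ → ℝ := fun s => max 0 (min 1 (2 - 4 / δ * s))
  have hχ : ∀ s t, |χ s - χ t| ≤ 4 / δ * |s - t| := fun s t => by
    have h4 : (0 : ℝ) ≤ 4 / δ := by positivity
    have h1 : LipschitzWith (Real.toNNReal (4 / δ)) fun s : ℝ => 2 - 4 / δ * s := by
      refine LipschitzWith.of_dist_le_mul fun s t => ?_
      rw [Real.dist_eq, Real.dist_eq, Real.coe_toNNReal _ h4, ← abs_of_nonneg h4, ← abs_mul,
        ← abs_neg, abs_of_nonneg h4]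
      apply le_of_eq
      congr 1
      ring
    have h2 := ((h1.const_min 1).const_max 0).dist_le_mul s t
    rwa [Real.dist_eq, Real.dist_eq, Real.coe_toNNReal _ h4] at h2
  let f : ℂ → ℂ := fun x => x + (χ ‖x - p‖ : ℂ) * (q - p)
  have happ : ApproximatesLinearOn f ((ContinuousLinearEquiv.refl ℝ ℂ : ℂ ≃L[ℝ] ℂ) : ℂ →L[ℝ] ℂ)
      Set.univ (1 / 2) := by
    intro x _ y _
    have e : f x - f y - ((ContinuousLinearEquiv.refl ℝ ℂ : ℂ ≃L[ℝ] ℂ) : ℂ →L[ℝ] ℂ) (x - y) =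
        ((χ ‖x - p‖ - χ ‖y - p‖ : ℝ) : ℂ) * (q - p) := by
      simp only [f, ContinuousLinearEquiv.coe_coe, ContinuousLinearEquiv.refl_apply]
      push_cast
      ring
    rw [e, norm_mul, Complex.norm_real, Real.norm_eq_abs]
    have h1 := hχ ‖x - p‖ ‖y - p‖
    have h2 : |‖x - p‖ - ‖y - p‖| ≤ ‖x - y‖ := by
      have := abs_norm_sub_norm_le (x - p) (y - p)
      rwa [sub_sub_sub_cancel_right] at this
    calc |χ ‖x - p‖ - χ ‖y - p‖| * ‖q - p‖ ≤ (4 / δ * ‖x - y‖) * (δ / 8) := by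
          refine mul_le_mul (h1.trans ?_) hq (norm_nonneg _) (by positivity)
          exact mul_le_mul_of_nonneg_left h2 (by positivity)
      _ = ((1 / 2 : NNReal) : ℝ) * ‖x - y‖ := by
          push_cast
          field_simp
          ring
  have hN : ‖((ContinuousLinearEquiv.refl ℝ ℂ : ℂ ≃L[ℝ] ℂ).symm : ℂ →L[ℝ] ℂ)‖₊ = 1 := by
    apply NNReal.eq
    simp
  refine ⟨happ.toHomeomorph f (Or.inr ?_), fun x hx => ?_, fun v hv => ?_⟩
  · rw [hN, inv_one]
    exact div_lt_self one_pos (by norm_num)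
  · change f x = x
    have h1 : χ ‖x - p‖ = 0 := by
      apply max_eq_left
      refine (min_le_right _ _).trans ?_
      have : 4 / δ * (δ / 2) ≤ 4 / δ * ‖x - p‖ := mul_le_mul_of_nonneg_left hx (by positivity)
      have e : 4 / δ * (δ / 2) = 2 := by
        field_simp
        norm_num
      linarith
    simp [f, h1]
  · change f (p + v) = q + v
    have h1 : χ ‖p + v - p‖ = 1 := by
      have h2 : min 1 (2 - 4 / δ * ‖p + v - p‖) = 1 := by
        apply min_eq_left
        rw [add_sub_cancel_left]
        have : 4 / δ * ‖v‖ ≤ 4 / δ * (δ / 4) := mul_le_mul_of_nonneg_left hv (by positivity)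
        have e : 4 / δ * (δ / 4) = 1 := by field_simp
        linarith
      simp only [χ, h2]
      norm_num
    simp only [f, h1]
    push_cast
    ring

/-- `p` can be pushed to `q` in the complement of `F`. -/
def PushesPoint (F : Set ℂ) (p q : ℂ) : Prop :=
  Translates (fun o : Option F => o.elim p (↑)) (fun o : Option F => o.elim q (↑))

/-- Being pushable is symmetric and transitive, and it holds for nearby points by a small push. The
complement of a finite set in the plane is connected, so it holds for all pairs. -/
theorem pushesPoint {F : Set ℂ} (hF : F.Finite) {p q : ℂ} (hp : p ∉ F) (hq : q ∉ F) :
    PushesPoint F p q := by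
  have hconn : IsPreconnected Fᶜ :=
    (hF.countable.isConnected_compl_of_one_lt_rank (by simp)).isPreconnected
  refine hconn.induction₂ (PushesPoint F) ?_ (fun x y z _ _ _ h h' => h.trans h')
    (fun x y _ _ h => h.symm) hp hq
  intro x hx
  obtain ⟨δ, hδ, hball⟩ := Metric.mem_nhds_iff.1 (hF.isClosed.isOpen_compl.mem_nhds hx)
  refine mem_nhdsWithin_of_mem_nhds ?_
  filter_upwards [Metric.ball_mem_nhds x (by positivity : 0 < δ / 8)] with y hy
  rw [mem_ball_iff_norm] at hy
  obtain ⟨h, hfix, hmove⟩ := exists_small_push x y hδ hy.le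
  refine ⟨h, ‖x‖ + δ / 2, δ / 4, by positivity, fun z hz => hfix z ?_, ?_⟩
  · have := norm_sub_norm_le z x
    linarith
  · rintro (_ | ⟨z, hz⟩) v hv
    · exact hmove v hv
    · refine hfix _ ?_
      have h1 : δ ≤ ‖z - x‖ := by
        by_contra hcon
        push Not at hcon
        exact hball (mem_ball_iff_norm.2 hcon) hz
      have h2 : ‖z - x‖ ≤ ‖z + v - x‖ + ‖v‖ := by
        have := norm_sub_le (z + v - x) v
        rwa [show z + v - x - v = z - x by ring] at this
      change δ / 2 ≤ ‖z + v - x‖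
      linarith

section

variable {ι : Type*} [Finite ι]

theorem translates_update [DecidableEq ι] {c : ι → ℂ} (hc : Function.Injective c) (i : ι) {q : ℂ}
    (hq : ∀ j, j ≠ i → c j ≠ q) : Translates c (Function.update c i q) := by
  have hF : (c '' {i}ᶜ).Finite := Set.toFinite _
  obtain ⟨h, R, r, hr, hR, hh⟩ := pushesPoint hF (p := c i) (q := q)
    (by rintro ⟨j, hj, e⟩; exact hj (hc e)) (by rintro ⟨j, hj, e⟩; exact hq j hj e)
  refine ⟨h, R, r, hr, hR, fun j v hv => ?_⟩
  by_cases hj : j = i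
  · subst hj
    simpa using hh none v hv
  · rw [Function.update_of_ne hj]
    exact hh (some ⟨c j, j, hj, rfl⟩) v hv

/-- The points are moved one at a time. Since the two configurations are disjoint, no target is
occupied when its turn comes. -/
theorem translates_of_disjoint {c d : ι → ℂ} (hc : Function.Injective c)
    (hd : Function.Injective d) (hcd : ∀ i j, c i ≠ d j) : Translates c d := by
  classical
  cases nonempty_fintype ι
  have key : ∀ s : Finset ι, Translates c (s.piecewise d c) := by
    intro s
    induction s using Finset.induction_on with
    | empty => simpa using Translates.refl c
    | insert j s hj ih =>
      rw [Finset.piecewise_insert]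
      refine ih.trans (translates_update ?_ j ?_)
      · intro a b e
        by_cases ha : a ∈ s <;> by_cases hb : b ∈ s <;> simp only [Finset.piecewise, ha, hb] at e
        · exact hd e
        · exact absurd e.symm (hcd _ _)
        · exact absurd e (hcd _ _)
        · exact hc e
      · intro a ha e
        by_cases has : a ∈ s <;> simp only [Finset.piecewise, has] at e
        · exact ha (hd e)
        · exact hcd _ _ e
  simpa using key Finset.univ

/-- If the configurations overlap, a third one that avoids both serves as an intermediate stop. -/
theorem translates_of_injective {c d : ι → ℂ} (hc : Function.Injective c)
    (hd : Function.Injective d) : Translates c d := by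
  have hF : (Set.range c ∪ Set.range d).Finite := Set.toFinite _
  have : Infinite ↥((Set.range c ∪ Set.range d)ᶜ) := hF.infinite_compl.to_subtype
  obtain ⟨n, ⟨e⟩⟩ := Finite.exists_equiv_fin ι
  let a : ι → ℂ := fun i => Infinite.natEmbedding ↥((Set.range c ∪ Set.range d)ᶜ) (e i)
  have ha : Function.Injective a := by
    intro i j h
    exact e.injective (Fin.ext ((Infinite.natEmbedding _).injective (Subtype.ext h)))
  have hav : ∀ i, a i ∉ Set.range c ∪ Set.range d := fun i =>
    (Infinite.natEmbedding ↥((Set.range c ∪ Set.range d)ᶜ) (e i)).2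
  refine (translates_of_disjoint hc ha fun i j h => hav j (Or.inl ⟨i, h⟩)).trans
    (translates_of_disjoint hd ha fun i j h => hav j (Or.inr ⟨i, h⟩)).symm

end

/-- A homeomorphism that moves small holes, once the outer radius is large. -/
theorem exists_homeo_moving_holes {ι : Type*} [Finite ι] {c d : ι → ℂ} (hc : Function.Injective c)
    (hd : Function.Injective d) : ∃ (h : ℂ ≃ₜ ℂ) (R₀ r₀ : ℝ), 0 < r₀ ∧ (∀ x, R₀ ≤ ‖x‖ → h x = x) ∧
      ∀ R r, R₀ ≤ R → r ≤ r₀ → CarriesDomain h R r c R r d := by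
  obtain ⟨h, R₀, r₀, hr₀, hfix, hmove⟩ := translates_of_injective hc hd
  refine ⟨h, R₀, r₀, hr₀, hfix, fun R r hR hr => ?_⟩
  have back : ∀ x, R₀ ≤ ‖h x‖ → h x = x := fun x hx => h.injective (hfix _ hx)
  have hmove' : ∀ i p, ‖p - c i‖ ≤ r₀ → h p - d i = p - c i := fun i p hp => by
    have := hmove i (p - c i) hp
    rw [add_sub_cancel] at this
    rw [this, add_sub_cancel_left]
  have hback : ∀ i p, ‖h p - d i‖ ≤ r₀ → h p - d i = p - c i := fun i p hp => by
    have := hmove i (h p - d i) hp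
    rw [add_sub_cancel] at this
    linear_combination h.injective this
  refine ⟨fun p => ?_, fun p => ?_, fun i p => ?_, fun i p => ?_⟩
  · rw [← not_le, ← not_le, not_iff_not]
    refine ⟨fun H => ?_, fun H => ?_⟩
    · rwa [back p (hR.trans H)] at H
    · rwa [hfix p (hR.trans H)]
  · rw [← not_lt, ← not_lt, not_iff_not]
    refine ⟨fun H => ?_, fun H => ?_⟩
    · rwa [back p (hR.trans H.le)] at H
    · rwa [hfix p (hR.trans H.le)]
  · refine ⟨fun H => ?_, fun H => ?_⟩
    · rwa [hback i p (H.le.trans hr)] at H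
    · rwa [hmove' i p (H.le.trans hr)]
  · refine ⟨fun H => ?_, fun H => ?_⟩
    · rwa [hback i p (H.trans hr)] at H
    · rwa [hmove' i p (H.trans hr)]

theorem CarriesDomain.symm {ι : Type*} {h : ℂ ≃ₜ ℂ} {R r : ℝ} {c : ι → ℂ} {R' r' : ℝ}
    {c' : ι → ℂ} (H : CarriesDomain h R r c R' r' c') :
    CarriesDomain h.symm R' r' c' R r c where
  outer_lt p := by simpa using (H.outer_lt (h.symm p)).symm
  outer_le p := by simpa using (H.outer_le (h.symm p)).symm
  inner_lt i p := by simpa using (H.inner_lt i (h.symm p)).symm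
  inner_le i p := by simpa using (H.inner_le i (h.symm p)).symm

/-- The closed discs of radius `r` about the points `c i` are disjoint and contained in the open
disc of radius `R` about the origin. -/
structure IsHoleConfiguration {ι : Type*} (R r : ℝ) (c : ι → ℂ) : Prop where
  radius_pos : 0 < r
  outer_pos : 0 < R
  separated : ∀ i j, i ≠ j → 2 * r < ‖c i - c j‖
  inside : ∀ i, ‖c i‖ + r < R

theorem IsHoleConfiguration.injective {ι : Type*} {R r : ℝ} {c : ι → ℂ}
    (H : IsHoleConfiguration R r c) : Function.Injective c := by
  intro i j e
  by_contra hij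
  have := H.separated i j hij
  rw [e, sub_self, norm_zero] at this
  linarith [H.radius_pos]

section

variable {ι : Type*} [Fintype ι]

/-- The inequalities of a hole configuration are strict and finite in number. This leaves room for a
radius `m` slightly above `r` in which to shrink the holes, and for a radius `ρ` slightly below `R`
beyond which to enlarge the disc. -/
theorem IsHoleConfiguration.exists_carriesDomain_shrink {R r : ℝ} {c : ι → ℂ}
    (H : IsHoleConfiguration R r c) {R₁ ε : ℝ} (hR : R ≤ R₁) (hε : 0 < ε) (hεr : ε ≤ r) :
    ∃ h, CarriesDomain h R r c R₁ ε c := by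
  have h1 : ∀ᶠ m in 𝓝[>] r, (∀ i j, i ≠ j → 2 * m < ‖c i - c j‖) ∧ ∀ i, ‖c i‖ + m < R := by
    refine Filter.Eventually.and ?_ ?_
    · rw [Filter.eventually_all]
      intro i
      rw [Filter.eventually_all]
      intro j
      by_cases hij : i = j
      · simp [hij]
      · have : Filter.Tendsto (fun m : ℝ => 2 * m) (𝓝[>] r) (𝓝 (2 * r)) :=
          (continuous_const.mul continuous_id).continuousWithinAt
        filter_upwards [this.eventually_lt_const (H.separated i j hij)] with m hm _ using hm
    · rw [Filter.eventually_all]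
      intro i
      have : Filter.Tendsto (fun m : ℝ => ‖c i‖ + m) (𝓝[>] r) (𝓝 (‖c i‖ + r)) :=
        (continuous_const.add continuous_id).continuousWithinAt
      exact this.eventually_lt_const (H.inside i)
  obtain ⟨m, ⟨hm1, hm2⟩, hm⟩ := (h1.and self_mem_nhdsWithin).exists
  have hrm : r < m := hm
  obtain ⟨h, hh⟩ := exists_carriesDomain_rescale H.radius_pos hε hrm (hεr.trans_lt hrm)
    (fun i j hij => (hm1 i j hij).le) hm2
  have h2 : ∀ᶠ ρ in 𝓝[<] R, 0 < ρ ∧ ∀ i, ‖c i‖ + ε < ρ := by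
    refine Filter.Eventually.and ?_ ?_
    · exact mem_nhdsWithin_of_mem_nhds (lt_mem_nhds H.outer_pos)
    · rw [Filter.eventually_all]
      intro i
      exact mem_nhdsWithin_of_mem_nhds (lt_mem_nhds (by linarith [H.inside i]))
  obtain ⟨ρ, ⟨hρ0, hρ1⟩, hρ⟩ := (h2.and self_mem_nhdsWithin).exists
  have hρR : ρ < R := hρ
  obtain ⟨h', hh'⟩ := exists_carriesDomain_outer hρ1 hρ0.le hρR (hρR.trans_le hR)
  exact ⟨h.trans h', hh.trans hh'⟩

/-- Moving the centers requires small holes and a large disc. Both configurations are brought to a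
common such pair of radii, the centers are moved there, and the second change of radii is undone. -/
theorem IsHoleConfiguration.exists_carriesDomain {R r R' r' : ℝ} {c c' : ι → ℂ}
    (H : IsHoleConfiguration R r c) (H' : IsHoleConfiguration R' r' c') :
    ∃ h, CarriesDomain h R r c R' r' c' := by
  obtain ⟨h, R₀, r₀, hr₀, -, hh⟩ := exists_homeo_moving_holes H.injective H'.injective
  have hε : 0 < min r₀ (min r r') := lt_min hr₀ (lt_min H.radius_pos H'.radius_pos)
  obtain ⟨h1, hh1⟩ := H.exists_carriesDomain_shrink (R₁ := max R₀ (max R R'))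
    ((le_max_left R R').trans (le_max_right _ _)) hε
    ((min_le_right _ _).trans (min_le_left _ _))
  obtain ⟨h2, hh2⟩ := H'.exists_carriesDomain_shrink (R₁ := max R₀ (max R R'))
    ((le_max_right R R').trans (le_max_right _ _)) hε
    ((min_le_right _ _).trans (min_le_right _ _))
  exact ⟨_, (hh1.trans (hh _ _ (le_max_left _ _) (min_le_left _ _))).trans hh2.symm⟩

end

/-! ### Doubles of planar domains -/

/-- The surface `z² = P`, the double of `{P ≥ 0}`. -/
def doubleOf (P : ℂ → ℝ) : Set (ℂ × ℝ) := {q | q.2 ^ 2 = P q.1}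

/-- The sign jumps only where `f` vanishes, and there the factor `g` suppresses the jump. -/
theorem continuous_sign_mul {X : Type*} [TopologicalSpace X] {f g : X → ℝ} (hf : Continuous f)
    (hg : Continuous g) (h : ∀ x, f x = 0 → g x = 0) :
    Continuous fun x => ((SignType.sign (f x) : SignType) : ℝ) * g x := by
  rw [continuous_iff_continuousAt]
  intro x
  by_cases hx : f x = 0
  · have e : ((SignType.sign (f x) : SignType) : ℝ) * g x = 0 := by rw [h x hx, mul_zero]
    rw [ContinuousAt, e]
    refine squeeze_zero_norm (a := fun y => |g y|) (fun y => ?_) ?_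
    · rw [Real.norm_eq_abs, abs_mul]
      have : |((SignType.sign (f y) : SignType) : ℝ)| ≤ 1 := by
        cases SignType.sign (f y) <;> simp
      exact mul_le_of_le_one_left (abs_nonneg _) this
    · have := hg.abs.tendsto x
      rwa [h x hx, abs_zero] at this
  · refine ContinuousAt.mul ?_ hg.continuousAt
    have h1 := (continuousAt_sign_of_ne_zero hx).comp (f := f) hf.continuousAt
    exact (continuous_of_discreteTopology (f := fun s : SignType => (s : ℝ))).continuousAt.comp h1

theorem sign_mul_sqrt_sq_mul {s z : ℝ} (hs : 0 ≤ s) (h : z = 0 ↔ s = 0) :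
    (((SignType.sign z : SignType) : ℝ) * √s) ^ 2 = s ∧
      SignType.sign (((SignType.sign z : SignType) : ℝ) * √s) = SignType.sign z := by
  rcases lt_trichotomy z 0 with hz | rfl | hz
  · have hs' : 0 < √s := Real.sqrt_pos.2 (hs.lt_of_ne' fun e => hz.ne (h.2 e))
    rw [sign_neg hz]
    simp [Real.sq_sqrt hs, hs']
  · simp [h.1 rfl]
  · have hs' : 0 < √s := Real.sqrt_pos.2 (hs.lt_of_ne' fun e => hz.ne' (h.2 e))
    rw [sign_pos hz]
    simp [Real.sq_sqrt hs, hs']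

theorem sign_mul_sqrt_of_sq {s z : ℝ} (h : z ^ 2 = s) :
    ((SignType.sign z : SignType) : ℝ) * √s = z := by
  rw [← h, Real.sqrt_sq_eq_abs, sign_mul_abs]

section

variable {P P' : ℂ → ℝ} {h : ℂ ≃ₜ ℂ}

/-- The map of doubles that covers the planar map `h`. -/
noncomputable def doubleMap (P' : ℂ → ℝ) (h : ℂ → ℂ) (q : ℂ × ℝ) : ℂ × ℝ :=
  (h q.1, ((SignType.sign q.2 : SignType) : ℝ) * √(P' (h q.1)))

theorem doubleMap_spec (h1 : ∀ p, 0 < P' (h p) ↔ 0 < P p) (h2 : ∀ p, 0 ≤ P' (h p) ↔ 0 ≤ P p)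
    {q : ℂ × ℝ} (hq : q ∈ doubleOf P) : 0 ≤ P' (h q.1) ∧ (q.2 = 0 ↔ P' (h q.1) = 0) := by
  have hq' : q.2 ^ 2 = P q.1 := hq
  have h3 : 0 ≤ P' (h q.1) := (h2 _).2 (hq' ▸ sq_nonneg _)
  refine ⟨h3, ?_⟩
  rw [← sq_eq_zero_iff, hq']
  have h4 : 0 ≤ P q.1 := (h2 _).1 h3
  constructor
  · intro e
    refine le_antisymm (not_lt.1 fun hlt => ?_) h3
    exact ((h1 _).1 hlt).ne' e
  · intro e
    refine le_antisymm (not_lt.1 fun hlt => ?_) h4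
    exact ((h1 _).2 hlt).ne' e

theorem doubleMap_mem (h1 : ∀ p, 0 < P' (h p) ↔ 0 < P p) (h2 : ∀ p, 0 ≤ P' (h p) ↔ 0 ≤ P p)
    {q : ℂ × ℝ} (hq : q ∈ doubleOf P) : doubleMap P' h q ∈ doubleOf P' :=
  (sign_mul_sqrt_sq_mul (doubleMap_spec h1 h2 hq).1 (doubleMap_spec h1 h2 hq).2).1

theorem doubleMap_doubleMap (h1 : ∀ p, 0 < P' (h p) ↔ 0 < P p)
    (h2 : ∀ p, 0 ≤ P' (h p) ↔ 0 ≤ P p) {q : ℂ × ℝ} (hq : q ∈ doubleOf P) :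
    doubleMap P h.symm (doubleMap P' h q) = q := by
  have hq' : q.2 ^ 2 = P q.1 := hq
  unfold doubleMap
  ext1
  · simp
  · simp only [h.symm_apply_apply]
    rw [(sign_mul_sqrt_sq_mul (doubleMap_spec h1 h2 hq).1 (doubleMap_spec h1 h2 hq).2).2,
      sign_mul_sqrt_of_sq hq']

theorem continuous_doubleMap (hP : Continuous P') (h1 : ∀ p, 0 < P' (h p) ↔ 0 < P p)
    (h2 : ∀ p, 0 ≤ P' (h p) ↔ 0 ≤ P p) :
    Continuous fun q : doubleOf P => doubleMap P' h q := by
  refine Continuous.prodMk (by fun_prop) ?_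
  refine continuous_sign_mul (f := fun q : doubleOf P => (q : ℂ × ℝ).2)
    (g := fun q : doubleOf P => √(P' (h (q : ℂ × ℝ).1))) (by fun_prop)
    (Real.continuous_sqrt.comp (hP.comp (by fun_prop))) fun q hq => ?_
  rw [(doubleMap_spec h1 h2 q.2).2.1 hq, Real.sqrt_zero]

/-- The sheet is remembered by the sign of the height, and the height itself is recomputed as `√P'`.
Both sign conditions are needed, so that the edges `P = 0`, where the sheets meet, correspond. -/
theorem doubleOf_homeomorph (hP : Continuous P) (hP' : Continuous P')
    (h1 : ∀ p, 0 < P' (h p) ↔ 0 < P p) (h2 : ∀ p, 0 ≤ P' (h p) ↔ 0 ≤ P p) :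
    Nonempty (doubleOf P ≃ₜ doubleOf P') := by
  have h1' : ∀ p, 0 < P (h.symm p) ↔ 0 < P' p := fun p => by
    simpa using (h1 (h.symm p)).symm
  have h2' : ∀ p, 0 ≤ P (h.symm p) ↔ 0 ≤ P' p := fun p => by
    simpa using (h2 (h.symm p)).symm
  exact ⟨{
    toFun := fun q => ⟨doubleMap P' h q, doubleMap_mem h1 h2 q.2⟩
    invFun := fun q => ⟨doubleMap P h.symm q, doubleMap_mem h1' h2' q.2⟩
    left_inv := fun q => Subtype.ext (doubleMap_doubleMap h1 h2 q.2)
    right_inv := fun q => Subtype.ext (by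
      simpa using doubleMap_doubleMap (h := h.symm) h1' h2' q.2)
    continuous_toFun := (continuous_doubleMap hP' h1 h2).subtype_mk _
    continuous_invFun := (continuous_doubleMap hP h1' h2').subtype_mk _ }⟩

end

/-- A function that is positive exactly inside the disc of radius `R` and outside the discs of
radius `r` about the points `c i`. -/
noncomputable def holeFunction {ι : Type*} (R r : ℝ) (c : ι → ℂ) (p : ℂ) : ℝ :=
  min (R - ‖p‖) (Metric.infDist p (Set.range c) - r)

theorem continuous_holeFunction {ι : Type*} (R r : ℝ) (c : ι → ℂ) : Continuous (holeFunction R r c) :=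
  (continuous_const.sub continuous_norm).min
    ((Metric.continuous_infDist_pt _).sub continuous_const)

theorem infDist_le_norm_sub {ι : Type*} (c : ι → ℂ) (p : ℂ) (i : ι) :
    Metric.infDist p (Set.range c) ≤ ‖p - c i‖ := by
  rw [← dist_eq_norm]
  exact Metric.infDist_le_dist_of_mem ⟨i, rfl⟩

section

variable {ι : Type*} [Finite ι] [Nonempty ι]

theorem exists_infDist_eq (c : ι → ℂ) (p : ℂ) :
    ∃ i, Metric.infDist p (Set.range c) = ‖p - c i‖ := by
  obtain ⟨_, ⟨i, rfl⟩, e⟩ := (Set.finite_range c).isCompact.exists_infDist_eq_dist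
    (Set.range_nonempty c) p
  exact ⟨i, by rw [e, dist_eq_norm]⟩

theorem lt_infDist_range {c : ι → ℂ} {p : ℂ} {r : ℝ} :
    r < Metric.infDist p (Set.range c) ↔ ∀ i, r < ‖p - c i‖ := by
  refine ⟨fun h i => h.trans_le (infDist_le_norm_sub c p i), fun h => ?_⟩
  obtain ⟨i, e⟩ := exists_infDist_eq c p
  exact e ▸ h i

theorem le_infDist_range {c : ι → ℂ} {p : ℂ} {r : ℝ} :
    r ≤ Metric.infDist p (Set.range c) ↔ ∀ i, r ≤ ‖p - c i‖ := by
  refine ⟨fun h i => h.trans (infDist_le_norm_sub c p i), fun h => ?_⟩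
  obtain ⟨i, e⟩ := exists_infDist_eq c p
  exact e ▸ h i

theorem holeFunction_pos {R r : ℝ} {c : ι → ℂ} {p : ℂ} :
    0 < holeFunction R r c p ↔ ‖p‖ < R ∧ ∀ i, r < ‖p - c i‖ := by
  rw [holeFunction, lt_min_iff, sub_pos, sub_pos, lt_infDist_range]

theorem holeFunction_nonneg {R r : ℝ} {c : ι → ℂ} {p : ℂ} :
    0 ≤ holeFunction R r c p ↔ ‖p‖ ≤ R ∧ ∀ i, r ≤ ‖p - c i‖ := by
  rw [holeFunction, le_min_iff, sub_nonneg, sub_nonneg, le_infDist_range]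

end

/-! ### The standard surface as the double of a disc with holes -/

/-- Euclidean 3-space as the product of the complex plane and the third axis. -/
noncomputable def spaceHomeo : EuclideanSpace ℝ (Fin 3) ≃ₜ ℂ × ℝ where
  toFun x := (⟨x 0, x 1⟩, x 2)
  invFun q := !₂[q.1.re, q.1.im, q.2]
  left_inv x := by
    ext i
    fin_cases i <;> rfl
  right_inv q := rfl
  continuous_toFun := by
    refine Continuous.prodMk ?_ (by fun_prop)
    have : (fun x : EuclideanSpace ℝ (Fin 3) => (⟨x 0, x 1⟩ : ℂ)) =
        fun x => (x 0 : ℂ) + (x 1 : ℂ) * Complex.I := by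
      funext x
      rw [Complex.mk_eq_add_mul_I]
    rw [this]
    fun_prop
  continuous_invFun := by
    refine (PiLp.continuous_toLp 2 _).comp (continuous_pi fun i => ?_)
    fin_cases i
    · exact Complex.continuous_re.comp continuous_fst
    · exact Complex.continuous_im.comp continuous_fst
    · exact continuous_snd

/-- The polynomial that defines the standard surface. -/
noncomputable def standardPolynomial (g : ℕ) (p : ℂ) : ℝ :=
  (9 * ((g : ℝ) + 1) ^ 2 - p.re ^ 2 - p.im ^ 2) *
    ∏ j ∈ Finset.Icc 1 g, ((p.re - 3 * (j : ℝ)) ^ 2 + p.im ^ 2 - 1)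

theorem continuous_standardPolynomial (g : ℕ) : Continuous (standardPolynomial g) := by
  unfold standardPolynomial
  fun_prop

theorem standardSurface_homeomorph (g : ℕ) :
    Nonempty (standardSurface g ≃ₜ doubleOf (standardPolynomial g)) :=
  ⟨spaceHomeo.sets rfl⟩

/-- The centers of the holes of the standard surface. -/
noncomputable def standardCenter (g : ℕ) (j : Fin g) : ℂ := 3 * ((j : ℂ) + 1)

theorem sq_norm_sub_real (p : ℂ) (t : ℝ) : ‖p - t‖ ^ 2 = (p.re - t) ^ 2 + p.im ^ 2 := by
  rw [Complex.sq_norm, Complex.normSq_apply]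
  simp
  ring

theorem standardCenter_eq (g : ℕ) (j : Fin g) :
    standardCenter g j = ((3 * ((j : ℝ) + 1) : ℝ) : ℂ) := by
  simp [standardCenter]

theorem isHoleConfiguration_standard (g : ℕ) :
    IsHoleConfiguration (3 * ((g : ℝ) + 1)) 1 (standardCenter g) where
  radius_pos := one_pos
  outer_pos := by positivity
  separated i j hij := by
    rw [standardCenter_eq, standardCenter_eq, ← Complex.ofReal_sub, Complex.norm_real,
      Real.norm_eq_abs]
    have h1 : (1 : ℝ) ≤ |(i : ℝ) - j| := by
      have h2 : ((i : ℕ) : ℤ) - ((j : ℕ) : ℤ) ≠ 0 := fun h => hij (Fin.ext (by omega))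
      have h3 := Int.one_le_abs h2
      exact_mod_cast h3
    rw [show 3 * ((i : ℝ) + 1) - 3 * ((j : ℝ) + 1) = 3 * ((i : ℝ) - j) by ring, abs_mul]
    norm_num
    linarith
  inside i := by
    rw [standardCenter_eq, Complex.norm_real, Real.norm_of_nonneg (by positivity)]
    have : ((i : ℕ) : ℝ) + 1 ≤ g := by exact_mod_cast i.2
    linarith

/-- A product of several negative factors could have the wrong sign. Here at most one factor is
nonpositive at any point, because the closed hole discs are disjoint and lie inside the open outer
disc. -/
theorem standardPolynomial_sign {g : ℕ} [Nonempty (Fin g)] (p : ℂ) :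
    (0 < standardPolynomial g p ↔ 0 < holeFunction (3 * ((g : ℝ) + 1)) 1 (standardCenter g) p) ∧
    (0 ≤ standardPolynomial g p ↔ 0 ≤ holeFunction (3 * ((g : ℝ) + 1)) 1 (standardCenter g) p) := by
  rw [holeFunction_pos, holeFunction_nonneg]
  have hprod : standardPolynomial g p = ((3 * ((g : ℝ) + 1)) ^ 2 - ‖p‖ ^ 2) *
      ∏ j : Fin g, (‖p - standardCenter g j‖ ^ 2 - 1) := by
    unfold standardPolynomial
    congr 1
    · have := sq_norm_sub_real p 0
      rw [Complex.ofReal_zero, sub_zero, sub_zero] at this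
      rw [this]
      ring
    · have e : Finset.Icc 1 g = Finset.map ⟨Nat.succ, Nat.succ_injective⟩ (Finset.range g) := by
        ext j
        simp only [Finset.mem_Icc, Finset.mem_map, Finset.mem_range, Function.Embedding.coeFn_mk]
        constructor
        · rintro ⟨h1, h2⟩
          exact ⟨j - 1, by omega, by omega⟩
        · rintro ⟨i, h1, rfl⟩
          exact ⟨by omega, by omega⟩
      rw [e, Finset.prod_map, Finset.prod_range]
      refine Finset.prod_congr rfl fun j _ => ?_
      rw [standardCenter_eq, sq_norm_sub_real]
      simp
  rw [hprod]
  have hcfg := isHoleConfiguration_standard g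
  have hR : 0 < 3 * ((g : ℝ) + 1) := hcfg.outer_pos
  have outer_lt : 0 < (3 * ((g : ℝ) + 1)) ^ 2 - ‖p‖ ^ 2 ↔ ‖p‖ < 3 * ((g : ℝ) + 1) := by
    rw [sub_pos, sq_lt_sq₀ (norm_nonneg _) hR.le]
  have outer_le : 0 ≤ (3 * ((g : ℝ) + 1)) ^ 2 - ‖p‖ ^ 2 ↔ ‖p‖ ≤ 3 * ((g : ℝ) + 1) := by
    rw [sub_nonneg, sq_le_sq₀ (norm_nonneg _) hR.le]
  have inner_lt : ∀ j, 0 < ‖p - standardCenter g j‖ ^ 2 - 1 ↔ 1 < ‖p - standardCenter g j‖ :=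
    fun j => by rw [sub_pos, one_lt_sq_iff₀ (norm_nonneg _)]
  have inner_le : ∀ j, 0 ≤ ‖p - standardCenter g j‖ ^ 2 - 1 ↔ 1 ≤ ‖p - standardCenter g j‖ :=
    fun j => by rw [sub_nonneg, one_le_sq_iff₀ (norm_nonneg _)]
  by_cases h : ∃ i, ‖p - standardCenter g i‖ ≤ 1
  · obtain ⟨i, hi⟩ := h
    have others : ∀ j, j ≠ i → 1 < ‖p - standardCenter g j‖ := fun j hj => by
      have h1 := hcfg.separated j i hj
      have h2 := norm_sub_le (p - standardCenter g i) (p - standardCenter g j)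
      rw [sub_sub_sub_cancel_left] at h2
      linarith
    have hin : ‖p‖ < 3 * ((g : ℝ) + 1) := by
      have h1 := hcfg.inside i
      have h2 := norm_sub_norm_le p (standardCenter g i)
      linarith
    rw [← Finset.mul_prod_erase _ _ (Finset.mem_univ i), mul_left_comm]
    have hC : 0 < ((3 * ((g : ℝ) + 1)) ^ 2 - ‖p‖ ^ 2) *
        ∏ j ∈ Finset.univ.erase i, (‖p - standardCenter g j‖ ^ 2 - 1) :=
      mul_pos (outer_lt.2 hin) (Finset.prod_pos fun j hj =>
        (inner_lt j).2 (others j (Finset.ne_of_mem_erase hj)))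
    rw [mul_pos_iff_of_pos_right hC, mul_nonneg_iff_of_pos_right hC, inner_lt, inner_le]
    refine ⟨⟨fun h => ⟨hin, fun j => ?_⟩, fun h => h.2 i⟩,
      ⟨fun h => ⟨hin.le, fun j => ?_⟩, fun h => h.2 i⟩⟩
    · by_cases hj : j = i
      · exact hj ▸ h
      · exact others j hj
    · by_cases hj : j = i
      · exact hj ▸ h
      · exact (others j hj).le
  · push Not at h
    have hC : 0 < ∏ j : Fin g, (‖p - standardCenter g j‖ ^ 2 - 1) :=
      Finset.prod_pos fun j _ => (inner_lt j).2 (h j)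
    rw [mul_pos_iff_of_pos_right hC, mul_nonneg_iff_of_pos_right hC, outer_lt, outer_le]
    exact ⟨⟨fun h' => ⟨h', h⟩, fun h' => h'.1⟩,
      ⟨fun h' => ⟨h', fun j => (h j).le⟩, fun h' => h'.1⟩⟩

/-- The double of a disc with `g` round holes is the standard surface of genus `g`. -/
theorem doubleOf_holeFunction_homeomorph {ι : Type*} [Fintype ι] [Nonempty ι] {R r : ℝ} {c : ι → ℂ}
    (H : IsHoleConfiguration R r c) {g : ℕ} (hg : Fintype.card ι = g) :
    Nonempty (doubleOf (holeFunction R r c) ≃ₜ standardSurface g) := by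
  let e : Fin g ≃ ι := (Fintype.equivFinOfCardEq hg).symm
  have : Nonempty (Fin g) := e.nonempty
  have H' : IsHoleConfiguration R r (c ∘ e) :=
    ⟨H.radius_pos, H.outer_pos, fun i j hij => H.separated _ _ (e.injective.ne hij),
      fun i => H.inside _⟩
  obtain ⟨h, hh⟩ := H'.exists_carriesDomain (isHoleConfiguration_standard g)
  have h1 : ∀ p, 0 < standardPolynomial g (h p) ↔ 0 < holeFunction R r c p := fun p => by
    rw [(standardPolynomial_sign (h p)).1, holeFunction_pos, holeFunction_pos, hh.outer_lt,
      ← e.forall_congr_right]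
    simp only [← not_le, hh.inner_le, Function.comp_apply]
  have h2 : ∀ p, 0 ≤ standardPolynomial g (h p) ↔ 0 ≤ holeFunction R r c p := fun p => by
    rw [(standardPolynomial_sign (h p)).2, holeFunction_nonneg, holeFunction_nonneg, hh.outer_le,
      ← e.forall_congr_right]
    simp only [← not_lt, hh.inner_lt, Function.comp_apply]
  obtain ⟨a⟩ := doubleOf_homeomorph (continuous_holeFunction R r c)
    (continuous_standardPolynomial g) h1 h2
  obtain ⟨b⟩ := standardSurface_homeomorph g
  exact ⟨a.trans b.symm⟩

/-! ### Connectedness of holed discs and of their doubles -/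

theorem Complex.norm_le_norm_of_re_eq {a b : ℂ} (hr : a.re = b.re) (hi : |a.im| ≤ |b.im|) :
    ‖a‖ ≤ ‖b‖ := by
  rw [← sq_le_sq₀ (norm_nonneg _) (norm_nonneg _), Complex.sq_norm, Complex.sq_norm,
    Complex.normSq_apply, Complex.normSq_apply, hr]
  have := sq_le_sq.2 hi
  nlinarith

/-- From any point one can move vertically away from the real axis up to the outer circle. The
distances to the real centers do not decrease on the way, so no hole is entered, and the outer
circle is connected. -/
theorem isPreconnected_collinear {ι : Type*} {t : ι → ℝ} {R r : ℝ} (hR : 0 ≤ R)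
    (ht : ∀ i, |t i| + r ≤ R) : IsPreconnected {p : ℂ | ‖p‖ ≤ R ∧ ∀ i, r ≤ ‖p - t i‖} := by
  let C : Set ℂ := Set.range fun θ : ℝ => (R : ℂ) * Complex.exp (θ * Complex.I)
  have hC : IsPreconnected C := isPreconnected_range (by fun_prop)
  have hCn : ∀ p ∈ C, ‖p‖ = R := by
    rintro _ ⟨θ, rfl⟩
    simp [Complex.norm_exp_ofReal_mul_I, abs_of_nonneg hR]
  have hnC : ∀ p : ℂ, ‖p‖ = R → p ∈ C := fun p hp =>
    ⟨p.arg, by rw [← hp]; exact Complex.norm_mul_exp_arg_mul_I p⟩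
  have hCsub : C ⊆ {p : ℂ | ‖p‖ ≤ R ∧ ∀ i, r ≤ ‖p - t i‖} := by
    intro p hp
    refine ⟨(hCn p hp).le, fun i => ?_⟩
    have h1 := norm_sub_norm_le p (t i)
    rw [hCn p hp, Complex.norm_real, Real.norm_eq_abs] at h1
    linarith [ht i]
  refine isPreconnected_of_forall (R : ℂ) fun p hp => ?_
  have hRC : (R : ℂ) ∈ C := hnC _ (by simp [abs_of_nonneg hR])
  obtain ⟨σ, hσ, hσp⟩ : ∃ σ : ℝ, |σ| = 1 ∧ p.im = σ * |p.im| := by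
    rcases le_total 0 p.im with h | h
    · exact ⟨1, by simp, by simp [abs_of_nonneg h]⟩
    · exact ⟨-1, by simp, by simp [abs_of_nonpos h]⟩
  have hpre : p.re ^ 2 + p.im ^ 2 ≤ R ^ 2 := by
    have h1 := sq_norm_sub_real p 0
    rw [Complex.ofReal_zero, sub_zero, sub_zero] at h1
    rw [← h1]
    exact pow_le_pow_left₀ (norm_nonneg _) hp.1 2
  have htop : |p.im| ≤ √(R ^ 2 - p.re ^ 2) := by
    apply Real.le_sqrt_of_sq_le
    rw [sq_abs]
    linarith
  let f : ℝ → ℂ := fun v => ⟨p.re, σ * v⟩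
  have hf : Continuous f := by
    have : f = fun v : ℝ => (p.re : ℂ) + ((σ * v : ℝ) : ℂ) * Complex.I := by
      funext v
      exact Complex.mk_eq_add_mul_I _ _
    rw [this]
    fun_prop
  let V : Set ℂ := f '' Set.Icc |p.im| (√(R ^ 2 - p.re ^ 2))
  have hV : IsPreconnected V := isPreconnected_Icc.image f hf.continuousOn
  have hftop : f (√(R ^ 2 - p.re ^ 2)) ∈ C := by
    apply hnC
    rw [← sq_eq_sq₀ (norm_nonneg _) hR, Complex.sq_norm, Complex.normSq_apply]
    have h1 : σ ^ 2 = 1 := by rw [← sq_abs, hσ, one_pow]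
    have h2 := Real.sq_sqrt (show 0 ≤ R ^ 2 - p.re ^ 2 by nlinarith [sq_nonneg p.im])
    simp only [f]
    linear_combination (√(R ^ 2 - p.re ^ 2)) ^ 2 * h1 + h2
  refine ⟨C ∪ V, ?_, Or.inl hRC, Or.inr ⟨|p.im|, ⟨le_rfl, htop⟩, ?_⟩, ?_⟩
  · refine Set.union_subset hCsub ?_
    rintro _ ⟨v, hv, rfl⟩
    have hv0 : 0 ≤ v := (abs_nonneg _).trans hv.1
    have hfim : |(f v).im| = v := by
      simp only [f]
      rw [abs_mul, hσ, one_mul, abs_of_nonneg hv0]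
    refine ⟨?_, fun i => (hp.2 i).trans (Complex.norm_le_norm_of_re_eq ?_ ?_)⟩
    · rw [← hCn _ hftop]
      refine Complex.norm_le_norm_of_re_eq rfl ?_
      rw [hfim]
      simp only [f]
      rw [abs_mul, hσ, one_mul]
      exact hv.2.trans (le_abs_self _)
    · simp [f]
    · rw [Complex.sub_im, Complex.sub_im, Complex.ofReal_im, sub_zero, sub_zero, hfim]
      exact hv.1
  · exact Complex.ext rfl hσp.symm
  · exact IsPreconnected.union _ hftop ⟨_, ⟨htop, le_rfl⟩, rfl⟩ hC hV

/-- A homeomorphism of the plane reduces this to holes on the real axis. -/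
theorem IsHoleConfiguration.isPreconnected {ι : Type*} [Fintype ι] {R r : ℝ} {c : ι → ℂ}
    (H : IsHoleConfiguration R r c) : IsPreconnected {p : ℂ | ‖p‖ ≤ R ∧ ∀ i, r ≤ ‖p - c i‖} := by
  let e := Fintype.equivFin ι
  have H' := isHoleConfiguration_standard (Fintype.card ι)
  have H'' : IsHoleConfiguration (3 * ((Fintype.card ι : ℝ) + 1)) 1
      (standardCenter (Fintype.card ι) ∘ e) :=
    ⟨H'.radius_pos, H'.outer_pos, fun i j hij => H'.separated _ _ (e.injective.ne hij),
      fun i => H'.inside _⟩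
  obtain ⟨h, hh⟩ := H''.exists_carriesDomain H
  have hpre := isPreconnected_collinear (t := fun i => 3 * (((e i : ℕ) : ℝ) + 1))
    H''.outer_pos.le (r := 1) fun i => by
      have := H''.inside i
      rw [Function.comp_apply, standardCenter_eq, Complex.norm_real, Real.norm_eq_abs] at this
      exact this.le
  have := hpre.image h h.continuous.continuousOn
  convert this using 1
  ext p
  rw [h.image_eq_preimage_symm]
  simp only [Set.mem_ofPred_eq, Set.mem_preimage]
  rw [← hh.outer_le, h.apply_symm_apply]
  simp only [← not_lt]
  refine and_congr_right fun _ => forall_congr' fun i => ?_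
  rw [not_iff_not, ← standardCenter_eq]
  have := hh.inner_lt i (h.symm p)
  rwa [h.apply_symm_apply] at this

/-- The double is the union of the graphs of `√P` and `-√P`, which meet over a zero of `P`. -/
theorem isPreconnected_doubleOf {P : ℂ → ℝ} (hP : Continuous P)
    (hE : IsPreconnected {p | 0 ≤ P p}) (h0 : ∃ p, P p = 0) : IsPreconnected (doubleOf P) := by
  obtain ⟨p₀, hp₀⟩ := h0
  have h1 := hE.image (fun p => (p, √(P p))) (by fun_prop)
  have h2 := hE.image (fun p => (p, -√(P p))) (by fun_prop)
  have m1 : (p₀, (0 : ℝ)) ∈ (fun p => (p, √(P p))) '' {p | 0 ≤ P p} :=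
    ⟨p₀, hp₀.ge, by simp [hp₀]⟩
  have m2 : (p₀, (0 : ℝ)) ∈ (fun p => (p, -√(P p))) '' {p | 0 ≤ P p} :=
    ⟨p₀, hp₀.ge, by simp [hp₀]⟩
  have h3 := IsPreconnected.union _ m1 m2 h1 h2
  convert h3
  ext ⟨p, z⟩
  constructor
  · intro (h : z ^ 2 = P p)
    have h4 : 0 ≤ P p := h ▸ sq_nonneg z
    rcases le_total 0 z with hz | hz
    · exact Or.inl ⟨p, h4, by simp only; rw [← h, Real.sqrt_sq hz]⟩
    · exact Or.inr ⟨p, h4, by simp only; rw [← h, Real.sqrt_sq_eq_abs, abs_of_nonpos hz, neg_neg]⟩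
  · rintro (⟨q, hq, e⟩ | ⟨q, hq, e⟩)
    · obtain ⟨rfl, rfl⟩ := Prod.mk.inj e
      exact Real.sq_sqrt hq
    · obtain ⟨rfl, rfl⟩ := Prod.mk.inj e
      change (-√(P q)) ^ 2 = P q
      rw [neg_sq, Real.sq_sqrt hq]

theorem preconnectedSpace_standardSurface {g : ℕ} (hg : 0 < g) :
    PreconnectedSpace (standardSurface g) := by
  have : Nonempty (Fin g) := ⟨⟨0, hg⟩⟩
  have H := isHoleConfiguration_standard g
  obtain ⟨e⟩ := standardSurface_homeomorph g
  have hs : {p | 0 ≤ standardPolynomial g p} =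
      {p : ℂ | ‖p‖ ≤ 3 * ((g : ℝ) + 1) ∧ ∀ i, 1 ≤ ‖p - standardCenter g i‖} := by
    ext p
    exact (standardPolynomial_sign p).2.trans holeFunction_nonneg
  have h1 : IsPreconnected (doubleOf (standardPolynomial g)) := by
    refine isPreconnected_doubleOf (continuous_standardPolynomial g) (hs ▸ H.isPreconnected)
      ⟨((3 * ((g : ℝ) + 1) : ℝ) : ℂ), ?_⟩
    unfold standardPolynomial
    simp only [Complex.ofReal_re, Complex.ofReal_im]
    ring
  have : PreconnectedSpace (doubleOf (standardPolynomial g)) := Subtype.preconnectedSpace h1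
  exact e.symm.surjective.denseRange.preconnectedSpace e.symm.continuous

/-! ### A winding number obstruction to being homotopic to the identity -/

/-- Along the homotopy from the identity, the quotient of `φ` at the moved point by `φ` at the
original one starts at the constant `1`. It therefore lifts through the covering map `exp`, starting
at `0`. -/
theorem exists_log_of_homotopic {X : Type*} [TopologicalSpace X] {F : C(X, X)}
    (hF : F.Homotopic (ContinuousMap.id X)) {φ : X → ℂ} (hφ : Continuous φ) (h0 : ∀ x, φ x ≠ 0) :
    ∃ L : X → ℂ, Continuous L ∧ ∀ x, φ (F x) = φ x * Complex.exp (L x) := by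
  obtain ⟨H⟩ := hF.symm
  let K : C(unitInterval × X, {z : ℂ // z ≠ 0}) :=
    ⟨fun q => ⟨φ (H q) / φ q.2, div_ne_zero (h0 _) (h0 _)⟩, by
      refine Continuous.subtype_mk ?_ _
      exact (hφ.comp H.continuous).div (hφ.comp continuous_snd) fun q => h0 _⟩
  let z : C(X, ℂ) := ContinuousMap.const X 0
  have hz : ∀ a, K (0, a) = (fun z : ℂ ↦ (⟨_, z.exp_ne_zero⟩ : {z : ℂ // z ≠ 0})) (z a) := by
    intro a
    apply Subtype.ext
    simp [K, z, div_self (h0 a)]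
  let L := Complex.isCoveringMap_exp.liftHomotopy K z hz
  refine ⟨fun x => L (1, x), by fun_prop, fun x => ?_⟩
  have h1 := congrFun (Complex.isCoveringMap_exp.liftHomotopy_lifts K z hz) (1, x)
  have h2 : Complex.exp (L (1, x)) = φ (H (1, x)) / φ x := congrArg Subtype.val h1
  rw [h2, mul_div_cancel₀ _ (h0 x)]
  simp

theorem eqOn_const_of_exp_eq_one {X : Type*} [TopologicalSpace X] {U : Set X}
    (hU : IsPreconnected U) {D : X → ℂ} (hD : ContinuousOn D U)
    (h : ∀ x ∈ U, Complex.exp (D x) = 1) {x y : X} (hx : x ∈ U) (hy : y ∈ U) : D x = D y := by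
  have : DiscreteTopology (AddSubgroup.zmultiples (2 * Real.pi * Complex.I) : Set ℂ) :=
    NormedSpace.discreteTopology_zmultiples _
  obtain ⟨c, -, hc⟩ := hU.eqOn_const_of_mapsTo
    (T := (AddSubgroup.zmultiples (2 * Real.pi * Complex.I) : Set ℂ)) ⟨this⟩ hD (fun x hx => by
      obtain ⟨n, hn⟩ := Complex.exp_eq_one_iff.1 (h x hx)
      exact ⟨n, by rw [hn]; simp⟩) ⟨0, zero_mem _⟩
  rw [hc hx, hc hy]
  rfl

theorem im_log_ofReal_mul_I {x : ℝ} (hx : 0 < x) :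
    (Complex.log (Complex.I * x)).im = Real.pi / 2 ∧
      (Complex.log (-Complex.I * x)).im = -(Real.pi / 2) := by
  rw [Complex.log_im, Complex.log_im, mul_comm, Complex.arg_real_mul _ hx, mul_comm,
    Complex.arg_real_mul _ hx, Complex.arg_I, Complex.arg_neg_I]
  exact ⟨rfl, rfl⟩

/-- A self-map of `M` that moves one of two tubes at height `z₀` to the other is not homotopic to
the identity, if these tubes are joined both above and below. -/
theorem not_homotopic_of_tubes {M : Set (ℂ × ℝ)} {z₀ ρ : ℝ} {a a' : ℂ} {F : C(M, M)}
    (hF1 : ∀ q, ‖(F q : ℂ × ℝ).1 - a‖ = ‖(q : ℂ × ℝ).1 - a'‖)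
    (hF2 : ∀ q, (F q : ℂ × ℝ).2 = (q : ℂ × ℝ).2)
    (hne : ∀ q ∈ M, q.2 = z₀ → ‖q.1 - a‖ ≠ ρ) {U V : Set M}
    (hU : IsPreconnected U) (hV : IsPreconnected V) (hUz : ∀ q ∈ U, z₀ ≤ (q : ℂ × ℝ).2)
    (hVz : ∀ q ∈ V, (q : ℂ × ℝ).2 ≤ z₀) {A A' : M} (hAU : A ∈ U) (hAV : A ∈ V) (hAU' : A' ∈ U)
    (hAV' : A' ∈ V) (h1 : ‖(A : ℂ × ℝ).1 - a‖ < ρ) (h2 : ρ < ‖(A : ℂ × ℝ).1 - a'‖)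
    (h3 : ρ < ‖(A' : ℂ × ℝ).1 - a‖) (h4 : ‖(A' : ℂ × ℝ).1 - a'‖ < ρ) :
    ¬ F.Homotopic (ContinuousMap.id M) := by
  intro hF
  -- `hne` says exactly that `φ` has no zero. At `A` the values of `φ` and `φ ∘ F` are a negative
  -- and a positive real number, at `A'` it is the other way round.
  let φ : M → ℂ := fun q => ((‖(q : ℂ × ℝ).1 - a‖ - ρ : ℝ) : ℂ) +
    (((q : ℂ × ℝ).2 - z₀ : ℝ) : ℂ) * Complex.I
  have hφre : ∀ q, (φ q).re = ‖(q : ℂ × ℝ).1 - a‖ - ρ := fun q => by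
    simp only [φ]
    rw [Complex.add_re, Complex.re_ofReal_mul, Complex.ofReal_re, Complex.I_re, mul_zero, add_zero]
  have hφim : ∀ q, (φ q).im = (q : ℂ × ℝ).2 - z₀ := fun q => by
    simp only [φ]
    rw [Complex.add_im, Complex.im_ofReal_mul, Complex.ofReal_im, Complex.I_im, mul_one, zero_add]
  have hφF : ∀ q, (φ (F q)).re = ‖(q : ℂ × ℝ).1 - a'‖ - ρ ∧ (φ (F q)).im = (q : ℂ × ℝ).2 - z₀ :=
    fun q => by rw [hφre, hφim, hF1, hF2]; exact ⟨rfl, rfl⟩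
  have hφc : Continuous φ := by fun_prop
  have hφ' : ∀ q, (φ q).im = 0 → (φ q).re ≠ 0 := fun q e => by
    rw [hφre]
    rw [hφim] at e
    exact sub_ne_zero.2 (hne q q.2 (by linarith))
  have hφ0 : ∀ q, φ q ≠ 0 := fun q e => hφ' q (by rw [e]; rfl) (by rw [e]; rfl)
  obtain ⟨L, hL, hLe⟩ := exists_log_of_homotopic hF hφc hφ0
  -- Where a branch of the logarithm is available for both `φ` and `φ ∘ F`, the difference of their
  -- logarithms agrees with `L` up to a constant in `2πiℤ`. The factor `σ` rotates the plane so that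
  -- the principal branch can be used.
  have key : ∀ (σ : ℂ) (W : Set M), σ ≠ 0 → IsPreconnected W →
      (∀ q ∈ W, σ * φ q ∈ Complex.slitPlane ∧ σ * φ (F q) ∈ Complex.slitPlane) → A ∈ W → A' ∈ W →
      L A - (Complex.log (σ * φ (F A)) - Complex.log (σ * φ A)) =
        L A' - (Complex.log (σ * φ (F A')) - Complex.log (σ * φ A')) := by
    intro σ W hσ hW hs hA hA'
    refine eqOn_const_of_exp_eq_one hW (D := fun q =>
      L q - (Complex.log (σ * φ (F q)) - Complex.log (σ * φ q))) ?_ ?_ hA hA'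
    · refine hL.continuousOn.sub (ContinuousOn.sub ?_ ?_)
      · exact ContinuousOn.clog (by fun_prop) fun q hq => (hs q hq).2
      · exact ContinuousOn.clog (by fun_prop) fun q hq => (hs q hq).1
    · intro q _
      rw [Complex.exp_sub, Complex.exp_sub, Complex.exp_log (mul_ne_zero hσ (hφ0 _)),
        Complex.exp_log (mul_ne_zero hσ (hφ0 _)), hLe]
      have := hφ0 q
      have := Complex.exp_ne_zero (L q)
      field_simp
  -- Above `z₀` the function takes values in the closed upper half-plane without `0`. Multiplication
  -- by `-i` turns this into the right half-plane, away from the cut; below `z₀` the factor is `i`.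
  have kU := key (-Complex.I) U (neg_ne_zero.2 Complex.I_ne_zero) hU (fun q hq => by
    have hs : ∀ q : M, z₀ ≤ (q : ℂ × ℝ).2 → -Complex.I * φ q ∈ Complex.slitPlane := fun q hq => by
      rw [Complex.mem_slitPlane_iff]
      have hre : (-Complex.I * φ q).re = (φ q).im := by simp
      have him : (-Complex.I * φ q).im = -(φ q).re := by simp
      rw [hre, him]
      rcases eq_or_lt_of_le (show 0 ≤ (φ q).im by rw [hφim]; linarith) with e | e
      · exact Or.inr (neg_ne_zero.2 (hφ' q e.symm))
      · exact Or.inl e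
    exact ⟨hs q (hUz q hq), hs (F q) (by rw [hF2]; exact hUz q hq)⟩) hAU hAU'
  have kV := key Complex.I V Complex.I_ne_zero hV (fun q hq => by
    have hs : ∀ q : M, (q : ℂ × ℝ).2 ≤ z₀ → Complex.I * φ q ∈ Complex.slitPlane := fun q hq => by
      rw [Complex.mem_slitPlane_iff]
      have hre : (Complex.I * φ q).re = -(φ q).im := by simp
      have him : (Complex.I * φ q).im = (φ q).re := by simp
      rw [hre, him]
      rcases eq_or_lt_of_le (show (φ q).im ≤ 0 by rw [hφim]; linarith) with e | e
      · exact Or.inr (hφ' q e)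
      · exact Or.inl (by linarith)
    exact ⟨hs q (hVz q hq), hs (F q) (by rw [hF2]; exact hVz q hq)⟩) hAV hAV'
  have real : ∀ q : M, q ∈ U → q ∈ V → φ q = ((‖(q : ℂ × ℝ).1 - a‖ - ρ : ℝ) : ℂ) ∧
      φ (F q) = ((‖(q : ℂ × ℝ).1 - a'‖ - ρ : ℝ) : ℂ) := fun q h h' => by
    have e : (q : ℂ × ℝ).2 - z₀ = 0 := by linarith [hUz q h, hVz q h']
    constructor
    · apply Complex.ext
      · rw [hφre, Complex.ofReal_re]
      · rw [hφim, e, Complex.ofReal_im]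
    · apply Complex.ext
      · rw [(hφF q).1, Complex.ofReal_re]
      · rw [(hφF q).2, e, Complex.ofReal_im]
  have flip : ∀ x : ℝ, Complex.I * (x : ℂ) = -Complex.I * ((-x : ℝ) : ℂ) ∧
      -Complex.I * (x : ℂ) = Complex.I * ((-x : ℝ) : ℂ) := fun x => by
    push_cast
    exact ⟨by ring, by ring⟩
  obtain ⟨eA, eA2⟩ := real A hAU hAV
  obtain ⟨eB, eB2⟩ := real A' hAU' hAV'
  have iU := congrArg Complex.im kU
  have iV := congrArg Complex.im kV
  rw [eA, eA2, eB, eB2] at iU iV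
  rw [(flip (‖(A : ℂ × ℝ).1 - a‖ - ρ)).2, (flip (‖(A' : ℂ × ℝ).1 - a'‖ - ρ)).2] at iU
  rw [(flip (‖(A : ℂ × ℝ).1 - a‖ - ρ)).1, (flip (‖(A' : ℂ × ℝ).1 - a'‖ - ρ)).1] at iV
  simp only [Complex.sub_im] at iU iV
  rw [(im_log_ofReal_mul_I (by linarith : 0 < -(‖(A : ℂ × ℝ).1 - a‖ - ρ))).1,
    (im_log_ofReal_mul_I (by linarith : 0 < -(‖(A' : ℂ × ℝ).1 - a'‖ - ρ))).1,
    (im_log_ofReal_mul_I (by linarith : 0 < ‖(A : ℂ × ℝ).1 - a'‖ - ρ)).2,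
    (im_log_ofReal_mul_I (by linarith : 0 < ‖(A' : ℂ × ℝ).1 - a‖ - ρ)).2] at iU
  rw [(im_log_ofReal_mul_I (by linarith : 0 < -(‖(A : ℂ × ℝ).1 - a‖ - ρ))).2,
    (im_log_ofReal_mul_I (by linarith : 0 < -(‖(A' : ℂ × ℝ).1 - a'‖ - ρ))).2,
    (im_log_ofReal_mul_I (by linarith : 0 < ‖(A : ℂ × ℝ).1 - a'‖ - ρ)).1,
    (im_log_ofReal_mul_I (by linarith : 0 < ‖(A' : ℂ × ℝ).1 - a‖ - ρ)).1] at iV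
  -- The imaginary part of `L A - L A'` is `-2π` when computed through `U` and `2π` when computed
  -- through `V`.
  linarith [Real.pi_pos]

/-! ### The mapping class of a rotation -/

/-- The rotation about the third axis by the argument of the unit complex number `u`. -/
def axisRotate (u : ℂ) (q : ℂ × ℝ) : ℂ × ℝ := (u * q.1, q.2)

theorem axialRotation_spaceHomeo_symm (φ : ℝ) (q : ℂ × ℝ) :
    axialRotation φ (spaceHomeo.symm q) =
      spaceHomeo.symm (axisRotate (Complex.exp (φ * Complex.I)) q) := by
  have e1 : (Complex.exp (φ * Complex.I) * q.1).re =
      Real.cos φ * q.1.re - Real.sin φ * q.1.im := by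
    rw [Complex.mul_re, Complex.exp_ofReal_mul_I_re, Complex.exp_ofReal_mul_I_im]
  have e2 : (Complex.exp (φ * Complex.I) * q.1).im =
      Real.sin φ * q.1.re + Real.cos φ * q.1.im := by
    rw [Complex.mul_im, Complex.exp_ofReal_mul_I_re, Complex.exp_ofReal_mul_I_im]
    ring
  change !₂[Real.cos φ * q.1.re - Real.sin φ * q.1.im,
    Real.sin φ * q.1.re + Real.cos φ * q.1.im, q.2] =
    !₂[(Complex.exp (φ * Complex.I) * q.1).re, (Complex.exp (φ * Complex.I) * q.1).im, q.2]
  rw [e1, e2]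

/-- The surface as a whole is invariant only under a finite group. On `W ∩ M`, however, every
rotation stays in the surface, and turning by the angle `sφ` for `0 ≤ s ≤ 1` is the isotopy. -/
theorem locallyIsotopicToId_of_rotation {S : Type*} [TopologicalSpace S] {M : Set (ℂ × ℝ)}
    (e : S ≃ₜ M) {W : Set (ℂ × ℝ)} (hW : IsOpen W) (hWM : (W ∩ M).Nonempty)
    (hrot : ∀ q ∈ W ∩ M, ∀ u : ℂ, ‖u‖ = 1 → axisRotate u q ∈ M) {φ : ℝ} {f : S → S}
    (hf : ∀ x, (e (f x) : ℂ × ℝ) = axisRotate (Complex.exp (φ * Complex.I)) (e x)) :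
    LocallyIsotopicToId f := by
  classical
  let R : unitInterval → S → ℂ × ℝ := fun s x =>
    axisRotate (Complex.exp (((s * φ : ℝ) : ℂ) * Complex.I)) (e x)
  let U : Set S := {x | (e x : ℂ × ℝ) ∈ W}
  have hR : ∀ s, ∀ x ∈ U, R s x ∈ M := fun s x hx =>
    hrot _ ⟨hx, (e x).2⟩ _ (Complex.norm_exp_ofReal_mul_I _)
  -- The default value is never taken on `U`, where alone `G` matters.
  let G : unitInterval → S → S := fun s x => if h : R s x ∈ M then e.symm ⟨R s x, h⟩ else x
  have hG : ∀ s, ∀ x (hx : x ∈ U), G s x = e.symm ⟨R s x, hR s x hx⟩ := fun s x hx =>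
    dif_pos (hR s x hx)
  refine ⟨U, hW.preimage (continuous_subtype_val.comp e.continuous), ?_, G, ?_, ?_, ?_, ?_⟩
  · obtain ⟨q, hq, hqM⟩ := hWM
    exact ⟨e.symm ⟨q, hqM⟩, by simpa [U] using hq⟩
  · rw [continuousOn_iff_continuous_domRestrict]
    have : (Set.univ ×ˢ U).domRestrict (fun q : unitInterval × S => G q.1 q.2) =
        fun q : (Set.univ ×ˢ U : Set (unitInterval × S)) =>
          e.symm ⟨R q.1.1 q.1.2, hR _ _ q.2.2⟩ := by
      funext q
      exact hG _ _ q.2.2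
    rw [this]
    refine e.symm.continuous.comp (Continuous.subtype_mk ?_ _)
    simp only [R, axisRotate]
    fun_prop
  · intro s x hx y hy hxy
    simp only [hG s x hx, hG s y hy] at hxy
    have h1 : R s x = R s y := congrArg Subtype.val (e.symm.injective hxy)
    have h2 := congrArg Prod.fst h1
    have h3 := congrArg Prod.snd h1
    apply e.injective
    apply Subtype.ext
    exact Prod.ext (mul_left_cancel₀ (Complex.exp_ne_zero _) h2) h3
  · intro x hx
    rw [hG 0 x hx, id, e.symm_apply_eq]
    apply Subtype.ext
    simp [R, axisRotate]
  · intro x hx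
    rw [hG 1 x hx, e.symm_apply_eq]
    apply Subtype.ext
    rw [hf]
    simp [R]

/-- The mapping class of the rotation of a surface in space that is invariant under it. -/
theorem exists_mappingClass_of_rotation {k g : ℕ} (hk : 2 ≤ k) (hg : 0 < g) {S : Type*}
    [TopologicalSpace S] (hS : IsClosedSurfaceOfGenus g S) {M : Set (ℂ × ℝ)}
    (hM : Nonempty (M ≃ₜ standardSurface g)) {ζ : ℂ}
    (hζ : ζ = Complex.exp ((2 * Real.pi / k : ℝ) * Complex.I))
    (hrot : ∀ q ∈ M, axisRotate ζ q ∈ M) {W : Set (ℂ × ℝ)} (hW : IsOpen W)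
    (hWM : (W ∩ M).Nonempty) (hWrot : ∀ q ∈ W ∩ M, ∀ u : ℂ, ‖u‖ = 1 → axisRotate u q ∈ M)
    (hnon : ∀ j, 0 < j → j < k → ∀ F : C(M, M), (∀ q, (F q : ℂ × ℝ) = axisRotate (ζ ^ j) q) →
      ¬ F.Homotopic (ContinuousMap.id M)) :
    ∃ m : MappingClassGroup S, orderOf m = k ∧ IsRealizedByRotation (2 * Real.pi / k) m := by
  obtain ⟨eS⟩ := hS
  obtain ⟨eM⟩ := hM
  let e : S ≃ₜ M := eS.trans eM.symm
  have : PreconnectedSpace (standardSurface g) := preconnectedSpace_standardSurface hg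
  have : PreconnectedSpace S :=
    eS.symm.surjective.denseRange.preconnectedSpace eS.symm.continuous
  have hk0 : (k : ℂ) ≠ 0 := Nat.cast_ne_zero.2 (by omega)
  have hζk : ζ ^ k = 1 := by
    rw [hζ, ← Complex.exp_nat_mul, Complex.exp_eq_one_iff]
    refine ⟨1, ?_⟩
    push_cast
    field_simp
  have hζ0 : ζ ≠ 0 := hζ ▸ Complex.exp_ne_zero _
  have hpow : ∀ (j : ℕ) q, q ∈ M → axisRotate (ζ ^ j) q ∈ M := by
    intro j q hq
    induction j with
    | zero => simpa [axisRotate] using hq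
    | succ j ih =>
      have := hrot _ ih
      simpa [axisRotate, pow_succ', mul_assoc] using this
  have hinv : ∀ q ∈ M, axisRotate ζ⁻¹ q ∈ M := fun q hq => by
    have e1 : ζ⁻¹ = ζ ^ (k - 1) := by
      rw [inv_eq_iff_eq_inv, eq_comm, inv_eq_iff_eq_inv]
      refine eq_inv_of_mul_eq_one_left ?_
      rw [← pow_succ, Nat.sub_add_cancel (by omega), hζk]
    rw [e1]
    exact hpow _ q hq
  have hcont : ∀ u : ℂ, Continuous (axisRotate u) := fun u => by
    unfold axisRotate
    fun_prop
  let fM : M ≃ₜ M :=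
    { toFun := fun q => ⟨axisRotate ζ q, hrot q q.2⟩
      invFun := fun q => ⟨axisRotate ζ⁻¹ q, hinv q q.2⟩
      left_inv := fun q => Subtype.ext (by simp [axisRotate, inv_mul_cancel_left₀ hζ0])
      right_inv := fun q => Subtype.ext (by simp [axisRotate, mul_inv_cancel_left₀ hζ0])
      continuous_toFun := ((hcont ζ).comp continuous_subtype_val).subtype_mk _
      continuous_invFun := ((hcont ζ⁻¹).comp continuous_subtype_val).subtype_mk _ }
  let f : S ≃ₜ S := e.trans (fM.trans e.symm)
  have hf : ∀ x, (e (f x) : ℂ × ℝ) = axisRotate ζ (e x) := fun x => by simp [f, fM]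
  have hf' : ∀ x, (e (f.symm x) : ℂ × ℝ) = axisRotate ζ⁻¹ (e x) := fun x => by
    have := hf (f.symm x)
    rw [f.apply_symm_apply] at this
    rw [this]
    simp [axisRotate, inv_mul_cancel_left₀ hζ0]
  have hplus : f ∈ HomeoPlus S := by
    refine mem_homeoPlus_of_locallyIsotopicToId
      (locallyIsotopicToId_of_rotation e hW hWM hWrot (φ := 2 * Real.pi / k) fun x => ?_)
      (locallyIsotopicToId_of_rotation e hW hWM hWrot (φ := -(2 * Real.pi / k)) fun x => ?_)
    · rw [hf, hζ]
    · rw [hf', hζ, ← Complex.exp_neg]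
      push_cast
      rw [neg_mul]
  let F : HomeoPlus S := ⟨f, hplus⟩
  have hFpow : ∀ (j : ℕ) x, (e ((F ^ j).1 x) : ℂ × ℝ) = axisRotate (ζ ^ j) (e x) := by
    intro j
    induction j with
    | zero =>
      intro x
      simp [axisRotate]
    | succ j ih =>
      intro x
      have h1 : (F ^ (j + 1)).1 x = f ((F ^ j).1 x) := by
        rw [pow_succ']
        rfl
      rw [h1, hf, ih]
      simp [axisRotate, pow_succ', mul_assoc]
  refine ⟨(F : MappingClassGroup S), ?_, fun x => spaceHomeo.symm (e x), F, ?_, fun x => ?_, rfl⟩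
  · rw [orderOf_eq_iff (by omega)]
    constructor
    · have : F ^ k = 1 := by
        apply Subtype.ext
        apply Homeomorph.ext
        intro x
        apply e.injective
        apply Subtype.ext
        rw [hFpow, hζk]
        simp [axisRotate]
      rw [← QuotientGroup.mk_pow, this, QuotientGroup.mk_one]
    -- If the `j`-th power were trivial in the quotient, conjugating its homotopy by `e` would
    -- contradict `hnon` on the model.
    · intro j hj hj0 hone
      rw [← QuotientGroup.mk_pow, QuotientGroup.eq_one_iff] at hone
      have hh : ContinuousMap.Homotopic ((F ^ j).1 : C(S, S)) (ContinuousMap.id S) := hone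
      have h2 := ContinuousMap.Homotopic.comp (ContinuousMap.Homotopic.comp
        (ContinuousMap.Homotopic.refl (e : C(S, M))) hh)
        (ContinuousMap.Homotopic.refl (e.symm : C(M, S)))
      have e3 : ContinuousMap.comp (ContinuousMap.comp (e : C(S, M)) (ContinuousMap.id S))
          (e.symm : C(M, S)) = ContinuousMap.id M := by
        ext1 q
        exact e.apply_symm_apply q
      rw [e3] at h2
      refine hnon j hj0 hj _ (fun q => ?_) h2
      change (e ((F ^ j).1 (e.symm q)) : ℂ × ℝ) = _
      rw [hFpow, e.apply_symm_apply]
  · exact spaceHomeo.symm.isEmbedding.comp (IsEmbedding.subtypeVal.comp e.isEmbedding)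
  · change spaceHomeo.symm (e (f x)) = _
    rw [hf, axialRotation_spaceHomeo_symm, hζ]

/-! ### The genera `ak` and `ak + 1`: doubles of a disc with rotating holes -/

theorem infDist_mul_of_invariant {F : Set ℂ} {u : ℂ} (hu : ‖u‖ = 1)
    (h : ∀ x, u * x ∈ F ↔ x ∈ F) (p : ℂ) : Metric.infDist (u * p) F = Metric.infDist p F := by
  have hu0 : u ≠ 0 := norm_ne_zero_iff.1 (hu ▸ one_ne_zero)
  have hiso : Isometry fun x : ℂ => u * x := by
    refine Isometry.of_dist_eq fun x y => ?_
    rw [dist_eq_norm, dist_eq_norm, ← mul_sub, norm_mul, hu, one_mul]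
  have himg : (fun x : ℂ => u * x) '' F = F := by
    ext y
    constructor
    · rintro ⟨x, hx, rfl⟩
      exact (h x).2 hx
    · intro hy
      refine ⟨u⁻¹ * y, (h _).1 ?_, mul_inv_cancel_left₀ hu0 y⟩
      rwa [mul_inv_cancel_left₀ hu0]
  have := Metric.infDist_image hiso (x := p) (t := F)
  rwa [himg] at this

/-- All small radii are admissible for the holes about finitely many points. -/
theorem eventually_separated {F : Set ℂ} (hF : F.Finite) :
    ∀ᶠ ε : ℝ in 𝓝[>] 0, 0 < ε ∧ ε < 1 / 2 ∧ ∀ x ∈ F, ∀ y ∈ F, x ≠ y → 4 * ε < ‖x - y‖ := by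
  refine Filter.Eventually.and self_mem_nhdsWithin (Filter.Eventually.and ?_ ?_)
  · exact mem_nhdsWithin_of_mem_nhds (gt_mem_nhds (by norm_num))
  · rw [Filter.eventually_all_finite hF]
    intro x _
    rw [Filter.eventually_all_finite hF]
    intro y _
    by_cases hxy : x = y
    · simp [hxy]
    · have h1 : Filter.Tendsto (fun ε : ℝ => 4 * ε) (𝓝[>] 0) (𝓝 (4 * 0)) :=
        (continuous_const.mul continuous_id).continuousWithinAt
      have h2 : 4 * (0 : ℝ) < ‖x - y‖ := by
        rw [mul_zero]
        exact norm_pos_iff.2 (sub_ne_zero.2 hxy)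
      filter_upwards [h1.eventually_lt_const h2] with ε hε _ using hε

theorem exists_norm_le_of_finite {F : Set ℂ} (hF : F.Finite) : ∃ B : ℝ, 0 ≤ B ∧ ∀ x ∈ F, ‖x‖ ≤ B := by
  obtain ⟨B, hB⟩ := hF.isBounded.exists_norm_le
  exact ⟨max B 0, le_max_right _ _, fun x hx => (hB x hx).trans (le_max_left _ _)⟩

theorem norm_rotate_sub {u a p : ℂ} (hu : ‖u‖ = 1) : ‖u * p - a‖ = ‖p - u⁻¹ * a‖ := by
  have hu0 : u ≠ 0 := norm_ne_zero_iff.1 (hu ▸ one_ne_zero)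
  have : u * p - a = u * (p - u⁻¹ * a) := by rw [mul_sub, mul_inv_cancel_left₀ hu0]
  rw [this, norm_mul, hu, one_mul]

/-- The generator `ζ` of the rotations of order `k`. -/
theorem rotation_generator {k : ℕ} (hk : 2 ≤ k) {ζ : ℂ}
    (hζ : ζ = Complex.exp ((2 * Real.pi / k : ℝ) * Complex.I)) :
    ‖ζ‖ = 1 ∧ IsPrimitiveRoot ζ k := by
  constructor
  · rw [hζ, Complex.norm_exp_ofReal_mul_I]
  · rw [hζ]
    have := Complex.isPrimitiveRoot_exp k (by omega)
    convert this using 2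
    push_cast
    ring

/-- The double of a disc with holes that a rotation permutes. -/
theorem exists_mappingClass_of_planar {k g : ℕ} (hk : 2 ≤ k) (hg : 0 < g) {S : Type*}
    [TopologicalSpace S] (hS : IsClosedSurfaceOfGenus g S) {ζ : ℂ}
    (hζ : ζ = Complex.exp ((2 * Real.pi / k : ℝ) * Complex.I)) {F : Set ℂ} (hF : F.Finite)
    (hcard : F.ncard = g) (hFrot : ∀ x, ζ * x ∈ F ↔ x ∈ F) {a : ℂ} (ha : a ∈ F) (ha0 : a ≠ 0) :
    ∃ m : MappingClassGroup S, orderOf m = k ∧ IsRealizedByRotation (2 * Real.pi / k) m := by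
  obtain ⟨hζ1, hprim⟩ := rotation_generator hk hζ
  obtain ⟨B, hB0, hB⟩ := exists_norm_le_of_finite hF
  obtain ⟨ε, hε0, hε1, hsep⟩ := (eventually_separated hF).exists
  have := hF.fintype
  have : Nonempty F := ⟨⟨a, ha⟩⟩
  let c : F → ℂ := Subtype.val
  have hrange : Set.range c = F := Subtype.range_coe
  set R : ℝ := B + 2 with hR
  have hcfg : IsHoleConfiguration R ε c :=
    ⟨hε0, by linarith, fun i j hij => by
      linarith [hsep i i.2 j j.2 fun e => hij (Subtype.ext e)], fun i => by
      linarith [hB i i.2]⟩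
  set P := holeFunction R ε c with hP
  have hPc : Continuous P := continuous_holeFunction R ε c
  have hE : IsPreconnected {p | 0 ≤ P p} := by
    have : {p | 0 ≤ P p} = {p : ℂ | ‖p‖ ≤ R ∧ ∀ i, ε ≤ ‖p - c i‖} := by
      ext p
      exact holeFunction_nonneg
    rw [this]
    exact hcfg.isPreconnected
  -- The outer radius `B + 2` keeps the holes far from the rim. Near the rim `P` depends on the norm
  -- only, so this ring can serve as the piece that all rotations preserve.
  have hrim : ∀ p, R - 1 / 2 < ‖p‖ → P p = R - ‖p‖ := fun p hp => by
    refine min_eq_left (le_sub_iff_add_le.2 ?_)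
    rw [le_infDist_range]
    intro i
    have := norm_sub_norm_le p (c i)
    have := hB i i.2
    linarith
  refine exists_mappingClass_of_rotation hk hg hS
    (doubleOf_holeFunction_homeomorph hcfg (by rw [← hcard, Set.ncard_eq_toFinset_card', Set.toFinset_card]))
    hζ (M := doubleOf P) ?_ (W := {q | R - 1 / 2 < ‖q.1‖})
    (isOpen_lt continuous_const (continuous_norm.comp continuous_fst)) ?_ ?_ ?_
  · intro q hq
    have hq' : q.2 ^ 2 = P q.1 := hq
    change q.2 ^ 2 = P (ζ * q.1)
    rw [hq', hP, holeFunction, holeFunction, norm_mul, hζ1, one_mul, hrange,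
      infDist_mul_of_invariant hζ1 hFrot]
  · refine ⟨((R : ℂ), 0), ?_, ?_⟩
    · change R - 1 / 2 < ‖(R : ℂ)‖
      rw [Complex.norm_real, Real.norm_of_nonneg hcfg.outer_pos.le]
      linarith
    · change (0 : ℝ) ^ 2 = P R
      have h1 : ‖(R : ℂ)‖ = R := by rw [Complex.norm_real, Real.norm_of_nonneg hcfg.outer_pos.le]
      rw [hrim _ (by rw [h1]; linarith), h1]
      ring
  · rintro q ⟨hqW, hqM⟩ u hu
    have hqW' : R - 1 / 2 < ‖q.1‖ := hqW
    have hqM' : q.2 ^ 2 = P q.1 := hqM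
    have h1 : ‖u * q.1‖ = ‖q.1‖ := by rw [norm_mul, hu, one_mul]
    change q.2 ^ 2 = P (u * q.1)
    rw [hqM', hrim _ hqW', hrim _ (by rw [h1]; exact hqW'), h1]
  · intro j hj0 hjk f hf
    have hu : ‖ζ ^ j‖ = 1 := by rw [norm_pow, hζ1, one_pow]
    have hu0 : ζ ^ j ≠ 0 := norm_ne_zero_iff.1 (hu ▸ one_ne_zero)
    have hu1 : ζ ^ j ≠ 1 := hprim.pow_ne_one_of_pos_of_lt hj0.ne' hjk
    have hjrot : ∀ (j : ℕ) x, ζ ^ j * x ∈ F ↔ x ∈ F := fun j x => by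
      induction j with
      | zero => simp
      | succ j ih => rw [pow_succ', mul_assoc, hFrot, ih]
    -- The center that the power of the rotation carries to `a`. It differs from `a` because `a` is
    -- not on the axis.
    set a' : ℂ := (ζ ^ j)⁻¹ * a with ha'def
    have ha' : a' ∈ F := by
      rw [← hjrot j, ha'def, mul_inv_cancel_left₀ hu0]
      exact ha
    have hne : a ≠ a' := by
      intro e
      rw [ha'def, eq_comm, inv_mul_eq_iff_eq_mul₀ hu0, eq_comm] at e
      exact hu1 (mul_right_cancel₀ ha0 (e.trans (one_mul a).symm))
    have hdist := hsep a ha a' ha' hne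
    -- The point `x + ε` on the edge of the hole about `x` lies on both sheets. It joins them for
    -- the two-sided connection between the holes `a` and `a'`.
    have hedge : ∀ x ∈ F, P (x + ε) = 0 := by
      intro x hx
      have hx1 : ‖x + ε - x‖ = ε := by
        rw [add_sub_cancel_left, Complex.norm_real, Real.norm_of_nonneg hε0.le]
      refine le_antisymm (not_lt.1 fun h => ?_) (holeFunction_nonneg.2 ⟨?_, fun i => ?_⟩)
      · have := (holeFunction_pos.1 h).2 ⟨x, hx⟩
        exact this.ne' hx1
      · have h1 := norm_add_le x (ε : ℂ)
        rw [Complex.norm_real, Real.norm_of_nonneg hε0.le] at h1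
        linarith [hB x hx]
      · by_cases hi : (i : ℂ) = x
        · exact hi ▸ hx1.ge
        · have h1 := hsep x hx i i.2 (Ne.symm hi)
          have h2 := norm_sub_le (x + ε - c i) (x + ε - x)
          rw [sub_sub_sub_cancel_left, hx1] at h2
          have h3 : ‖x - c i‖ ≤ ‖x + ε - c i‖ + ε := h2
          have h4 : ‖x - (i : ℂ)‖ = ‖x - c i‖ := rfl
          linarith
    have hmem : ∀ (σ : ℝ), σ ^ 2 = 1 → ∀ p : {p | 0 ≤ P p}, ((p : ℂ), σ * √(P p)) ∈ doubleOf P :=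
      fun σ hσ p => by
        change (σ * √(P p)) ^ 2 = P p
        rw [mul_pow, hσ, one_mul, Real.sq_sqrt p.2]
    have hsheet : ∀ (σ : ℝ) (hσ : σ ^ 2 = 1), IsPreconnected
        (Set.range fun p : {p | 0 ≤ P p} => (⟨_, hmem σ hσ p⟩ : doubleOf P)) := by
      intro σ hσ
      have : PreconnectedSpace {p | 0 ≤ P p} := Subtype.preconnectedSpace hE
      exact isPreconnected_range (Continuous.subtype_mk (by fun_prop) _)
    have hpt : ∀ x ∈ F, (x + (ε : ℂ), (0 : ℝ)) ∈ doubleOf P := fun x hx => by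
      change (0 : ℝ) ^ 2 = P (x + ε)
      rw [hedge x hx]
      ring
    have hptmem : ∀ (σ : ℝ) (hσ : σ ^ 2 = 1) (x : ℂ) (hx : x ∈ F), (⟨_, hpt x hx⟩ : doubleOf P) ∈
        Set.range fun p : {p | 0 ≤ P p} => (⟨_, hmem σ hσ p⟩ : doubleOf P) := by
      intro σ hσ x hx
      refine ⟨⟨x + ε, (hedge x hx).ge⟩, Subtype.ext (Prod.ext rfl ?_)⟩
      simp [hedge x hx]
    have hεn : ∀ x : ℂ, ‖x + (ε : ℂ) - x‖ = ε := fun x => by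
      rw [add_sub_cancel_left, Complex.norm_real, Real.norm_of_nonneg hε0.le]
    have hfar : ∀ x y : ℂ, 4 * ε < ‖x - y‖ → 3 / 2 * ε < ‖x + (ε : ℂ) - y‖ := fun x y h => by
      have h2 := norm_sub_le (x + ε - y) (x + ε - x)
      rw [sub_sub_sub_cancel_left, hεn] at h2
      linarith
    have hp : (1 : ℝ) ^ 2 = 1 := one_pow 2
    have hm : (-1 : ℝ) ^ 2 = 1 := neg_one_sq
    -- The circle of radius `3ε / 2` about `a` separates its hole, of radius `ε`, from the other
    -- holes, whose centers are more than `4ε` away. It lies where `P > 0`, so the surface does not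
    -- meet it at height `0`.
    refine not_homotopic_of_tubes (z₀ := 0) (ρ := 3 / 2 * ε) (a := a) (a' := a')
      (fun q => ?_) (fun q => ?_) ?_ (hsheet 1 hp) (hsheet (-1) hm) ?_ ?_ (hptmem 1 hp a ha)
      (hptmem (-1) hm a ha) (hptmem 1 hp a' ha') (hptmem (-1) hm a' ha') ?_ ?_ ?_ ?_
    · rw [hf]
      exact norm_rotate_sub hu
    · rw [hf]
      rfl
    · intro q hq hz e
      have hq' : q.2 ^ 2 = P q.1 := hq
      rw [hz] at hq'
      have h0 : ¬ 0 < P q.1 := by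
        rw [← hq']
        norm_num
      apply h0
      rw [holeFunction_pos]
      have hin : ‖q.1‖ ≤ B + 3 / 2 * ε := by
        have h1 := norm_sub_norm_le q.1 a
        linarith [hB a ha]
      refine ⟨by linarith, fun i => ?_⟩
      by_cases hi : (i : ℂ) = a
      · change ε < ‖q.1 - (i : ℂ)‖
        rw [hi, e]
        linarith
      · have h1 := hsep a ha i i.2 (Ne.symm hi)
        have h2 := norm_sub_le (q.1 - c i) (q.1 - a)
        rw [sub_sub_sub_cancel_left, e] at h2
        have h3 : ‖a - (i : ℂ)‖ = ‖a - c i‖ := rfl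
        linarith
    · rintro _ ⟨p, rfl⟩
      simp only [one_mul]
      exact Real.sqrt_nonneg _
    · rintro _ ⟨p, rfl⟩
      simp only [neg_mul, one_mul, Left.neg_nonpos_iff]
      exact Real.sqrt_nonneg _
    · change ‖a + (ε : ℂ) - a‖ < _
      rw [hεn]
      linarith
    · exact hfar a a' hdist
    · exact hfar a' a (by rwa [norm_sub_rev])
    · change ‖a' + (ε : ℂ) - a'‖ < _
      rw [hεn]
      linarith

theorem ncard_pow_eq_one {n : ℕ} (hn : 0 < n) :
    {p : ℂ | p ^ n = 1}.Finite ∧ {p : ℂ | p ^ n = 1}.ncard = n := by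
  have : NeZero n := ⟨hn.ne'⟩
  have h : {p : ℂ | p ^ n = 1} = (Polynomial.nthRootsFinset n (1 : ℂ) : Set ℂ) := by
    ext p
    simp [Polynomial.mem_nthRootsFinset hn]
  rw [h]
  refine ⟨Finset.finite_toSet _, ?_⟩
  rw [Set.ncard_coe_finset]
  exact (Complex.isPrimitiveRoot_exp n hn.ne').card_nthRootsFinset

/-- The holes are placed at the `ak`-th roots of unity. The additional hole for genus `ak + 1` is
centered on the axis and fixed by the rotation. -/
theorem exists_mappingClass_of_multiple {k g a : ℕ} (hk : 2 ≤ k) (ha : 0 < a)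
    (hg : g = a * k ∨ g = a * k + 1) {S : Type*} [TopologicalSpace S]
    (hS : IsClosedSurfaceOfGenus g S) :
    ∃ m : MappingClassGroup S, orderOf m = k ∧ IsRealizedByRotation (2 * Real.pi / k) m := by
  obtain ⟨-, hprim⟩ := rotation_generator hk rfl
  have hn : 0 < a * k := by positivity
  obtain ⟨hfin, hcard⟩ := ncard_pow_eq_one hn
  set ζ := Complex.exp ((2 * Real.pi / k : ℝ) * Complex.I) with hζ
  have hrot : ∀ x, ζ * x ∈ {p : ℂ | p ^ (a * k) = 1} ↔ x ∈ {p : ℂ | p ^ (a * k) = 1} := fun x => by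
    simp only [Set.mem_ofPred_eq]
    rw [mul_pow, mul_comm a k, pow_mul, hprim.pow_eq_one, one_pow, one_mul]
  have h1 : (1 : ℂ) ∈ {p : ℂ | p ^ (a * k) = 1} := one_pow _
  rcases hg with rfl | rfl
  · exact exists_mappingClass_of_planar hk hn hS rfl hfin hcard hrot h1 one_ne_zero
  · have h0 : (0 : ℂ) ∉ {p : ℂ | p ^ (a * k) = 1} := by
      simp only [Set.mem_ofPred_eq]
      rw [zero_pow hn.ne']
      exact zero_ne_one
    refine exists_mappingClass_of_planar hk (Nat.succ_pos _) hS rfl (hfin.insert 0) ?_ ?_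
      (Set.mem_insert_of_mem _ h1) one_ne_zero
    · rw [Set.ncard_insert_of_notMem h0 hfin, hcard]
    · intro x
      have hζ0 : ζ ≠ 0 := Complex.exp_ne_zero _
      rw [Set.mem_insert_iff, Set.mem_insert_iff, hrot, mul_eq_zero_iff_left hζ0]

/-! ### Surfaces glued from sheets -/

/-- Maps from a compact space to Hausdorff spaces are quotient maps onto their ranges, so both
ranges are the quotient of `K` by the same relation. -/
theorem range_homeomorph_of_ker_eq {K A B : Type*} [TopologicalSpace K] [CompactSpace K]
    [TopologicalSpace A] [T2Space A] [TopologicalSpace B] [T2Space B] {f : K → A} {f' : K → B}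
    (hf : Continuous f) (hf' : Continuous f') (h : ∀ x y, f x = f y ↔ f' x = f' y) :
    Nonempty (Set.range f ≃ₜ Set.range f') := by
  let F : C(K, Set.range f) := ⟨Set.rangeFactorization f, hf.subtype_mk _⟩
  let F' : C(K, Set.range f') := ⟨Set.rangeFactorization f', hf'.subtype_mk _⟩
  have q : IsQuotientMap F :=
    F.continuous.isClosedMap.isQuotientMap F.continuous Set.rangeFactorization_surjective
  have q' : IsQuotientMap F' :=
    F'.continuous.isClosedMap.isQuotientMap F'.continuous Set.rangeFactorization_surjective
  have e : Setoid.ker F = Setoid.ker F' := by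
    ext x y
    rw [Setoid.ker_def, Setoid.ker_def, Subtype.ext_iff, Subtype.ext_iff]
    exact h x y
  have i1 := q.homeomorph
  rw [e] at i1
  exact ⟨i1.symm.trans q'.homeomorph⟩

section Stack

variable {b : ℕ}

/-- The height of the middle of a slab, or of the two caps. -/
def slabHeight (b : ℕ) : Option (Fin b) → ℝ
  | none => 0
  | some j => 2 * (j : ℝ) - ((b : ℝ) - 1)

/-- The distance from the middle of a slab to its boundary, where it meets its neighbours. -/
def seamHeight (b : ℕ) : Option (Fin b) → ℝ
  | none => b
  | some _ => 1

theorem abs_slabHeight_le (j : Fin b) : |slabHeight b (some j)| ≤ b - 1 := by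
  have h : ((j : ℕ) : ℝ) + 1 ≤ b := by exact_mod_cast j.2
  have h0 : (0 : ℝ) ≤ (j : ℕ) := Nat.cast_nonneg _
  rw [slabHeight, abs_le]
  constructor <;> linarith

theorem two_le_abs_slabHeight_sub {i j : Fin b} (hij : i ≠ j) :
    2 ≤ |slabHeight b (some i) - slabHeight b (some j)| := by
  have h1 : (1 : ℝ) ≤ |((i : ℕ) : ℝ) - (j : ℕ)| := by
    have h2 : ((i : ℕ) : ℤ) - ((j : ℕ) : ℤ) ≠ 0 := fun h => hij (Fin.ext (by omega))
    exact_mod_cast Int.one_le_abs h2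
  have e : slabHeight b (some i) - slabHeight b (some j) = 2 * (((i : ℕ) : ℝ) - (j : ℕ)) := by
    simp only [slabHeight]
    ring
  rw [e, abs_mul, abs_two]
  linarith

/-- The sign attached to the upper and the lower sheet. -/
def sheetSign (δ : Bool) : ℝ := if δ then 1 else -1

theorem sheetSign_mul_eq {δ δ' : Bool} {a a' : ℝ} (ha : 0 ≤ a) (ha' : 0 ≤ a')
    (h : sheetSign δ * a = sheetSign δ' * a') : a = a' ∧ (δ = δ' ∨ a = 0) := by
  cases δ <;> cases δ' <;> simp only [sheetSign, if_true, Bool.false_eq_true, if_false] at h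
  · exact ⟨by linarith, Or.inl rfl⟩
  · exact ⟨by linarith, Or.inr (by linarith)⟩
  · exact ⟨by linarith, Or.inr (by linarith)⟩
  · exact ⟨by linarith, Or.inl rfl⟩

theorem abs_sheetSign_mul {δ : Bool} {a : ℝ} (ha : 0 ≤ a) : |sheetSign δ * a| = a := by
  cases δ <;> simp [sheetSign, abs_of_nonneg ha]

/-- The range of the height above the middle of a slab, or of a cap. -/
def IsSheetHeight (b : ℕ) : Option (Fin b) → ℝ → Prop
  | none, a => (b : ℝ) ≤ a
  | some _, a => 0 ≤ a ∧ a ≤ 1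

theorem IsSheetHeight.nonneg {o : Option (Fin b)} {a : ℝ} (h : IsSheetHeight b o a) : 0 ≤ a := by
  cases o with
  | none => exact (Nat.cast_nonneg b).trans h
  | some j => exact h.1

/-- The slabs occupy the consecutive intervals of length `2` that tile `[-b, b]`, and the caps lie
outside. Sheets of different slabs can share a height only at a common end of their intervals. -/
theorem sheetHeight_eq_imp {o o' : Option (Fin b)} {δ δ' : Bool} {a a' : ℝ}
    (ha : IsSheetHeight b o a) (ha' : IsSheetHeight b o' a')
    (h : slabHeight b o + sheetSign δ * a = slabHeight b o' + sheetSign δ' * a') :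
    (o = o' ∧ (δ = δ' ∨ a = 0)) ∨ (a = seamHeight b o ∧ a' = seamHeight b o') := by
  have key : ∀ (j : Fin b) (δ δ' : Bool) (a a' : ℝ), 0 ≤ a → a ≤ 1 → (b : ℝ) ≤ a' →
      slabHeight b (some j) + sheetSign δ * a = slabHeight b none + sheetSign δ' * a' →
      a = 1 ∧ a' = b := by
    intro j δ δ' a a' h0 h1 hb e
    have h2 := abs_add_le (slabHeight b (some j)) (sheetSign δ * a)
    have h3 : slabHeight b none = 0 := rfl
    rw [e, h3, zero_add, abs_sheetSign_mul h0,
      abs_sheetSign_mul ((Nat.cast_nonneg b).trans hb)] at h2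
    have h4 := abs_slabHeight_le j
    constructor <;> linarith
  match o, o', ha, ha' with
  | none, none, ha, ha' =>
    have hb := IsSheetHeight.nonneg (o := (none : Option (Fin b))) ha
    have hb' := IsSheetHeight.nonneg (o := (none : Option (Fin b))) ha'
    exact Or.inl ⟨rfl, (sheetSign_mul_eq hb hb' (add_left_cancel h)).2⟩
  | none, some j, ha, ha' =>
    have := key j δ' δ a' a ha'.1 ha'.2 ha h.symm
    exact Or.inr ⟨this.2, this.1⟩
  | some j, none, ha, ha' =>
    exact Or.inr (key j δ δ' a a' ha.1 ha.2 ha' h)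
  | some i, some j, ha, ha' =>
    by_cases hij : i = j
    · subst hij
      exact Or.inl ⟨rfl, (sheetSign_mul_eq ha.1 ha'.1 (add_left_cancel h)).2⟩
    · have h1 := two_le_abs_slabHeight_sub hij
      have e : slabHeight b (some i) - slabHeight b (some j) =
          sheetSign δ' * a' - sheetSign δ * a := by linarith
      rw [e] at h1
      have h2 := abs_sub (sheetSign δ' * a') (sheetSign δ * a)
      rw [abs_sheetSign_mul ha.1, abs_sheetSign_mul ha'.1] at h2
      have h3 := ha.2
      have h4 := ha'.2
      exact Or.inr ⟨show a = 1 by linarith, show a' = 1 by linarith⟩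

/-- A system of sheets: the sheets of the slab `o` are the graphs of `± T o` about the height of
the slab, over the image of `E o` under `g o`. The two sheets meet over `Z o`, and the neighbouring
slabs meet along the circle of radius `R`. -/
structure IsSheetSystem (R : ℝ) (E Z : Option (Fin b) → Set ℂ) (g : Option (Fin b) → ℂ → ℂ)
    (T : Option (Fin b) → ℂ → ℝ) : Prop where
  continuousOn_map : ∀ o, ContinuousOn (g o) (E o)
  continuousOn_height : ∀ o, ContinuousOn (T o) (E o)
  injOn_map : ∀ o, Set.InjOn (g o) (E o)
  map_seam : ∀ o, ∀ w ∈ E o, ‖w‖ = R → g o w = w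
  height : ∀ o, ∀ w ∈ E o, IsSheetHeight b o (T o w)
  height_eq_zero : ∀ o, ∀ w ∈ E o, T o w = 0 ↔ w ∈ Z o
  height_eq_seam : ∀ o, ∀ w ∈ E o, T o w = seamHeight b o ↔ ‖w‖ = R

/-- The surface formed by a system of sheets. -/
def stackSurface (E : Option (Fin b) → Set ℂ) (g : Option (Fin b) → ℂ → ℂ)
    (T : Option (Fin b) → ℂ → ℝ) : Set (ℂ × ℝ) :=
  {q | ∃ o, ∃ w ∈ E o, q.1 = g o w ∧ |q.2 - slabHeight b o| = T o w}

variable {R : ℝ} {E Z : Option (Fin b) → Set ℂ} {g g' : Option (Fin b) → ℂ → ℂ}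
  {T T' : Option (Fin b) → ℂ → ℝ}

/-- The parametrization of a stack by its sheets. -/
def sheetPoint (g : Option (Fin b) → ℂ → ℂ) (T : Option (Fin b) → ℂ → ℝ)
    (k : Σ od : Option (Fin b) × Bool, E od.1) : ℂ × ℝ :=
  (g k.1.1 k.2, slabHeight b k.1.1 + sheetSign k.1.2 * T k.1.1 k.2)

theorem IsSheetSystem.range_sheetPoint (H : IsSheetSystem R E Z g T) :
    Set.range (sheetPoint (E := E) g T) = stackSurface E g T := by
  ext ⟨p, z⟩
  constructor
  · rintro ⟨⟨⟨o, δ⟩, w, hw⟩, e⟩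
    obtain ⟨rfl, rfl⟩ := Prod.mk.inj e
    refine ⟨o, w, hw, rfl, ?_⟩
    rw [add_sub_cancel_left, abs_sheetSign_mul (H.height o w hw).nonneg]
  · rintro ⟨o, w, hw, e1, e2⟩
    change p = g o w at e1
    change |z - slabHeight b o| = T o w at e2
    rcases abs_eq (H.height o w hw).nonneg |>.1 e2 with h | h
    · exact ⟨⟨⟨o, true⟩, w, hw⟩, Prod.ext e1.symm (by simp [sheetPoint, sheetSign]; linarith)⟩
    · exact ⟨⟨⟨o, false⟩, w, hw⟩, Prod.ext e1.symm (by simp [sheetPoint, sheetSign]; linarith)⟩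

theorem IsSheetSystem.continuous_sheetPoint (H : IsSheetSystem R E Z g T) :
    Continuous (sheetPoint (E := E) g T) := by
  refine continuous_sigma fun od => ?_
  have h1 := continuousOn_iff_continuous_domRestrict.1 (H.continuousOn_map od.1)
  have h2 := continuousOn_iff_continuous_domRestrict.1 (H.continuousOn_height od.1)
  have h3 : Continuous fun w : E od.1 => T od.1 w := h2
  have h4 : Continuous fun x : ℝ => slabHeight b od.1 + sheetSign od.2 * x := by fun_prop
  exact h1.prodMk (h4.comp h3)

/-- The right-hand side does not involve `g` and `T`. The gluing pattern, and with it the surface,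
therefore depends only on the domains and the edge sets. -/
theorem IsSheetSystem.sheetPoint_eq_iff (H : IsSheetSystem R E Z g T)
    (k k' : Σ od : Option (Fin b) × Bool, E od.1) :
    sheetPoint g T k = sheetPoint g T k' ↔ (k.2 : ℂ) = k'.2 ∧
      ((k.1.1 = k'.1.1 ∧ (k.1.2 = k'.1.2 ∨ (k.2 : ℂ) ∈ Z k.1.1)) ∨
      (‖(k.2 : ℂ)‖ = R ∧ slabHeight b k.1.1 + sheetSign k.1.2 * seamHeight b k.1.1 =
        slabHeight b k'.1.1 + sheetSign k'.1.2 * seamHeight b k'.1.1)) := by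
  obtain ⟨⟨o, δ⟩, w, hw⟩ := k
  obtain ⟨⟨o', δ'⟩, w', hw'⟩ := k'
  simp only [sheetPoint, Prod.mk.injEq]
  constructor
  · rintro ⟨e1, e2⟩
    rcases sheetHeight_eq_imp (H.height o w hw) (H.height o' w' hw') e2 with ⟨rfl, h⟩ | ⟨h, h'⟩
    · exact ⟨H.injOn_map o hw hw' e1,
        Or.inl ⟨rfl, h.imp_right (H.height_eq_zero o w hw).1⟩⟩
    · have n := (H.height_eq_seam o w hw).1 h
      have n' := (H.height_eq_seam o' w' hw').1 h'
      rw [H.map_seam o w hw n, H.map_seam o' w' hw' n'] at e1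
      rw [h, h'] at e2
      exact ⟨e1, Or.inr ⟨n, e2⟩⟩
  · rintro ⟨rfl, ⟨rfl, h⟩ | ⟨n, e⟩⟩
    · refine ⟨rfl, ?_⟩
      rcases h with rfl | h
      · rfl
      · rw [(H.height_eq_zero o w hw).2 h, mul_zero, mul_zero]
    · rw [H.map_seam o w hw n, H.map_seam o' w hw' n, (H.height_eq_seam o w hw).2 n,
        (H.height_eq_seam o' w hw').2 n]
      exact ⟨rfl, e⟩

theorem IsSheetSystem.homeomorph (H : IsSheetSystem R E Z g T) (H' : IsSheetSystem R E Z g' T')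
    (hE : ∀ o, IsCompact (E o)) : Nonempty (stackSurface E g T ≃ₜ stackSurface E g' T') := by
  have : ∀ od : Option (Fin b) × Bool, CompactSpace (E od.1) := fun od =>
    isCompact_iff_compactSpace.1 (hE od.1)
  rw [← H.range_sheetPoint, ← H'.range_sheetPoint]
  exact range_homeomorph_of_ker_eq H.continuous_sheetPoint H'.continuous_sheetPoint fun k k' => by
    rw [H.sheetPoint_eq_iff, H'.sheetPoint_eq_iff]

end Stack

/-! ### The profile of a slab with collinear tubes -/

section Profile

variable {n : ℕ} {ε R x : ℝ}

/-- Equidistant points on a line, in a symmetric position. -/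
def tubeCenter (n : ℕ) (i : Fin n) : ℝ := 2 * ((i : ℕ) : ℝ) - ((n : ℝ) - 1)

/-- The midpoints between equidistant points on a line. -/
def gapCenter (n : ℕ) (i : Fin (n - 1)) : ℝ := 2 * ((i : ℕ) : ℝ) - ((n : ℝ) - 2)

theorem one_le_abs_natCast_sub {i j : ℕ} (h : i ≠ j) : (1 : ℝ) ≤ |(i : ℝ) - j| := by
  have h2 : ((i : ℕ) : ℤ) - ((j : ℕ) : ℤ) ≠ 0 := by omega
  exact_mod_cast Int.one_le_abs h2

theorem two_le_abs_tubeCenter_sub {i j : Fin n} (h : i ≠ j) :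
    2 ≤ |tubeCenter n i - tubeCenter n j| := by
  have e : tubeCenter n i - tubeCenter n j = 2 * (((i : ℕ) : ℝ) - (j : ℕ)) := by
    simp only [tubeCenter]
    ring
  rw [e, abs_mul, abs_two]
  linarith [one_le_abs_natCast_sub (Fin.val_ne_of_ne h)]

theorem two_le_abs_gapCenter_sub {i j : Fin (n - 1)} (h : i ≠ j) :
    2 ≤ |gapCenter n i - gapCenter n j| := by
  have e : gapCenter n i - gapCenter n j = 2 * (((i : ℕ) : ℝ) - (j : ℕ)) := by
    simp only [gapCenter]
    ring
  rw [e, abs_mul, abs_two]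
  linarith [one_le_abs_natCast_sub (Fin.val_ne_of_ne h)]

theorem abs_tubeCenter_le (i : Fin n) : |tubeCenter n i| ≤ n - 1 := by
  have h : ((i : ℕ) : ℝ) + 1 ≤ n := by exact_mod_cast i.2
  have h0 : (0 : ℝ) ≤ (i : ℕ) := Nat.cast_nonneg _
  rw [tubeCenter, abs_le]
  constructor <;> linarith

theorem abs_gapCenter_le (i : Fin (n - 1)) : |gapCenter n i| ≤ n - 2 := by
  have h : ((i : ℕ) : ℝ) + 2 ≤ n := by
    have := i.2
    exact_mod_cast (by omega : (i : ℕ) + 2 ≤ n)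
  have h0 : (0 : ℝ) ≤ (i : ℕ) := Nat.cast_nonneg _
  rw [gapCenter, abs_le]
  constructor <;> linarith

theorem one_le_abs_gapCenter_sub_tubeCenter (i : Fin (n - 1)) (j : Fin n) :
    1 ≤ |gapCenter n i - tubeCenter n j| := by
  have e : gapCenter n i - tubeCenter n j = ((2 * (i : ℕ) + 1 - 2 * (j : ℕ) : ℤ) : ℝ) := by
    simp only [gapCenter, tubeCenter]
    push_cast
    ring
  have h : (2 * (i : ℕ) + 1 - 2 * (j : ℕ) : ℤ) ≠ 0 := by omega
  rw [e]
  exact_mod_cast Int.one_le_abs h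

theorem exists_gapCenter (hn : 2 ≤ n) (hx : |x| ≤ n - 1) :
    ∃ i : Fin (n - 1), |x - gapCenter n i| ≤ 1 := by
  rw [abs_le] at hx
  have hn' : ((n - 2 : ℕ) : ℝ) = n - 2 := by rw [Nat.cast_sub hn]; norm_num
  -- The floor gives the index of the gap except at the right end, where it would be out of range at
  -- `x = n - 1`. There the last gap is taken.
  by_cases h : x < n - 3
  · have hu : 0 ≤ (x + (n - 1)) / 2 := by linarith
    have h1 := Nat.floor_le hu
    have h2 := Nat.lt_floor_add_one ((x + (n - 1)) / 2)
    have h3 : ⌊(x + (n - 1)) / 2⌋₊ < n - 1 := by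
      have : (⌊(x + (n - 1)) / 2⌋₊ : ℝ) < (n - 2 : ℕ) := by
        rw [hn']
        linarith
      have := Nat.cast_lt.1 this
      omega
    refine ⟨⟨_, h3⟩, ?_⟩
    simp only [gapCenter]
    rw [abs_le]
    constructor <;> linarith
  · refine ⟨⟨n - 2, by omega⟩, ?_⟩
    simp only [gapCenter]
    rw [abs_le, hn']
    constructor <;> linarith

/-- The closed intervals of radius `ε` about the tube centers, the open ones of radius `1 - ε` about
the gap centers and the exterior tile the line. The last clauses of the first case record what
happens at the ends of a tube interval: it touches a gap interval or the exterior. -/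
theorem line_trichotomy (hn : 2 ≤ n) (hε : 0 < ε) (hε' : ε < 1 / 2) (x : ℝ) :
    (∃ i, |x - tubeCenter n i| ≤ ε ∧ (∀ j, j ≠ i → ε < |x - tubeCenter n j|) ∧
        (∀ j, 1 - ε ≤ |x - gapCenter n j|) ∧ |x| ≤ n - 1 + ε ∧
        (|x - tubeCenter n i| < ε → (∀ j, 1 - ε < |x - gapCenter n j|) ∧ |x| < n - 1 + ε) ∧
        (|x - tubeCenter n i| = ε → (∃ j, |x - gapCenter n j| = 1 - ε) ∨ |x| = n - 1 + ε)) ∨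
    (∃ i, |x - gapCenter n i| < 1 - ε ∧ (∀ j, j ≠ i → 1 - ε < |x - gapCenter n j|) ∧
        (∀ j, ε < |x - tubeCenter n j|) ∧ |x| < n - 1 + ε) ∨
    (n - 1 + ε < |x| ∧ (∀ j, 1 - ε < |x - gapCenter n j|) ∧ ∀ j, ε < |x - tubeCenter n j|) := by
  by_cases ht : ∃ i, |x - tubeCenter n i| ≤ ε
  · left
    obtain ⟨i, hi⟩ := ht
    have hg : ∀ j, 1 - |x - tubeCenter n i| ≤ |x - gapCenter n j| := fun j => by
      have h1 := one_le_abs_gapCenter_sub_tubeCenter j i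
      have h2 := abs_sub_le (gapCenter n j) x (tubeCenter n i)
      rw [abs_sub_comm (gapCenter n j) x] at h2
      linarith
    have hb : |x| ≤ n - 1 + |x - tubeCenter n i| := by
      have h1 := abs_add_le (x - tubeCenter n i) (tubeCenter n i)
      rw [sub_add_cancel] at h1
      linarith [abs_tubeCenter_le i]
    refine ⟨i, hi, fun j hj => ?_, fun j => by linarith [hg j], by linarith,
      fun h => ⟨fun j => by linarith [hg j], by linarith⟩, fun h => ?_⟩
    · have h1 := two_le_abs_tubeCenter_sub hj.symm
      have h2 := abs_sub_le (tubeCenter n i) x (tubeCenter n j)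
      rw [abs_sub_comm (tubeCenter n i) x] at h2
      linarith
    · by_cases hx : |x| ≤ n - 1
      · left
        obtain ⟨j, hj⟩ := exists_gapCenter hn hx
        refine ⟨j, le_antisymm ?_ (h ▸ hg j)⟩
        -- A gap center and a tube center differ by an odd integer. Here it is less than `2` in
        -- absolute value, hence `±1`, and the gap is adjacent to the tube.
        have e : gapCenter n j - tubeCenter n i = ((2 * (j : ℕ) + 1 - 2 * (i : ℕ) : ℤ) : ℝ) := by
          simp only [gapCenter, tubeCenter]
          push_cast
          ring
        have h2 := abs_sub_le (gapCenter n j) x (tubeCenter n i)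
        rw [abs_sub_comm (gapCenter n j) x, e] at h2
        have h3 : |((2 * (j : ℕ) + 1 - 2 * (i : ℕ) : ℤ) : ℝ)| < 2 := by linarith
        have h4 : |(2 * (j : ℕ) + 1 - 2 * (i : ℕ) : ℤ)| < 2 := by exact_mod_cast h3
        have h5 : (2 * (j : ℕ) + 1 - 2 * (i : ℕ) : ℤ) = 1 ∨
            (2 * (j : ℕ) + 1 - 2 * (i : ℕ) : ℤ) = -1 := by
          rw [abs_lt] at h4
          omega
        rw [abs_le] at hj
        rcases h5 with h5 | h5
        · rw [h5] at e
          push_cast at e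
          have : x - tubeCenter n i = x - gapCenter n j + 1 := by linarith
          rw [this, abs_of_nonneg (by linarith)] at h
          rw [abs_le]
          constructor <;> linarith
        · rw [h5] at e
          push_cast at e
          have : x - tubeCenter n i = x - gapCenter n j - 1 := by linarith
          rw [this, abs_of_nonpos (by linarith)] at h
          rw [abs_le]
          constructor <;> linarith
      · right
        have h1 := abs_tubeCenter_le i
        rw [abs_le] at h1
        rw [not_le] at hx
        rcases lt_abs.1 hx with h2 | h2
        · have hn1 : (1 : ℝ) ≤ n := by exact_mod_cast (by omega : 1 ≤ n)
          have h3 : tubeCenter n i = n - 1 := by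
            by_contra hne
            have h6 : ((i : ℕ) : ℝ) ≤ n - 2 := by
              have : (i : ℕ) ≠ n - 1 := fun e => hne (by
                simp only [tubeCenter, e]
                rw [Nat.cast_sub (by omega)]
                push_cast
                ring)
              have : (i : ℕ) + 2 ≤ n := by omega
              have : (((i : ℕ) + 2 : ℕ) : ℝ) ≤ n := by exact_mod_cast this
              push_cast at this
              linarith
            have h7 : tubeCenter n i ≤ n - 3 := by
              simp only [tubeCenter]
              linarith
            rw [abs_le] at hi
            linarith
          rw [h3, abs_of_nonneg (by linarith)] at h
          rw [abs_of_nonneg (by linarith)]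
          linarith
        · have hn1 : (1 : ℝ) ≤ n := by exact_mod_cast (by omega : 1 ≤ n)
          have h3 : tubeCenter n i = -(n - 1) := by
            by_contra hne
            have h6 : (1 : ℝ) ≤ ((i : ℕ) : ℝ) := by
              have : (i : ℕ) ≠ 0 := fun e => hne (by
                simp only [tubeCenter, e]
                push_cast
                ring)
              exact_mod_cast Nat.one_le_iff_ne_zero.2 this
            have h7 : -(n - 3) ≤ tubeCenter n i := by
              simp only [tubeCenter]
              linarith
            rw [abs_le] at hi
            linarith
          rw [h3, abs_of_nonpos (by linarith)] at h
          rw [abs_of_nonpos (by linarith)]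
          linarith
  · right
    push Not at ht
    by_cases hx : |x| ≤ n - 1
    · left
      obtain ⟨i, hi⟩ := exists_gapCenter hn hx
      -- Otherwise `x` would be within `ε` of one of the two tubes next to the gap, with index `i`
      -- or `i + 1`.
      have hlt : |x - gapCenter n i| < 1 - ε := by
        by_contra hge
        rw [not_lt] at hge
        rcases le_abs.1 hge with h | h
        · have h1 := ht ⟨i + 1, by have := i.2; omega⟩
          simp only [tubeCenter, gapCenter] at h1 h hi
          rw [abs_le] at hi
          push_cast at h1
          rw [abs_of_nonpos (by linarith)] at h1
          linarith
        · have h1 := ht ⟨i, by have := i.2; omega⟩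
          simp only [tubeCenter, gapCenter] at h1 h hi
          rw [abs_le] at hi
          rw [abs_of_nonneg (by linarith)] at h1
          linarith
      refine ⟨i, hlt, fun j hj => ?_, ht, by linarith⟩
      have h1 := two_le_abs_gapCenter_sub hj.symm
      have h2 := abs_sub_le (gapCenter n i) x (gapCenter n j)
      rw [abs_sub_comm (gapCenter n i) x] at h2
      linarith
    · right
      rw [not_le] at hx
      have hn1 : ((n - 1 : ℕ) : ℝ) = n - 1 := by rw [Nat.cast_sub (by omega)]; norm_num
      have hn0 : (1 : ℝ) ≤ n := by exact_mod_cast (by omega : 1 ≤ n)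
      refine ⟨?_, fun j => ?_, ht⟩
      · rcases lt_abs.1 hx with h | h
        · have h1 := ht ⟨n - 1, by omega⟩
          simp only [tubeCenter, hn1] at h1
          rw [abs_of_nonneg (by linarith)] at h1
          rw [abs_of_nonneg (by linarith)]
          linarith
        · have h1 := ht ⟨0, by omega⟩
          simp only [tubeCenter] at h1
          push_cast at h1
          rw [abs_of_nonpos (by linarith)] at h1
          rw [abs_of_nonpos (by linarith)]
          linarith
      · have h1 := abs_sub_abs_le_abs_sub x (gapCenter n j)
        linarith [abs_gapCenter_le j]

/-- Where the tubes are: the sum of the bumps over the intervals of radius `r` about the `c i`. -/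
noncomputable def bumpSum {ι : Type*} [Fintype ι] (r : ℝ) (c : ι → ℝ) (x : ℝ) : ℝ :=
  ∑ i, max (r ^ 2 - (x - c i) ^ 2) 0

theorem bump_eq_zero {r a : ℝ} (hr : 0 ≤ r) (h : r ≤ |a|) : max (r ^ 2 - a ^ 2) 0 = 0 := by
  rw [← sq_abs a]
  exact max_eq_right (by nlinarith)

theorem bumpSum_eq_zero {ι : Type*} [Fintype ι] {r : ℝ} {c : ι → ℝ} (hr : 0 ≤ r)
    (h : ∀ i, r ≤ |x - c i|) : bumpSum r c x = 0 :=
  Finset.sum_eq_zero fun i _ => bump_eq_zero hr (h i)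

theorem bumpSum_eq {ι : Type*} [Fintype ι] {r : ℝ} {c : ι → ℝ} {i : ι}
    (hi : |x - c i| ≤ r) (h : ∀ j, j ≠ i → r ≤ |x - c j|) :
    bumpSum r c x = r ^ 2 - (x - c i) ^ 2 := by
  have hr : 0 ≤ r := (abs_nonneg _).trans hi
  have e : bumpSum r c x = max (r ^ 2 - (x - c i) ^ 2) 0 :=
    Fintype.sum_eq_single i fun j hj => bump_eq_zero hr (h j hj)
  rw [e, max_eq_left]
  rw [← sq_abs (x - c i)]
  nlinarith [abs_nonneg (x - c i)]

theorem continuous_bumpSum {ι : Type*} [Fintype ι] (r : ℝ) (c : ι → ℝ) :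
    Continuous (bumpSum r c) :=
  continuous_finsetSum _ fun i _ => by fun_prop

/-- How far the abscissa is on its way from the outermost tube to the rim. -/
noncomputable def rimParameter (A R x : ℝ) : ℝ := max ((|x| - A) / (R - A)) 0

/-- The slab with `n` tubes is `y² = ζ² (w x + R² - x²) - w x`, with this function `w`. -/
noncomputable def profile (n : ℕ) (ε R x : ℝ) : ℝ :=
  -bumpSum ε (tubeCenter n) x + (R ^ 2 - x ^ 2) * bumpSum (1 - ε) (gapCenter n) x /
      (1 - bumpSum (1 - ε) (gapCenter n) x) +
    rimParameter (n - 1 + ε) R x ^ 2 * (R - (n - 1 + ε)) * (R + |x|) /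
      (1 + rimParameter (n - 1 + ε) R x)

theorem sq_lt_sq_add_of_lt {r a ζ : ℝ} (hr : 0 ≤ r) (h : r < |a|) : r ^ 2 < a ^ 2 + ζ ^ 2 := by
  rw [← sq_abs a]
  nlinarith [sq_nonneg ζ]

/-- The value `w` of the profile at `x` describes a slab whose holes, seen from above, are the discs
about the tube centers, and whose holes, seen from the front, are the discs about the gap
centers. -/
structure ProfileSpec (n : ℕ) (ε R x w : ℝ) : Prop where
  pos : 0 < w + (R ^ 2 - x ^ 2)
  tube_nonneg : ∀ y : ℝ, 0 ≤ w + y ^ 2 ↔ ∀ i, ε ^ 2 ≤ (x - tubeCenter n i) ^ 2 + y ^ 2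
  tube_pos : ∀ y : ℝ, 0 < w + y ^ 2 ↔ ∀ i, ε ^ 2 < (x - tubeCenter n i) ^ 2 + y ^ 2
  gap_nonneg : ∀ ζ : ℝ, 0 ≤ ζ → (0 ≤ ζ ^ 2 * (w + (R ^ 2 - x ^ 2)) - w ↔
    |x| ≤ n - 1 + ε + (R - (n - 1 + ε)) * ζ ∧
      ∀ i, (1 - ε) ^ 2 ≤ (x - gapCenter n i) ^ 2 + ζ ^ 2)
  gap_pos : ∀ ζ : ℝ, 0 ≤ ζ → (0 < ζ ^ 2 * (w + (R ^ 2 - x ^ 2)) - w ↔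
    |x| < n - 1 + ε + (R - (n - 1 + ε)) * ζ ∧
      ∀ i, (1 - ε) ^ 2 < (x - gapCenter n i) ^ 2 + ζ ^ 2)

/-- Here `w ≤ 0`, and `w + y² = 0` is the circle of the tube. Seen from the front there is material
at every height; only at `ζ = 0` do the ends of the tube interval lie on an edge, which is where
`h5` and `h6` enter. -/
theorem profileSpec_tube (hε : 0 < ε) (hε' : ε < 1 / 2) (hR : (n : ℝ) + 1 < R) {i : Fin n}
    (h1 : |x - tubeCenter n i| ≤ ε) (h2 : ∀ j, j ≠ i → ε < |x - tubeCenter n j|)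
    (h3 : ∀ j, 1 - ε ≤ |x - gapCenter n j|) (h4 : |x| ≤ n - 1 + ε)
    (h5 : |x - tubeCenter n i| < ε → (∀ j, 1 - ε < |x - gapCenter n j|) ∧ |x| < n - 1 + ε)
    (h6 : |x - tubeCenter n i| = ε → (∃ j, |x - gapCenter n j| = 1 - ε) ∨ |x| = n - 1 + ε) :
    ProfileSpec n ε R x ((x - tubeCenter n i) ^ 2 - ε ^ 2) := by
  set d := x - tubeCenter n i with hd
  have hd2 : d ^ 2 ≤ ε ^ 2 := by
    rw [← sq_abs d]
    nlinarith [abs_nonneg d]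
  have hx : 1 / 4 < R ^ 2 - x ^ 2 := by
    have : (R - |x|) * (R + |x|) = R ^ 2 - x ^ 2 := by rw [← sq_abs x]; ring
    rw [← this]
    nlinarith [abs_nonneg x]
  have hpos : 0 < d ^ 2 - ε ^ 2 + (R ^ 2 - x ^ 2) := by nlinarith [sq_nonneg d]
  have hQ : ∀ ζ : ℝ, 0 ≤ ζ ^ 2 * (d ^ 2 - ε ^ 2 + (R ^ 2 - x ^ 2)) :=
    fun ζ => by positivity
  refine ⟨hpos, fun y => ⟨fun h j => ?_, fun h => ?_⟩, fun y => ⟨fun h j => ?_, fun h => ?_⟩,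
    fun ζ hζ => ⟨fun _ => ⟨?_, fun j => ?_⟩, fun _ => by linarith [hQ ζ]⟩,
    fun ζ hζ => ⟨fun h => ?_, fun h => ?_⟩⟩
  · by_cases hj : j = i
    · rw [hj]
      linarith
    · exact (sq_lt_sq_add_of_lt hε.le (h2 j hj)).le
  · linarith [h i]
  · by_cases hj : j = i
    · rw [hj]
      linarith
    · exact sq_lt_sq_add_of_lt hε.le (h2 j hj)
  · linarith [h i]
  · nlinarith
  · rw [← sq_abs (x - gapCenter n j)]
    nlinarith [h3 j, sq_nonneg ζ]
  · rcases hζ.eq_or_lt with e | hζ'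
    · rw [← e] at h ⊢
      have hlt : |d| < ε := lt_of_pow_lt_pow_left₀ 2 hε.le (by rw [sq_abs]; linarith)
      refine ⟨by rw [mul_zero, add_zero]; exact (h5 hlt).2, fun j => ?_⟩
      exact sq_lt_sq_add_of_lt (by linarith) ((h5 hlt).1 j)
    · refine ⟨by nlinarith, fun j => ?_⟩
      rw [← sq_abs (x - gapCenter n j)]
      nlinarith [h3 j, sq_pos_of_pos hζ']
  · rcases hζ.eq_or_lt with e | hζ'
    · rw [← e] at h ⊢
      have hne : |d| ≠ ε := fun e' => by
        rcases h6 e' with ⟨j, hj⟩ | h7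
        · have := h.2 j
          rw [← sq_abs (x - gapCenter n j), hj] at this
          linarith
        · linarith [h.1]
      have hlt := lt_of_le_of_ne h1 hne
      have : |d| ^ 2 < ε ^ 2 := pow_lt_pow_left₀ hlt (abs_nonneg d) two_ne_zero
      rw [sq_abs] at this
      linarith
    · have : 0 < ζ ^ 2 * (d ^ 2 - ε ^ 2 + (R ^ 2 - x ^ 2)) := by positivity
      linarith

/-- The value `w` is the solution of `V (w + R² - x²) = w`, so the front section `y = 0` is `ζ² =
V`, the circle about the gap center. -/
theorem profileSpec_gap (hε : 0 < ε) (hε' : ε < 1 / 2) (hR : (n : ℝ) + 1 < R) {i : Fin (n - 1)}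
    (h1 : |x - gapCenter n i| < 1 - ε) (h2 : ∀ j, j ≠ i → 1 - ε < |x - gapCenter n j|)
    (h3 : ∀ j, ε < |x - tubeCenter n j|) (h4 : |x| < n - 1 + ε) {V : ℝ}
    (hV : V = (1 - ε) ^ 2 - (x - gapCenter n i) ^ 2) :
    ProfileSpec n ε R x ((R ^ 2 - x ^ 2) * V / (1 - V)) := by
  have hV0 : 0 < V := by
    rw [hV, ← sq_abs (x - gapCenter n i)]
    nlinarith [abs_nonneg (x - gapCenter n i)]
  have hV1 : 0 < 1 - V := by
    rw [hV]
    nlinarith [sq_nonneg (x - gapCenter n i)]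
  have hx : 0 < R ^ 2 - x ^ 2 := by
    have : (R - |x|) * (R + |x|) = R ^ 2 - x ^ 2 := by rw [← sq_abs x]; ring
    rw [← this]
    nlinarith [abs_nonneg x]
  have hw : 0 < (R ^ 2 - x ^ 2) * V / (1 - V) := by positivity
  have hQ : ∀ ζ : ℝ, ζ ^ 2 * ((R ^ 2 - x ^ 2) * V / (1 - V) + (R ^ 2 - x ^ 2)) -
      (R ^ 2 - x ^ 2) * V / (1 - V) = (ζ ^ 2 - V) * ((R ^ 2 - x ^ 2) / (1 - V)) := fun ζ => by
    field_simp
    ring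
  have hc : 0 < (R ^ 2 - x ^ 2) / (1 - V) := by positivity
  have hout : ∀ ζ : ℝ, 0 ≤ ζ → |x| < n - 1 + ε + (R - (n - 1 + ε)) * ζ := fun ζ hζ => by nlinarith
  refine ⟨by positivity, fun y => ⟨fun _ j => (sq_lt_sq_add_of_lt hε.le (h3 j)).le, fun _ => by
    positivity⟩, fun y => ⟨fun _ j => sq_lt_sq_add_of_lt hε.le (h3 j), fun _ => by positivity⟩,
    fun ζ hζ => ?_, fun ζ hζ => ?_⟩
  · rw [hQ, mul_nonneg_iff_of_pos_right hc]
    refine ⟨fun h => ⟨(hout ζ hζ).le, fun j => ?_⟩, fun h => by linarith [h.2 i]⟩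
    by_cases hj : j = i
    · rw [hj]
      linarith
    · exact (sq_lt_sq_add_of_lt (by linarith) (h2 j hj)).le
  · rw [hQ, mul_pos_iff_of_pos_right hc]
    refine ⟨fun h => ⟨hout ζ hζ, fun j => ?_⟩, fun h => by linarith [h.2 i]⟩
    by_cases hj : j = i
    · rw [hj]
      linarith
    · exact sq_lt_sq_add_of_lt (by linarith) (h2 j hj)

/-- Now `w` is chosen so that the front section is `ζ = τ`, a straight line from the outermost tube
to the rim. Solving gives `τ² (R² - x²) / (1 - τ²)`. The factor `1 - τ` also divides `R² - x²` and
is cancelled, which keeps the formula regular at and beyond the rim. -/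
theorem profileSpec_rim (hε : 0 < ε) (hε' : ε < 1 / 2) {A : ℝ} (hA0 : 0 ≤ A) (hR : A < R)
    (hA : A = n - 1 + ε)
    (h1 : A < |x|) (h2 : ∀ j, 1 - ε < |x - gapCenter n j|)
    (h3 : ∀ j, ε < |x - tubeCenter n j|) {τ : ℝ} (hτ : τ = (|x| - A) / (R - A)) :
    ProfileSpec n ε R x (τ ^ 2 * (R - A) * (R + |x|) / (1 + τ)) := by
  have hRA : 0 < R - A := by linarith
  have hτ0 : 0 < τ := by
    rw [hτ]
    exact div_pos (by linarith) hRA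
  have hτR : τ * (R - A) = |x| - A := by
    rw [hτ]
    field_simp
  have hRx : 0 < R + |x| := by linarith
  have hw : 0 < τ ^ 2 * (R - A) * (R + |x|) / (1 + τ) := by positivity
  have hfac : R ^ 2 - x ^ 2 = (R - A) * (1 - τ) * (R + |x|) := by
    have : (R - A) * (1 - τ) = R - |x| := by linarith
    rw [this, ← sq_abs x]
    ring
  have hden : τ ^ 2 * (R - A) * (R + |x|) / (1 + τ) + (R ^ 2 - x ^ 2) =
      (R - A) * (R + |x|) / (1 + τ) := by
    rw [hfac]
    field_simp
    ring
  have hc : 0 < (R - A) * (R + |x|) / (1 + τ) := by positivity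
  have hQ : ∀ ζ : ℝ, ζ ^ 2 * (τ ^ 2 * (R - A) * (R + |x|) / (1 + τ) + (R ^ 2 - x ^ 2)) -
      τ ^ 2 * (R - A) * (R + |x|) / (1 + τ) =
      (ζ ^ 2 - τ ^ 2) * ((R - A) * (R + |x|) / (1 + τ)) := fun ζ => by
    rw [hden]
    field_simp
  refine ⟨hden ▸ hc, fun y => ⟨fun _ j => (sq_lt_sq_add_of_lt hε.le (h3 j)).le, fun _ => by
    positivity⟩, fun y => ⟨fun _ j => sq_lt_sq_add_of_lt hε.le (h3 j), fun _ => by positivity⟩,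
    fun ζ hζ => ?_, fun ζ hζ => ?_⟩
  · rw [hQ, mul_nonneg_iff_of_pos_right hc, sub_nonneg, pow_le_pow_iff_left₀ hτ0.le hζ two_ne_zero,
      ← hA]
    refine ⟨fun h => ⟨by nlinarith, fun j =>
      (sq_lt_sq_add_of_lt (by linarith) (h2 j)).le⟩, fun h => ?_⟩
    refine le_of_mul_le_mul_right ?_ hRA
    linarith [h.1]
  · rw [hQ, mul_pos_iff_of_pos_right hc, sub_pos, pow_lt_pow_iff_left₀ hτ0.le hζ two_ne_zero,
      ← hA]
    refine ⟨fun h => ⟨by nlinarith, fun j =>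
      sq_lt_sq_add_of_lt (by linarith) (h2 j)⟩, fun h => ?_⟩
    refine lt_of_mul_lt_mul_right ?_ hRA.le
    linarith [h.1]

theorem profileSpec_profile (hn : 2 ≤ n) (hε : 0 < ε) (hε' : ε < 1 / 2) (hR : (n : ℝ) + 1 < R)
    (x : ℝ) : ProfileSpec n ε R x (profile n ε R x) := by
  have hn0 : (2 : ℝ) ≤ n := by exact_mod_cast hn
  have hr : 0 ≤ 1 - ε := by linarith
  have hτ0 : |x| ≤ n - 1 + ε → rimParameter (n - 1 + ε) R x = 0 := fun h =>
    max_eq_right (div_nonpos_of_nonpos_of_nonneg (by linarith) (by linarith))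
  rcases line_trichotomy hn hε hε' x with ⟨i, h1, h2, h3, h4, h5, h6⟩ | ⟨i, h1, h2, h3, h4⟩ |
    ⟨h1, h2, h3⟩
  · have e : profile n ε R x = (x - tubeCenter n i) ^ 2 - ε ^ 2 := by
      rw [profile, hτ0 h4, bumpSum_eq_zero hr h3, bumpSum_eq h1 fun j hj => (h2 j hj).le]
      ring
    rw [e]
    exact profileSpec_tube hε hε' hR h1 h2 h3 h4 h5 h6
  · have e : profile n ε R x = (R ^ 2 - x ^ 2) * bumpSum (1 - ε) (gapCenter n) x /
        (1 - bumpSum (1 - ε) (gapCenter n) x) := by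
      rw [profile, hτ0 h4.le, bumpSum_eq_zero hε.le fun j => (h3 j).le]
      ring
    rw [e]
    exact profileSpec_gap hε hε' hR h1 h2 h3 h4 (bumpSum_eq h1.le fun j hj => (h2 j hj).le)
  · have e : profile n ε R x = rimParameter (n - 1 + ε) R x ^ 2 * (R - (n - 1 + ε)) * (R + |x|) /
        (1 + rimParameter (n - 1 + ε) R x) := by
      rw [profile, bumpSum_eq_zero hε.le fun j => (h3 j).le, bumpSum_eq_zero hr fun j => (h2 j).le]
      ring
    rw [e]
    exact profileSpec_rim hε hε' (by linarith) (by linarith) rfl h1 h2 h3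
      (max_eq_left (div_nonneg (by linarith) (by linarith)))

theorem continuous_profile (hn : 2 ≤ n) (hε : 0 < ε) (hε' : ε < 1 / 2) :
    Continuous (profile n ε R) := by
  have hV : ∀ x, 1 - bumpSum (1 - ε) (gapCenter n) x ≠ 0 := fun x => by
    have hr : 0 ≤ 1 - ε := by linarith
    rcases line_trichotomy hn hε hε' x with ⟨i, h1, h2, h3, h4, h5, h6⟩ | ⟨i, h1, h2, h3, h4⟩ |
      ⟨h1, h2, h3⟩
    · rw [bumpSum_eq_zero hr h3]
      norm_num
    · rw [bumpSum_eq h1.le fun j hj => (h2 j hj).le]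
      nlinarith [sq_nonneg (x - gapCenter n i)]
    · rw [bumpSum_eq_zero hr fun j => (h2 j).le]
      norm_num
  have h1 := continuous_bumpSum ε (tubeCenter n)
  have h2 := continuous_bumpSum (1 - ε) (gapCenter n)
  have h3 : Continuous (rimParameter (n - 1 + ε) R) := by
    unfold rimParameter
    fun_prop
  have h4 : ∀ x, 1 + rimParameter (n - 1 + ε) R x ≠ 0 := fun x => by
    have : 0 ≤ rimParameter (n - 1 + ε) R x := le_max_right _ _
    positivity
  unfold profile
  refine Continuous.add (Continuous.add h1.neg ?_) ?_
  · exact Continuous.div (by fun_prop) (by fun_prop) hV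
  · exact Continuous.div (by fun_prop) (by fun_prop) h4

end Profile

/-! ### Horizontal stretching of the plane -/

section Stretch

/-- The signed excess of `x` over the interval `[-c, c]`. -/
def excess (c x : ℝ) : ℝ := max (x - c) 0 - max (-x - c) 0

theorem excess_eq_zero {c x : ℝ} (h : |x| ≤ c) : excess c x = 0 := by
  rw [abs_le] at h
  rw [excess, max_eq_right (by linarith), max_eq_right (by linarith), sub_zero]

theorem excess_of_le {c x : ℝ} (hc : 0 ≤ c) (h : c ≤ x) : excess c x = x - c := by
  rw [excess, max_eq_left (by linarith), max_eq_right (by linarith), sub_zero]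

theorem excess_of_le_neg {c x : ℝ} (hc : 0 ≤ c) (h : x ≤ -c) : excess c x = x + c := by
  rw [excess, max_eq_right (by linarith), max_eq_left (by linarith)]
  ring

theorem excess_add_mul_excess {c ν x : ℝ} (hc : 0 ≤ c) (hν : 0 ≤ 1 + ν) :
    excess c (x + ν * excess c x) = (1 + ν) * excess c x := by
  rcases le_total |x| c with h | h
  · rw [excess_eq_zero h, mul_zero, add_zero, excess_eq_zero h, mul_zero]
  · rcases le_abs.1 h with h | h
    · rw [excess_of_le hc h, excess_of_le hc (by nlinarith)]
      ring
    · have h' : x ≤ -c := by linarith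
      rw [excess_of_le_neg hc h', excess_of_le_neg hc (by nlinarith)]
      ring

theorem abs_add_mul_excess {c ν x : ℝ} (hc : 0 ≤ c) (hν : 0 ≤ ν) (h : c ≤ |x|) :
    |x + ν * excess c x| = c + (1 + ν) * (|x| - c) := by
  rcases le_abs.1 h with h | h
  · rw [excess_of_le hc h, abs_of_nonneg (by nlinarith : (0 : ℝ) ≤ x), abs_of_nonneg (by nlinarith)]
    ring
  · rw [excess_of_le_neg hc (by linarith), abs_of_nonpos (by nlinarith : x ≤ (0 : ℝ)),
      abs_of_nonpos (by nlinarith)]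
    ring

/-- The plane stretched horizontally. -/
noncomputable def stretch (ν c : ℝ → ℝ) (p : ℂ) : ℂ :=
  ⟨p.re + ν p.im * excess (c p.im) p.re, p.im⟩

theorem continuous_stretch {ν c : ℝ → ℝ} (hν : Continuous ν) (hc : Continuous c) :
    Continuous (stretch ν c) := by
  have h : Continuous fun p : ℂ =>
      Complex.equivRealProdCLM.symm (p.re + ν p.im * excess (c p.im) p.re, p.im) := by
    unfold excess
    fun_prop
  exact h

/-- At each height the excess over `[-c, c]` is multiplied by `1 + ν`. The inverse divides it again,
which is the stretch with `-ν / (1 + ν)`. -/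
theorem exists_homeo_stretch {ν c : ℝ → ℝ} (hν : Continuous ν) (hc : Continuous c)
    (hν0 : ∀ z, 0 ≤ ν z) (hc0 : ∀ z, 0 ≤ c z) : ∃ h : ℂ ≃ₜ ℂ, ∀ p, h p = stretch ν c p := by
  have h1 : ∀ z, 0 < 1 + ν z := fun z => by linarith [hν0 z]
  have key : ∀ ν ν' : ℝ → ℝ, (∀ z, 0 < 1 + ν z) → (∀ z, ν z + ν' z * (1 + ν z) = 0) → ∀ p,
      stretch ν' c (stretch ν c p) = p := by
    intro ν ν' h e p
    apply Complex.ext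
    · simp only [stretch]
      rw [excess_add_mul_excess (hc0 _) (h _).le]
      linear_combination excess (c p.im) p.re * e p.im
    · rfl
  have hν' : Continuous fun z => -ν z / (1 + ν z) := by
    exact hν.neg.div (continuous_const.add hν) fun z => (h1 z).ne'
  refine ⟨⟨⟨stretch ν c, stretch (fun z => -ν z / (1 + ν z)) c, key _ _ h1 fun z => ?_,
    key _ _ (fun z => ?_) fun z => ?_⟩, continuous_stretch hν hc, continuous_stretch hν' hc⟩,
    fun _ => rfl⟩
  · have := (h1 z).ne'
    field_simp
    ring
  · have : 1 + -ν z / (1 + ν z) = 1 / (1 + ν z) := by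
      have := (h1 z).ne'
      field_simp
      ring
    rw [this]
    exact one_div_pos.2 (h1 z)
  · have := (h1 z).ne'
    field_simp
    ring

theorem lt_norm_iff_sq {r : ℝ} (hr : 0 ≤ r) (q : ℂ) : r < ‖q‖ ↔ r ^ 2 < q.re ^ 2 + q.im ^ 2 := by
  rw [← pow_lt_pow_iff_left₀ hr (norm_nonneg q) two_ne_zero, Complex.sq_norm, Complex.normSq_apply,
    ← sq, ← sq]

theorem le_norm_iff_sq {r : ℝ} (hr : 0 ≤ r) (q : ℂ) : r ≤ ‖q‖ ↔ r ^ 2 ≤ q.re ^ 2 + q.im ^ 2 := by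
  rw [← pow_le_pow_iff_left₀ hr (norm_nonneg q) two_ne_zero, Complex.sq_norm, Complex.normSq_apply,
    ← sq, ← sq]

theorem norm_lt_sqrt_iff (y : ℝ) (q : ℂ) : ‖q‖ < √y ↔ q.re ^ 2 + q.im ^ 2 < y := by
  rw [Real.lt_sqrt (norm_nonneg q), Complex.sq_norm, Complex.normSq_apply, ← sq, ← sq]

theorem norm_le_sqrt_iff {y : ℝ} (hy : 0 ≤ y) (q : ℂ) : ‖q‖ ≤ √y ↔ q.re ^ 2 + q.im ^ 2 ≤ y := by
  rw [Real.le_sqrt (norm_nonneg q) hy, Complex.sq_norm, Complex.normSq_apply, ← sq, ← sq]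

end Stretch

/-! ### The genus of a stack with collinear tubes, seen from the front -/

section CollinearStack

variable {b : ℕ} {n : Fin b → ℕ} {ε R : ℝ}

theorem slab_separated {z : ℝ} {j : Fin b} (h : |z - slabHeight b (some j)| ≤ 1) :
    |z| ≤ b ∧ ∀ i, i ≠ j → 1 ≤ |z - slabHeight b (some i)| := by
  constructor
  · have h1 := abs_slabHeight_le j
    have h2 := abs_sub_abs_le_abs_sub z (slabHeight b (some j))
    linarith
  · intro i hi
    have h1 := two_le_abs_slabHeight_sub hi.symm
    have h2 := abs_sub_le (slabHeight b (some j)) z (slabHeight b (some i))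
    rw [abs_sub_comm _ z] at h2
    linarith

theorem cap_separated {z : ℝ} (h : b ≤ |z|) (i : Fin b) : 1 ≤ |z - slabHeight b (some i)| := by
  have h1 := abs_slabHeight_le i
  have h2 := abs_sub_abs_le_abs_sub z (slabHeight b (some i))
  linarith

theorem exists_slab (hb : 0 < b) (z : ℝ) :
    (∃ j, |z - slabHeight b (some j)| ≤ 1) ∨ (b ≤ |z|) := by
  rcases le_total |z| b with h | h
  · left
    -- The middles of `b` slabs are placed like the gaps between `b + 1` tubes.
    obtain ⟨j, hj⟩ := exists_gapCenter (n := b + 1) (x := z) (by omega) (by push_cast; linarith)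
    have e : gapCenter (b + 1) j = slabHeight b (some j) := by
      simp only [gapCenter, slabHeight]
      push_cast
      ring
    exact ⟨j, e ▸ hj⟩
  · exact Or.inr h

/-- The stack with collinear tubes is `y² = P (x + i z)`, with this function `P`. -/
noncomputable def stackFunction (n : Fin b → ℕ) (ε R : ℝ) (p : ℂ) : ℝ :=
  R ^ 2 - p.re ^ 2 - max (p.im ^ 2 - (b : ℝ) ^ 2) 0 -
    ∑ j, max (1 ^ 2 - (p.im - slabHeight b (some j)) ^ 2) 0 *
      (profile (n j) ε R p.re + (R ^ 2 - p.re ^ 2))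

theorem stackFunction_slab {p : ℂ} {j : Fin b} (h : |p.im - slabHeight b (some j)| ≤ 1) :
    stackFunction n ε R p = |p.im - slabHeight b (some j)| ^ 2 *
      (profile (n j) ε R p.re + (R ^ 2 - p.re ^ 2)) - profile (n j) ε R p.re := by
  obtain ⟨hb, h'⟩ := slab_separated h
  have e : ∑ j, max (1 ^ 2 - (p.im - slabHeight b (some j)) ^ 2) 0 *
      (profile (n j) ε R p.re + (R ^ 2 - p.re ^ 2)) =
      max (1 ^ 2 - (p.im - slabHeight b (some j)) ^ 2) 0 *
      (profile (n j) ε R p.re + (R ^ 2 - p.re ^ 2)) :=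
    Fintype.sum_eq_single j fun i hi => by rw [bump_eq_zero zero_le_one (h' i hi), zero_mul]
  have h1 : max (1 ^ 2 - (p.im - slabHeight b (some j)) ^ 2) 0 =
      1 ^ 2 - (p.im - slabHeight b (some j)) ^ 2 := by
    refine max_eq_left ?_
    rw [← sq_abs (p.im - _)]
    nlinarith [abs_nonneg (p.im - slabHeight b (some j))]
  have h2 : max (p.im ^ 2 - (b : ℝ) ^ 2) 0 = 0 := by
    refine max_eq_right ?_
    rw [← sq_abs p.im]
    nlinarith [abs_nonneg p.im]
  rw [stackFunction, e, h1, h2, sq_abs]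
  ring

theorem stackFunction_cap {p : ℂ} (hb : b ≤ |p.im|) :
    stackFunction n ε R p = R ^ 2 + (b : ℝ) ^ 2 - (p.re ^ 2 + p.im ^ 2) := by
  have e : ∑ j, max (1 ^ 2 - (p.im - slabHeight b (some j)) ^ 2) 0 *
      (profile (n j) ε R p.re + (R ^ 2 - p.re ^ 2)) = 0 :=
    Finset.sum_eq_zero fun i _ => by rw [bump_eq_zero zero_le_one (cap_separated hb i), zero_mul]
  have h2 : max (p.im ^ 2 - (b : ℝ) ^ 2) 0 = p.im ^ 2 - (b : ℝ) ^ 2 := by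
    refine max_eq_left ?_
    rw [← sq_abs p.im]
    nlinarith [Nat.cast_nonneg (α := ℝ) b]
  rw [stackFunction, e, h2]
  ring

/-- Half the width of the section of the stack at height `z`. -/
noncomputable def halfWidth (n : Fin b → ℕ) (ε R z : ℝ) : ℝ :=
  R - ∑ j, max (1 - |z - slabHeight b (some j)|) 0 * (R - (n j - 1 + ε))

theorem halfWidth_slab {z : ℝ} {j : Fin b} (h : |z - slabHeight b (some j)| ≤ 1) :
    halfWidth n ε R z = n j - 1 + ε + (R - (n j - 1 + ε)) * |z - slabHeight b (some j)| := by
  have e : ∑ j, max (1 - |z - slabHeight b (some j)|) 0 * (R - (n j - 1 + ε)) =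
      max (1 - |z - slabHeight b (some j)|) 0 * (R - (n j - 1 + ε)) :=
    Fintype.sum_eq_single j fun i hi => by
      rw [max_eq_right (by linarith [(slab_separated h).2 i hi]), zero_mul]
  rw [halfWidth, e, max_eq_left (by linarith)]
  ring

theorem halfWidth_cap {z : ℝ} (h : b ≤ |z|) :
    halfWidth n ε R z = R := by
  have e : ∑ j, max (1 - |z - slabHeight b (some j)|) 0 * (R - (n j - 1 + ε)) = 0 :=
    Finset.sum_eq_zero fun i _ => by rw [max_eq_right (by linarith [cap_separated h i]), zero_mul]
  rw [halfWidth, e, sub_zero]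

/-- The centers of the gaps of all slabs. -/
def stackGapCenter (n : Fin b → ℕ) (σ : Σ j, Fin (n j - 1)) : ℂ :=
  ⟨gapCenter (n σ.1) σ.2, slabHeight b (some σ.1)⟩

theorem isHoleConfiguration_stackGapCenter (hε : 0 < ε) (hε' : ε < 1 / 2)
    (hR0 : 0 < R) (hR : ∀ j, (n j : ℝ) + b + 1 < R) :
    IsHoleConfiguration √(R ^ 2 + (b : ℝ) ^ 2) (1 - ε) (stackGapCenter n) := by
  have hRR : R ≤ √(R ^ 2 + (b : ℝ) ^ 2) := Real.le_sqrt_of_sq_le (by nlinarith [sq_nonneg (b : ℝ)])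
  refine ⟨by linarith, by linarith, ?_, ?_⟩
  · rintro ⟨j, i⟩ ⟨j', i'⟩ hne
    by_cases hj : j = j'
    · subst hj
      have hi : i ≠ i' := fun e => hne (by rw [e])
      have h1 := Complex.abs_re_le_norm (stackGapCenter n ⟨j, i⟩ - stackGapCenter n ⟨j, i'⟩)
      have h2 := two_le_abs_gapCenter_sub hi
      rw [Complex.sub_re] at h1
      change |gapCenter (n j) i - gapCenter (n j) i'| ≤ _ at h1
      linarith
    · have h1 := Complex.abs_im_le_norm (stackGapCenter n ⟨j, i⟩ - stackGapCenter n ⟨j', i'⟩)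
      have h2 := two_le_abs_slabHeight_sub hj
      rw [Complex.sub_im] at h1
      change |slabHeight b (some j) - slabHeight b (some j')| ≤ _ at h1
      linarith
  · rintro ⟨j, i⟩
    have h1 := Complex.norm_le_abs_re_add_abs_im (stackGapCenter n ⟨j, i⟩)
    change _ ≤ |gapCenter (n j) i| + |slabHeight b (some j)| at h1
    have h2 := abs_gapCenter_le i
    have h3 := abs_slabHeight_le j
    linarith [hR j]

theorem continuous_stackFunction (hn : ∀ j, 2 ≤ n j) (hε : 0 < ε) (hε' : ε < 1 / 2) :
    Continuous (stackFunction n ε R) := by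
  have h : ∀ j, Continuous fun p : ℂ => profile (n j) ε R p.re := fun j =>
    (continuous_profile (hn j) hε hε').comp Complex.continuous_re
  unfold stackFunction
  fun_prop

/-- The stretched stack function has the same sign as the hole function of a round disc. -/
theorem stretch_mem_iff (hb : 0 < b) (hn : ∀ j, 2 ≤ n j) (hε : 0 < ε) (hε' : ε < 1 / 2)
    (hR : ∀ j, (n j : ℝ) + b + 1 < R) {ν c : ℝ → ℝ}
    (hc : ∀ z, c z = halfWidth n ε R z - ε)
    (hν : ∀ z, ν z = (√(R ^ 2 + (b : ℝ) ^ 2 - min (z ^ 2) ((b : ℝ) ^ 2)) - halfWidth n ε R z) / ε)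
    (hc0 : ∀ z, 0 ≤ c z) (hν0 : ∀ z, 0 ≤ ν z) (p : ℂ) :
    (0 < holeFunction √(R ^ 2 + (b : ℝ) ^ 2) (1 - ε) (stackGapCenter n) (stretch ν c p) ↔
      0 < stackFunction n ε R p) ∧
    (0 ≤ holeFunction √(R ^ 2 + (b : ℝ) ^ 2) (1 - ε) (stackGapCenter n) (stretch ν c p) ↔
      0 ≤ stackFunction n ε R p) := by
  have hne : Nonempty (Σ j, Fin (n j - 1)) := ⟨⟨⟨0, hb⟩, ⟨0, by have := hn ⟨0, hb⟩; omega⟩⟩⟩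
  have hr : 0 ≤ 1 - ε := by linarith
  have hRb : 0 ≤ R ^ 2 + (b : ℝ) ^ 2 := by positivity
  have hb0 : (0 : ℝ) ≤ b := Nat.cast_nonneg b
  obtain ⟨x, z⟩ := p
  set X := x + ν z * excess (c z) x with hX
  have hst : stretch ν c ⟨x, z⟩ = ⟨X, z⟩ := rfl
  have hsub : ∀ σ, (⟨X, z⟩ - stackGapCenter n σ : ℂ).re = X - gapCenter (n σ.1) σ.2 ∧
      (⟨X, z⟩ - stackGapCenter n σ : ℂ).im = z - slabHeight b (some σ.1) := fun σ => ⟨rfl, rfl⟩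
  rw [hst, holeFunction_pos, holeFunction_nonneg, norm_lt_sqrt_iff, norm_le_sqrt_iff hRb]
  simp only [lt_norm_iff_sq hr, le_norm_iff_sq hr, hsub]
  have hfar : ∀ j, 1 ≤ |z - slabHeight b (some j)| → ∀ a : ℝ,
      (1 - ε) ^ 2 < a ^ 2 + (z - slabHeight b (some j)) ^ 2 := fun j h a => by
    rw [← sq_abs (z - _)]
    nlinarith [sq_nonneg a]
  rcases exists_slab hb z with ⟨j, h1⟩ | h1
  · obtain ⟨h2, h3⟩ := slab_separated h1
    set ζ := |z - slabHeight b (some j)| with hζ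
    have hζ0 : 0 ≤ ζ := abs_nonneg _
    have hw : halfWidth n ε R z = n j - 1 + ε + (R - (n j - 1 + ε)) * ζ := halfWidth_slab h1
    have hz : z ^ 2 ≤ (b : ℝ) ^ 2 := by
      rw [← sq_abs z]
      nlinarith [abs_nonneg z]
    have hS : (stackFunction n ε R ⟨x, z⟩) = ζ ^ 2 *
      (profile (n j) ε R x + (R ^ 2 - x ^ 2)) - profile (n j) ε R x :=
      stackFunction_slab (p := ⟨x, z⟩) h1
    have spec := profileSpec_profile (hn j) hε hε' (by linarith [hR j] : (n j : ℝ) + 1 < R) x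
    rw [hS, spec.gap_nonneg ζ hζ0, spec.gap_pos ζ hζ0, ← hw]
    -- The stretch fixes `|x| ≤ c z`. Gap centers satisfy `|x| ≤ n - 2` and the gap radius is below
    -- `1`, so the gaps lie in the fixed part.
    have hcA : (n j : ℝ) - 1 ≤ c z := by
      rw [hc, hw]
      nlinarith [hR j]
    -- The end `c + ε` of the section at height `z` is carried to the round circle of radius `√(R² +
    -- b²)`. This determines `ν`.
    have hsqrt : √(R ^ 2 + (b : ℝ) ^ 2 - z ^ 2) = c z + (1 + ν z) * ε := by
      rw [hν, hc, min_eq_left hz]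
      field_simp
      ring
    have hroot0 : 0 ≤ R ^ 2 + (b : ℝ) ^ 2 - z ^ 2 := by nlinarith [sq_nonneg R]
    have hout : (X ^ 2 + z ^ 2 < R ^ 2 + (b : ℝ) ^ 2 ↔ |x| < halfWidth n ε R z) ∧
        (X ^ 2 + z ^ 2 ≤ R ^ 2 + (b : ℝ) ^ 2 ↔ |x| ≤ halfWidth n ε R z) := by
      have e : halfWidth n ε R z = c z + ε := by
        rw [hc]
        ring
      rw [← lt_sub_iff_add_lt, ← le_sub_iff_add_le, ← sq_abs X, ← Real.lt_sqrt (abs_nonneg X),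
        ← Real.le_sqrt (abs_nonneg X) hroot0, hsqrt, e]
      have h1ν : 0 < 1 + ν z := by linarith [hν0 z]
      rcases le_total |x| (c z) with h | h
      · have e2 : X = x := by rw [hX, excess_eq_zero h, mul_zero, add_zero]
        rw [e2]
        have : 0 < (1 + ν z) * ε := by positivity
        constructor <;> constructor <;> intro _ <;> linarith
      · rw [hX, abs_add_mul_excess (hc0 z) (hν0 z) h, add_lt_add_iff_left, add_le_add_iff_left,
          mul_lt_mul_iff_right₀ h1ν, mul_le_mul_iff_right₀ h1ν, sub_lt_iff_lt_add',
          sub_le_iff_le_add']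
        exact ⟨Iff.rfl, Iff.rfl⟩
    have hgap : ∀ i : Fin (n j - 1),
        ((1 - ε) ^ 2 < (X - gapCenter (n j) i) ^ 2 + (z - slabHeight b (some j)) ^ 2 ↔
          (1 - ε) ^ 2 < (x - gapCenter (n j) i) ^ 2 + ζ ^ 2) ∧
        ((1 - ε) ^ 2 ≤ (X - gapCenter (n j) i) ^ 2 + (z - slabHeight b (some j)) ^ 2 ↔
          (1 - ε) ^ 2 ≤ (x - gapCenter (n j) i) ^ 2 + ζ ^ 2) := by
      intro i
      rw [hζ, sq_abs]
      rcases le_total |x| (c z) with h | h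
      · have e2 : X = x := by rw [hX, excess_eq_zero h, mul_zero, add_zero]
        rw [e2]
        exact ⟨Iff.rfl, Iff.rfl⟩
      · have hXc : c z ≤ |X| := by
          rw [hX, abs_add_mul_excess (hc0 z) (hν0 z) h]
          nlinarith [hν0 z]
        have big : ∀ y : ℝ, c z ≤ |y| →
            (1 - ε) ^ 2 < (y - gapCenter (n j) i) ^ 2 + (z - slabHeight b (some j)) ^ 2 := by
          intro y hy
          have h4 := abs_sub_abs_le_abs_sub y (gapCenter (n j) i)
          have h5 := abs_gapCenter_le i
          exact sq_lt_sq_add_of_lt hr (by linarith)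
        exact ⟨iff_of_true (big X hXc) (big x h), iff_of_true (big X hXc).le (big x h).le⟩
    constructor
    · refine and_congr hout.1 ⟨fun H i => (hgap i).1.1 (H ⟨j, i⟩), ?_⟩
      rintro H ⟨j', i⟩
      by_cases hj : j' = j
      · subst hj
        exact (hgap i).1.2 (H i)
      · exact hfar j' (h3 j' hj) _
    · refine and_congr hout.2 ⟨fun H i => (hgap i).2.1 (H ⟨j, i⟩), ?_⟩
      rintro H ⟨j', i⟩
      by_cases hj : j' = j
      · subst hj
        exact (hgap i).2.2 (H i)
      · exact (hfar j' (h3 j' hj) _).le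
  · have hz : (b : ℝ) ^ 2 ≤ z ^ 2 := by
      rw [← sq_abs z]
      nlinarith [abs_nonneg z]
    have hw : halfWidth n ε R z = R := halfWidth_cap h1
    have hR0 : 0 ≤ R := by linarith [hR ⟨0, hb⟩, Nat.cast_nonneg (α := ℝ) (n ⟨0, hb⟩)]
    -- On the caps the outline is already the round circle; the minimum in `ν` makes the stretch
    -- trivial there.
    have hν' : ν z = 0 := by
      rw [hν, min_eq_right hz, add_sub_cancel_right, hw, Real.sqrt_sq hR0, sub_self, zero_div]
    have e2 : X = x := by rw [hX, hν', zero_mul, add_zero]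
    rw [e2, stackFunction_cap (p := ⟨x, z⟩) h1, sub_pos, sub_nonneg]
    exact ⟨⟨fun h => h.1, fun h => ⟨h, fun σ => hfar σ.1 (cap_separated h1 σ.1) _⟩⟩,
      ⟨fun h => h.1, fun h => ⟨h, fun σ => (hfar σ.1 (cap_separated h1 σ.1) _).le⟩⟩⟩

/-- After stretching, the front view is a round disc whose holes are the gaps between neighbouring
tubes, `n j - 1` of them in the slab `j`. -/
theorem doubleOf_stackFunction_homeomorph (hb : 0 < b) (hn : ∀ j, 2 ≤ n j) (hε : 0 < ε)
    (hε' : ε < 1 / 2) (hR : ∀ j, (n j : ℝ) + b + 1 < R) :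
    Nonempty (doubleOf (stackFunction n ε R) ≃ₜ standardSurface (∑ j, (n j - 1))) := by
  have hne : Nonempty (Σ j, Fin (n j - 1)) := ⟨⟨⟨0, hb⟩, ⟨0, by have := hn ⟨0, hb⟩; omega⟩⟩⟩
  have hR0 : 0 < R := by
    linarith [hR ⟨0, hb⟩, Nat.cast_nonneg (α := ℝ) (n ⟨0, hb⟩), Nat.cast_nonneg (α := ℝ) b]
  have hb0 : (0 : ℝ) ≤ b := Nat.cast_nonneg b
  have hwidth : ∀ z, ε ≤ halfWidth n ε R z ∧ halfWidth n ε R z ≤ R := fun z => by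
    rcases exists_slab hb z with ⟨j, h1⟩ | h2
    · rw [halfWidth_slab h1]
      have h4 : (2 : ℝ) ≤ n j := by exact_mod_cast hn j
      have h5 := hR j
      have h6 := abs_nonneg (z - slabHeight b (some j))
      constructor <;> nlinarith
    · rw [halfWidth_cap h2]
      refine ⟨?_, le_rfl⟩
      linarith [hR ⟨0, hb⟩, Nat.cast_nonneg (α := ℝ) (n ⟨0, hb⟩)]
  have hwc : Continuous (halfWidth n ε R) := by
    unfold halfWidth
    fun_prop
  have hroot : ∀ z : ℝ, R ≤ √(R ^ 2 + (b : ℝ) ^ 2 - min (z ^ 2) ((b : ℝ) ^ 2)) := fun z =>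
    Real.le_sqrt_of_sq_le (by linarith [min_le_right (z ^ 2) ((b : ℝ) ^ 2)])
  let c : ℝ → ℝ := fun z => halfWidth n ε R z - ε
  let ν : ℝ → ℝ := fun z =>
    (√(R ^ 2 + (b : ℝ) ^ 2 - min (z ^ 2) ((b : ℝ) ^ 2)) - halfWidth n ε R z) / ε
  have hc0 : ∀ z, 0 ≤ c z := fun z => sub_nonneg.2 (hwidth z).1
  have hν0 : ∀ z, 0 ≤ ν z := fun z =>
    div_nonneg (sub_nonneg.2 ((hwidth z).2.trans (hroot z))) hε.le
  obtain ⟨h, hh⟩ := exists_homeo_stretch (ν := ν) (c := c) (by fun_prop) (by fun_prop) hν0 hc0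
  have key := fun p => stretch_mem_iff hb hn hε hε' hR (fun _ => rfl) (fun _ => rfl) hc0 hν0 p
  obtain ⟨e1⟩ := doubleOf_homeomorph (h := h) (continuous_stackFunction hn hε hε')
    (continuous_holeFunction √(R ^ 2 + (b : ℝ) ^ 2) (1 - ε) (stackGapCenter n))
    (fun p => by rw [hh]; exact (key p).1) (fun p => by rw [hh]; exact (key p).2)
  obtain ⟨e2⟩ := doubleOf_holeFunction_homeomorph
    (isHoleConfiguration_stackGapCenter hε hε' hR0 hR) (g := ∑ j, (n j - 1)) (by simp)
  exact ⟨e1.trans e2⟩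

end CollinearStack

/-! ### The collinear stack as a system of sheets -/

section SheetSystems

variable {b : ℕ} {R : ℝ}

/-- The height of the spherical caps above a disc of radius `R`, seen from the center. -/
noncomputable def capHeight (b : ℕ) (R : ℝ) (w : ℂ) : ℝ := √(R ^ 2 + (b : ℝ) ^ 2 - ‖w‖ ^ 2)

theorem isSheetSystem_elim (hb : 0 < b) (hR : 0 < R) {E Z : Fin b → Set ℂ} {g : Fin b → ℂ → ℂ}
    {T : Fin b → ℂ → ℝ} (h1 : ∀ j, ContinuousOn (g j) (E j)) (h2 : ∀ j, ContinuousOn (T j) (E j))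
    (h3 : ∀ j, Set.InjOn (g j) (E j)) (h4 : ∀ j, ∀ w ∈ E j, ‖w‖ = R → g j w = w)
    (h5 : ∀ j, ∀ w ∈ E j, 0 ≤ T j w ∧ T j w ≤ 1) (h6 : ∀ j, ∀ w ∈ E j, T j w = 0 ↔ w ∈ Z j)
    (h7 : ∀ j, ∀ w ∈ E j, T j w = 1 ↔ ‖w‖ = R) :
    IsSheetSystem R (fun o : Option (Fin b) => o.elim {w | ‖w‖ ≤ R} E) (fun o => o.elim ∅ Z)
      (fun o => o.elim id g) (fun o => o.elim (capHeight b R) T) := by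
  have hb0 : (0 : ℝ) < b := Nat.cast_pos.2 hb
  have hcap : ∀ w : ℂ, ‖w‖ ≤ R → (b : ℝ) ≤ capHeight b R w := fun w hw =>
    Real.le_sqrt_of_sq_le (by nlinarith [norm_nonneg w])
  refine ⟨?_, ?_, ?_, ?_, ?_, ?_, ?_⟩
  · rintro (_ | j)
    · exact continuousOn_id
    · exact h1 j
  · rintro (_ | j)
    · refine Continuous.continuousOn (f := capHeight b R) ?_
      unfold capHeight
      fun_prop
    · exact h2 j
  · rintro (_ | j)
    · exact Set.injOn_id _
    · exact h3 j
  · rintro (_ | j)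
    · exact fun _ _ _ => rfl
    · exact h4 j
  · rintro (_ | j)
    · exact hcap
    · exact h5 j
  · rintro (_ | j)
    · intro w hw
      exact iff_of_false (hb0.trans_le (hcap w hw)).ne' (Set.notMem_empty w)
    · exact h6 j
  · rintro (_ | j)
    · intro w hw
      change capHeight b R w = b ↔ _
      have hw' : ‖w‖ ≤ R := hw
      rw [capHeight, Real.sqrt_eq_iff_eq_sq (by nlinarith [norm_nonneg w]) hb0.le]
      constructor
      · intro e
        exact (pow_left_inj₀ (norm_nonneg w) hR.le two_ne_zero).1 (by linarith)
      · intro e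
        rw [e]
        ring
    · exact h7 j

/-- A disc with holes on the real axis. -/
def collinearDisc (n : ℕ) (ε R : ℝ) : Set ℂ :=
  {w | ‖w‖ ≤ R ∧ ∀ i, ε ≤ ‖w - (tubeCenter n i : ℝ)‖}

/-- The edges of the holes on the real axis. -/
def collinearEdge (n : ℕ) (ε : ℝ) : Set ℂ := {w | ∃ i, ‖w - (tubeCenter n i : ℝ)‖ = ε}

/-- The height of the slab with tubes on the real axis. -/
noncomputable def collinearHeight (n : ℕ) (ε R : ℝ) (w : ℂ) : ℝ :=
  √((profile n ε R w.re + w.im ^ 2) / (profile n ε R w.re + (R ^ 2 - w.re ^ 2)))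

theorem isCompact_collinearDisc (n : ℕ) (ε R : ℝ) : IsCompact (collinearDisc n ε R) := by
  refine (isCompact_closedBall (0 : ℂ) R).of_isClosed_subset ?_ fun w hw => by
    rw [mem_closedBall_zero_iff]
    exact hw.1
  refine (isClosed_le continuous_norm continuous_const).inter ?_
  have : {w : ℂ | ∀ i, ε ≤ ‖w - (tubeCenter n i : ℝ)‖} =
      ⋂ i, {w : ℂ | ε ≤ ‖w - (tubeCenter n i : ℝ)‖} := by
    ext w
    simp
  change IsClosed {w : ℂ | ∀ i, ε ≤ ‖w - (tubeCenter n i : ℝ)‖}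
  rw [this]
  exact isClosed_iInter fun i => isClosed_le continuous_const (by fun_prop)

variable {n : Fin b → ℕ} {ε : ℝ}

theorem le_norm_sub_ofReal_iff (hε : 0 ≤ ε) (w : ℂ) (t : ℝ) :
    ε ≤ ‖w - t‖ ↔ ε ^ 2 ≤ (w.re - t) ^ 2 + w.im ^ 2 := by
  rw [← sq_norm_sub_real, pow_le_pow_iff_left₀ hε (norm_nonneg _) two_ne_zero]

theorem lt_norm_sub_ofReal_iff (hε : 0 ≤ ε) (w : ℂ) (t : ℝ) :
    ε < ‖w - t‖ ↔ ε ^ 2 < (w.re - t) ^ 2 + w.im ^ 2 := by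
  rw [← sq_norm_sub_real, pow_lt_pow_iff_left₀ hε (norm_nonneg _) two_ne_zero]

/-- The height is the equation of the slab solved for `ζ`. It vanishes where `w + y² = 0`, at the
edges of the tubes, and equals `1` where `y² = R² - x²`, at the rim. -/
theorem isSheetSystem_collinear (hb : 0 < b) (hn : ∀ j, 2 ≤ n j) (hε : 0 < ε)
    (hε' : ε < 1 / 2) (hR0 : 0 < R) (hR : ∀ j, (n j : ℝ) + b + 1 < R) :
    IsSheetSystem R (fun o : Option (Fin b) => o.elim {w | ‖w‖ ≤ R} fun j =>
        collinearDisc (n j) ε R) (fun o => o.elim ∅ fun j => collinearEdge (n j) ε)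
      (fun o => o.elim id fun _ => id)
      (fun o => o.elim (capHeight b R) fun j => collinearHeight (n j) ε R) := by
  have hb0 : (0 : ℝ) < b := Nat.cast_pos.2 hb
  have spec := fun j x => profileSpec_profile (hn j) hε hε' (by linarith [hR j] : (n j : ℝ) + 1 < R) x
  have hq : ∀ j, ∀ w ∈ collinearDisc (n j) ε R, 0 ≤ (profile (n j) ε R w.re + w.im ^ 2) /
      (profile (n j) ε R w.re + (R ^ 2 - w.re ^ 2)) := by
    intro j w hw
    refine div_nonneg (((spec j w.re).tube_nonneg _).2 fun i => ?_) (spec j w.re).pos.le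
    exact (le_norm_sub_ofReal_iff hε.le w _).1 (hw.2 i)
  have hnorm : ∀ w : ℂ, ‖w‖ ^ 2 = w.re ^ 2 + w.im ^ 2 := fun w => by
    rw [Complex.sq_norm, Complex.normSq_apply, ← sq, ← sq]
  refine isSheetSystem_elim hb hR0 (fun _ => continuousOn_id) (fun j => ?_)
    (fun _ => Set.injOn_id _) (fun _ _ _ _ => rfl) (fun j w hw => ⟨Real.sqrt_nonneg _, ?_⟩)
    (fun j w hw => ?_) (fun j w hw => ?_)
  · have h1 : Continuous fun w : ℂ => profile (n j) ε R w.re :=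
      (continuous_profile (hn j) hε hε').comp Complex.continuous_re
    refine Continuous.continuousOn (Real.continuous_sqrt.comp ?_)
    exact Continuous.div (by fun_prop) (by fun_prop) fun w => (spec j w.re).pos.ne'
  · rw [collinearHeight, Real.sqrt_le_iff, and_iff_right zero_le_one, one_pow, div_le_one (spec j w.re).pos]
    have h1 := hnorm w
    have h2 : ‖w‖ ^ 2 ≤ R ^ 2 := pow_le_pow_left₀ (norm_nonneg w) hw.1 2
    linarith
  · rw [collinearHeight, Real.sqrt_eq_zero (hq j w hw), div_eq_zero_iff,
      or_iff_left (spec j w.re).pos.ne']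
    constructor
    · intro e
      have h1 := ((spec j w.re).tube_pos w.im).not.1 e.not_gt
      push Not at h1
      obtain ⟨i, hi⟩ := h1
      rw [← not_lt, ← lt_norm_sub_ofReal_iff hε.le, not_lt] at hi
      exact ⟨i, le_antisymm hi (hw.2 i)⟩
    · rintro ⟨i, hi⟩
      refine le_antisymm (not_lt.1 fun h => ?_) (((spec j w.re).tube_nonneg _).2 fun i =>
        (le_norm_sub_ofReal_iff hε.le w _).1 (hw.2 i))
      exact ((lt_norm_sub_ofReal_iff hε.le w _).2 (((spec j w.re).tube_pos _).1 h i)).ne' hi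
  · rw [collinearHeight, Real.sqrt_eq_one, div_eq_one_iff_eq (spec j w.re).pos.ne',
      ← pow_left_inj₀ (norm_nonneg w) hR0.le two_ne_zero, hnorm]
    constructor <;> intro h <;> linarith

/-- The exchange of the second and the third coordinate of space. -/
noncomputable def swapHeight : ℂ × ℝ ≃ₜ ℂ × ℝ where
  toFun q := (⟨q.1.re, q.2⟩, q.1.im)
  invFun q := (⟨q.1.re, q.2⟩, q.1.im)
  left_inv _ := rfl
  right_inv _ := rfl
  continuous_toFun := by
    have h : Continuous fun q : ℂ × ℝ => (Complex.equivRealProdCLM.symm (q.1.re, q.2), q.1.im) := by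
      fun_prop
    exact h
  continuous_invFun := by
    have h : Continuous fun q : ℂ × ℝ => (Complex.equivRealProdCLM.symm (q.1.re, q.2), q.1.im) := by
      fun_prop
    exact h

/-- The same surface is described from above, as sheets over discs with tubes, and from the front,
as a double over a disc with gaps. This is the link between the gluing pattern and the genus. -/
theorem mem_stackSurface_collinear_iff (hb : 0 < b) (hn : ∀ j, 2 ≤ n j) (hε : 0 < ε)
    (hε' : ε < 1 / 2) (hR0 : 0 < R) (hR : ∀ j, (n j : ℝ) + b + 1 < R) (q : ℂ × ℝ) :
    q ∈ stackSurface (fun o : Option (Fin b) => o.elim {w | ‖w‖ ≤ R} fun j =>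
        collinearDisc (n j) ε R) (fun o => o.elim id fun _ => id)
      (fun o => o.elim (capHeight b R) fun j => collinearHeight (n j) ε R) ↔
    swapHeight q ∈ doubleOf (stackFunction n ε R) := by
  obtain ⟨w, z⟩ := q
  have hb0 : (0 : ℝ) < b := Nat.cast_pos.2 hb
  have hnorm : ‖w‖ ^ 2 = w.re ^ 2 + w.im ^ 2 := by
    rw [Complex.sq_norm, Complex.normSq_apply, ← sq, ← sq]
  have spec := fun j => profileSpec_profile (hn j) hε hε' (by linarith [hR j] : (n j : ℝ) + 1 < R) w.re
  change (∃ o, _) ↔ w.im ^ 2 = stackFunction n ε R ⟨w.re, z⟩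
  constructor
  · rintro ⟨_ | j, w', hw, e1, e2⟩
    · change w = w' at e1
      subst e1
      change |z - 0| = capHeight b R w at e2
      change ‖w‖ ≤ R at hw
      have h0 : (b : ℝ) ^ 2 ≤ R ^ 2 + (b : ℝ) ^ 2 - ‖w‖ ^ 2 := by nlinarith [norm_nonneg w]
      have hbz : b ≤ |z| := by
        rw [sub_zero] at e2
        rw [e2]
        exact Real.le_sqrt_of_sq_le h0
      have hz : z ^ 2 = R ^ 2 + (b : ℝ) ^ 2 - ‖w‖ ^ 2 := by
        rw [sub_zero] at e2
        rw [← sq_abs z, e2, capHeight, Real.sq_sqrt (by nlinarith)]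
      rw [stackFunction_cap (p := ⟨w.re, z⟩) hbz]
      linarith
    · change w = w' at e1
      subst e1
      change |z - slabHeight b (some j)| = collinearHeight (n j) ε R w at e2
      have hs := isSheetSystem_collinear hb hn hε hε' hR0 hR
      have h1 : |z - slabHeight b (some j)| ≤ 1 := e2 ▸ (hs.height (some j) w hw).2
      rw [stackFunction_slab (p := ⟨w.re, z⟩) h1, e2, collinearHeight, Real.sq_sqrt, div_mul_cancel₀]
      · ring
      · exact (spec j).pos.ne'
      · refine div_nonneg (((spec j).tube_nonneg _).2 fun i => ?_) (spec j).pos.le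
        exact (le_norm_sub_ofReal_iff hε.le w _).1 (hw.2 i)
  · intro e
    rcases exists_slab hb z with ⟨j, h1⟩ | h1
    · rw [stackFunction_slab (p := ⟨w.re, z⟩) h1] at e
      change w.im ^ 2 = |z - slabHeight b (some j)| ^ 2 *
        (profile (n j) ε R w.re + (R ^ 2 - w.re ^ 2)) - profile (n j) ε R w.re at e
      have hpos := (spec j).pos
      refine ⟨some j, w, ⟨?_, fun i => ?_⟩, rfl, ?_⟩
      · refine (pow_le_pow_iff_left₀ (norm_nonneg w) hR0.le two_ne_zero).1 ?_
        have : |z - slabHeight b (some j)| ^ 2 ≤ 1 := by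
          nlinarith [abs_nonneg (z - slabHeight b (some j))]
        nlinarith
      · rw [le_norm_sub_ofReal_iff hε.le]
        refine ((spec j).tube_nonneg _).1 ?_ i
        rw [e]
        have : 0 ≤ |z - slabHeight b (some j)| ^ 2 *
          (profile (n j) ε R w.re + (R ^ 2 - w.re ^ 2)) := by positivity
        linarith
      · change |z - slabHeight b (some j)| = collinearHeight (n j) ε R w
        have : (profile (n j) ε R w.re + w.im ^ 2) / (profile (n j) ε R w.re + (R ^ 2 - w.re ^ 2)) =
            |z - slabHeight b (some j)| ^ 2 := by
          rw [e, div_eq_iff hpos.ne']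
          ring
        rw [collinearHeight, this, Real.sqrt_sq (abs_nonneg _)]
    · rw [stackFunction_cap (p := ⟨w.re, z⟩) h1] at e
      change w.im ^ 2 = R ^ 2 + (b : ℝ) ^ 2 - (w.re ^ 2 + z ^ 2) at e
      refine ⟨none, w, ?_, rfl, ?_⟩
      · refine (pow_le_pow_iff_left₀ (norm_nonneg w) hR0.le two_ne_zero).1 ?_
        have : (b : ℝ) ^ 2 ≤ |z| ^ 2 := pow_le_pow_left₀ hb0.le h1 2
        rw [sq_abs] at this
        linarith
      · change |z - 0| = capHeight b R w
        have : R ^ 2 + (b : ℝ) ^ 2 - ‖w‖ ^ 2 = |z| ^ 2 := by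
          rw [hnorm, sq_abs]
          linarith
        rw [sub_zero, capHeight, this, Real.sqrt_sq (abs_nonneg _)]

/-- The genus of a stack. -/
theorem IsSheetSystem.homeomorph_standardSurface (hb : 0 < b) (hn : ∀ j, 2 ≤ n j) (hε : 0 < ε)
    (hε' : ε < 1 / 2) (hR0 : 0 < R) (hR : ∀ j, (n j : ℝ) + b + 1 < R)
    {g : Option (Fin b) → ℂ → ℂ} {T : Option (Fin b) → ℂ → ℝ}
    (H : IsSheetSystem R (fun o : Option (Fin b) => o.elim {w | ‖w‖ ≤ R} fun j =>
        collinearDisc (n j) ε R) (fun o => o.elim ∅ fun j => collinearEdge (n j) ε) g T) :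
    Nonempty (stackSurface (fun o : Option (Fin b) => o.elim {w | ‖w‖ ≤ R} fun j =>
        collinearDisc (n j) ε R) g T ≃ₜ standardSurface (∑ j, (n j - 1))) := by
  obtain ⟨e1⟩ := H.homeomorph (isSheetSystem_collinear hb hn hε hε' hR0 hR) (by
    rintro (_ | j)
    · have : {w : ℂ | ‖w‖ ≤ R} = Metric.closedBall 0 R := by
        ext w
        rw [mem_closedBall_zero_iff]
        rfl
      change IsCompact {w : ℂ | ‖w‖ ≤ R}
      rw [this]
      exact isCompact_closedBall _ _
    · exact isCompact_collinearDisc _ _ _)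
  let e2 := swapHeight.subtype (mem_stackSurface_collinear_iff hb hn hε hε' hR0 hR)
  obtain ⟨e3⟩ := doubleOf_stackFunction_homeomorph hb hn hε hε' hR
  exact ⟨(e1.trans e2).trans e3⟩

end SheetSystems

/-! ### Stacks with tubes in general position -/

section SlabHeight

variable {ι : Type*} {c : ι → ℂ} {ε R : ℝ}

/-- The height of a slab with tubes about the points `c i`: it vanishes at the edges of the holes
and equals one at the rim. -/
noncomputable def tubeHeight (c : ι → ℂ) (ε R : ℝ) (p : ℂ) : ℝ :=
  (Metric.infDist p (Set.range c) - ε) / ((Metric.infDist p (Set.range c) - ε) + (R - ‖p‖))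

/-- The disc with holes about the points `c i`. -/
def holedDisc (c : ι → ℂ) (ε R : ℝ) : Set ℂ := {p | ‖p‖ ≤ R ∧ ∀ i, ε ≤ ‖p - c i‖}

variable [Fintype ι] [Nonempty ι]

/-- The two summands of the denominator vanish on the hole edges and on the rim, respectively, and
these do not meet. -/
theorem IsHoleConfiguration.tubeHeight_denom_pos (H : IsHoleConfiguration R ε c) {p : ℂ}
    (hp : p ∈ holedDisc c ε R) : 0 ≤ Metric.infDist p (Set.range c) - ε ∧ 0 ≤ R - ‖p‖ ∧
      0 < (Metric.infDist p (Set.range c) - ε) + (R - ‖p‖) := by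
  have h1 : 0 ≤ Metric.infDist p (Set.range c) - ε := sub_nonneg.2 (le_infDist_range.2 hp.2)
  have h2 : 0 ≤ R - ‖p‖ := sub_nonneg.2 hp.1
  refine ⟨h1, h2, lt_of_le_of_ne (add_nonneg h1 h2) fun h => ?_⟩
  obtain ⟨i, hi⟩ := exists_infDist_eq c p
  have h3 := norm_sub_norm_le p (c i)
  linarith [H.inside i]

theorem IsHoleConfiguration.continuousOn_tubeHeight (H : IsHoleConfiguration R ε c) :
    ContinuousOn (tubeHeight c ε R) (holedDisc c ε R) := by
  have h1 : Continuous fun p : ℂ => Metric.infDist p (Set.range c) := Metric.continuous_infDist_pt _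
  exact ContinuousOn.div (by fun_prop) (by fun_prop) fun p hp => (H.tubeHeight_denom_pos hp).2.2.ne'

theorem IsHoleConfiguration.tubeHeight_mem (H : IsHoleConfiguration R ε c) {p : ℂ}
    (hp : p ∈ holedDisc c ε R) : 0 ≤ tubeHeight c ε R p ∧ tubeHeight c ε R p ≤ 1 := by
  obtain ⟨h1, h2, h3⟩ := H.tubeHeight_denom_pos hp
  exact ⟨div_nonneg h1 h3.le, (div_le_one h3).2 (by linarith)⟩

theorem IsHoleConfiguration.tubeHeight_eq_zero_iff (H : IsHoleConfiguration R ε c) {p : ℂ}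
    (hp : p ∈ holedDisc c ε R) : tubeHeight c ε R p = 0 ↔ ∃ i, ‖p - c i‖ = ε := by
  obtain ⟨h1, h2, h3⟩ := H.tubeHeight_denom_pos hp
  rw [tubeHeight, div_eq_zero_iff, or_iff_left h3.ne', sub_eq_zero]
  constructor
  · intro h
    obtain ⟨i, hi⟩ := exists_infDist_eq c p
    exact ⟨i, hi ▸ h⟩
  · rintro ⟨i, hi⟩
    exact le_antisymm (hi ▸ infDist_le_norm_sub c p i) (sub_nonneg.1 h1)

theorem IsHoleConfiguration.tubeHeight_eq_one_iff (H : IsHoleConfiguration R ε c) {p : ℂ}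
    (hp : p ∈ holedDisc c ε R) : tubeHeight c ε R p = 1 ↔ ‖p‖ = R := by
  obtain ⟨h1, h2, h3⟩ := H.tubeHeight_denom_pos hp
  rw [tubeHeight, div_eq_one_iff_eq h3.ne']
  constructor <;> intro h <;> linarith

theorem rotate_invariant {u : ℂ} (hu : ‖u‖ = 1)
    (h : ∀ x, u * x ∈ Set.range c ↔ x ∈ Set.range c) (p : ℂ) :
    (u * p ∈ holedDisc c ε R ↔ p ∈ holedDisc c ε R) ∧
      tubeHeight c ε R (u * p) = tubeHeight c ε R p := by
  have h1 : ‖u * p‖ = ‖p‖ := by rw [norm_mul, hu, one_mul]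
  constructor
  · change (_ ∧ _) ↔ (_ ∧ _)
    rw [← le_infDist_range, ← le_infDist_range, infDist_mul_of_invariant hu h, h1]
  · rw [tubeHeight, tubeHeight, infDist_mul_of_invariant hu h, h1]

end SlabHeight

section RotationStack

variable {b : ℕ} {n : Fin b → ℕ} {c : ∀ j, Fin (n j) → ℂ} {ε R : ℝ}

/-- A stack of slabs with tubes about the points `c j i`. -/
def tubeStack (c : ∀ j : Fin b, Fin (n j) → ℂ) (ε R : ℝ) : Set (ℂ × ℝ) :=
  {q | (‖q.1‖ ≤ R ∧ |q.2| = capHeight b R q.1) ∨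
    ∃ j, q.1 ∈ holedDisc (c j) ε R ∧ |q.2 - slabHeight b (some j)| = tubeHeight (c j) ε R q.1}

theorem eq_iff_eq_of_le_lt {x y r : ℝ} (h1 : x ≤ r ↔ y ≤ r) (h2 : x < r ↔ y < r) :
    x = r ↔ y = r :=
  ⟨fun e => le_antisymm (h1.1 e.le) (not_lt.1 fun h => (h2.2 h).ne e),
    fun e => le_antisymm (h1.2 e.le) (not_lt.1 fun h => (h2.1 h).ne e)⟩

/-- Each slab may be straightened by its own plane homeomorphism. These are the identity on the rim,
where neighbouring slabs meet, so the stack is a sheet system over the collinear discs with the maps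
`(h j)⁻¹`. -/
theorem tubeStack_homeomorph (hb : 0 < b) (hn : ∀ j, 2 ≤ n j) (hε' : ε < 1 / 2)
    (hR : ∀ j, (n j : ℝ) + b + 1 < R) (hc : ∀ j, IsHoleConfiguration R ε (c j))
    {h : Fin b → ℂ ≃ₜ ℂ} (hfix : ∀ j x, R ≤ ‖x‖ → h j x = x)
    (hcarry : ∀ j, CarriesDomain (h j) R ε (c j) R ε fun i => (tubeCenter (n j) i : ℝ)) :
    Nonempty (tubeStack c ε R ≃ₜ standardSurface (∑ j, (n j - 1))) := by
  have hε := (hc ⟨0, hb⟩).radius_pos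
  have hR0 := (hc ⟨0, hb⟩).outer_pos
  have hne : ∀ j, Nonempty (Fin (n j)) := fun j => ⟨⟨0, by have := hn j; omega⟩⟩
  have hmem : ∀ j p, h j p ∈ collinearDisc (n j) ε R ↔ p ∈ holedDisc (c j) ε R := fun j p =>
    and_congr ((hcarry j).outer_le p) (forall_congr' fun i => by
      rw [← not_lt, ← not_lt, (hcarry j).inner_lt i p])
  have hmem' : ∀ j w, w ∈ collinearDisc (n j) ε R → (h j).symm w ∈ holedDisc (c j) ε R :=
    fun j w hw => (hmem j _).1 (by rwa [(h j).apply_symm_apply])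
  have hrim : ∀ j w, ‖(h j).symm w‖ = R ↔ ‖w‖ = R := fun j w => by
    have h1 := (hcarry j).outer_le ((h j).symm w)
    have h2 := (hcarry j).outer_lt ((h j).symm w)
    rw [(h j).apply_symm_apply] at h1 h2
    exact eq_iff_eq_of_le_lt h1.symm h2.symm
  have hedge : ∀ j w i, ‖(h j).symm w - c j i‖ = ε ↔ ‖w - (tubeCenter (n j) i : ℝ)‖ = ε :=
    fun j w i => by
      have h1 := (hcarry j).inner_le i ((h j).symm w)
      have h2 := (hcarry j).inner_lt i ((h j).symm w)
      rw [(h j).apply_symm_apply] at h1 h2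
      exact eq_iff_eq_of_le_lt h1.symm h2.symm
  obtain ⟨key⟩ := (isSheetSystem_elim hb hR0 (E := fun j => collinearDisc (n j) ε R)
    (Z := fun j => collinearEdge (n j) ε) (g := fun j => (h j).symm)
    (T := fun j w => tubeHeight (c j) ε R ((h j).symm w))
    (fun j => (h j).symm.continuous.continuousOn)
    (fun j => (hc j).continuousOn_tubeHeight.comp (h j).symm.continuous.continuousOn (hmem' j))
    (fun j => (h j).symm.injective.injOn)
    (fun j w _ hw => (h j).symm_apply_eq.2 (hfix j w hw.ge).symm)
    (fun j w hw => (hc j).tubeHeight_mem (hmem' j w hw))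
    (fun j w hw => ((hc j).tubeHeight_eq_zero_iff (hmem' j w hw)).trans
      (exists_congr fun i => hedge j w i))
    (fun j w hw => ((hc j).tubeHeight_eq_one_iff (hmem' j w hw)).trans
      (hrim j w))).homeomorph_standardSurface hb hn hε hε' hR0 hR
  refine ⟨(Homeomorph.setCongr ?_).trans key⟩
  ext ⟨p, z⟩
  constructor
  · rintro (⟨h1, h2⟩ | ⟨j, h1, h2⟩)
    · refine ⟨none, p, h1, rfl, ?_⟩
      change |z - 0| = _
      rw [sub_zero]
      exact h2
    · refine ⟨some j, h j p, (hmem j p).2 h1, ((h j).symm_apply_apply p).symm, ?_⟩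
      change |z - slabHeight b (some j)| = tubeHeight (c j) ε R ((h j).symm (h j p))
      rw [(h j).symm_apply_apply]
      exact h2
  · rintro ⟨_ | j, w, hw, e1, e2⟩
    · change p = w at e1
      subst e1
      change |z - 0| = _ at e2
      rw [sub_zero] at e2
      exact Or.inl ⟨hw, e2⟩
    · change p = (h j).symm w at e1
      subst e1
      exact Or.inr ⟨j, hmem' j w hw, e2⟩

theorem le_capHeight {w : ℂ} (h : ‖w‖ ≤ R) : (b : ℝ) ≤ capHeight b R w :=
  Real.le_sqrt_of_sq_le (by nlinarith [norm_nonneg w])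

/-- The rotation of a stack is not homotopic to the identity if it moves a tube. -/
theorem tubeStack_not_homotopic (hn : ∀ j, 0 < n j)
    (hc : ∀ j, IsHoleConfiguration R ε (c j)) {j : Fin b}
    (hsep : ∀ i i', i ≠ i' → 4 * ε < ‖c j i - c j i'‖) {u : ℂ} (hu : ‖u‖ = 1)
    {i i' : Fin (n j)} (hi : i ≠ i') (hui : c j i = u * c j i')
    {F : C(tubeStack c ε R, tubeStack c ε R)}
    (hF : ∀ q, (F q : ℂ × ℝ) = axisRotate u q) :
    ¬ F.Homotopic (ContinuousMap.id (tubeStack c ε R)) := by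
  have hne : ∀ j, Nonempty (Fin (n j)) := fun j => ⟨⟨0, hn j⟩⟩
  have H := hc j
  have hε0 := H.radius_pos
  have hu0 : u ≠ 0 := norm_ne_zero_iff.1 (hu ▸ one_ne_zero)
  have hεn : ∀ x : ℂ, ‖x + (ε : ℂ) - x‖ = ε := fun x => by
    rw [add_sub_cancel_left, Complex.norm_real, Real.norm_of_nonneg hε0.le]
  have hfar : ∀ x y : ℂ, 4 * ε < ‖x - y‖ → 3 / 2 * ε < ‖x + (ε : ℂ) - y‖ := fun x y h => by
    have h2 := norm_sub_le (x + ε - y) (x + ε - x)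
    rw [sub_sub_sub_cancel_left, hεn] at h2
    linarith
  have hmem : ∀ σ : ℝ, |σ| = 1 → ∀ p ∈ holedDisc (c j) ε R,
      (p, slabHeight b (some j) + σ * tubeHeight (c j) ε R p) ∈ tubeStack c ε R := by
    intro σ hσ p hp
    refine Or.inr ⟨j, hp, ?_⟩
    change |slabHeight b (some j) + σ * tubeHeight (c j) ε R p - slabHeight b (some j)| = _
    rw [add_sub_cancel_left, abs_mul, hσ, one_mul, abs_of_nonneg (H.tubeHeight_mem hp).1]
  let sheet : ∀ σ : ℝ, |σ| = 1 → holedDisc (c j) ε R → tubeStack c ε R := fun σ hσ p =>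
    ⟨_, hmem σ hσ p p.2⟩
  have hsheet : ∀ (σ : ℝ) (hσ : |σ| = 1), IsPreconnected (Set.range (sheet σ hσ)) := by
    intro σ hσ
    have : PreconnectedSpace (holedDisc (c j) ε R) := Subtype.preconnectedSpace H.isPreconnected
    have h1 : Continuous fun p : holedDisc (c j) ε R => tubeHeight (c j) ε R p :=
      continuousOn_iff_continuous_domRestrict.1 H.continuousOn_tubeHeight
    exact isPreconnected_range (Continuous.subtype_mk (by fun_prop) _)
  have hin : ∀ i, c j i + (ε : ℂ) ∈ holedDisc (c j) ε R := by
    intro i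
    refine ⟨?_, fun i' => ?_⟩
    · have h1 := norm_add_le (c j i) (ε : ℂ)
      rw [Complex.norm_real, Real.norm_of_nonneg hε0.le] at h1
      linarith [H.inside i]
    · by_cases hi : i = i'
      · rw [← hi, hεn]
      · linarith [hfar _ _ (hsep i i' hi)]
  have hedge : ∀ i, tubeHeight (c j) ε R (c j i + ε) = 0 := fun i =>
    (H.tubeHeight_eq_zero_iff (hin i)).2 ⟨i, hεn _⟩
  have hpt : ∀ (σ : ℝ) (hσ : |σ| = 1) i,
      sheet σ hσ ⟨_, hin i⟩ = sheet 1 abs_one ⟨_, hin i⟩ := by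
    intro σ hσ i
    apply Subtype.ext
    simp only [sheet, hedge, mul_zero]
  have hm : |(-1 : ℝ)| = 1 := by rw [abs_neg, abs_one]
  have hd := hsep i i' hi
  refine not_homotopic_of_tubes (z₀ := slabHeight b (some j)) (ρ := 3 / 2 * ε) (a := c j i)
    (a' := c j i') (fun q => ?_) (fun q => ?_) ?_ (hsheet 1 abs_one) (hsheet (-1) hm) ?_ ?_
    ⟨⟨_, hin i⟩, rfl⟩ ⟨⟨_, hin i⟩, hpt (-1) hm i⟩ ⟨⟨_, hin i'⟩, rfl⟩ ⟨⟨_, hin i'⟩, hpt (-1) hm i'⟩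
    ?_ ?_ ?_ ?_
  · rw [hF]
    change ‖u * _ - _‖ = _
    rw [norm_rotate_sub hu, hui, inv_mul_cancel_left₀ hu0]
  · rw [hF]
    rfl
  -- At the middle height of the slab `j` the stack contains only the hole edges of that slab. The
  -- caps are too far out, and the sheets of other slabs reach only distance `1` from middles that
  -- are at least `2` away. No hole edge lies at distance `3ε / 2` from `c j i`.
  · rintro ⟨p, z⟩ hq hz e
    change z = _ at hz
    change ‖p - c j i‖ = _ at e
    have hzb := abs_slabHeight_le j
    rcases hq with ⟨h1, h2⟩ | ⟨j', h1, h2⟩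
    · change |z| = capHeight b R p at h2
      have h3 := le_capHeight (b := b) h1
      rw [← h2, hz] at h3
      linarith
    · by_cases hj : j = j'
      · subst hj
        change |z - _| = _ at h2
        rw [hz, sub_self, abs_zero] at h2
        obtain ⟨l, hl⟩ := (H.tubeHeight_eq_zero_iff h1).1 h2.symm
        change ‖p - c j l‖ = ε at hl
        by_cases hil : i = l
        · subst hil
          linarith
        · have h3 := hsep i l hil
          have h4 := norm_sub_le (p - c j l) (p - c j i)
          rw [sub_sub_sub_cancel_left] at h4
          linarith
      · have h3 := ((hc j').tubeHeight_mem h1).2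
        change |z - _| = tubeHeight (c j') ε R p at h2
        change tubeHeight (c j') ε R p ≤ 1 at h3
        have h4 := two_le_abs_slabHeight_sub hj
        rw [hz] at h2
        linarith
  · rintro _ ⟨p, rfl⟩
    have := (H.tubeHeight_mem p.2).1
    change _ ≤ slabHeight b (some j) + 1 * tubeHeight (c j) ε R p
    linarith
  · rintro _ ⟨p, rfl⟩
    have := (H.tubeHeight_mem p.2).1
    change slabHeight b (some j) + -1 * tubeHeight (c j) ε R p ≤ _
    linarith
  · change ‖c j i + (ε : ℂ) - c j i‖ < _
    rw [hεn]
    linarith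
  · exact hfar _ _ hd
  · exact hfar _ _ (by rwa [norm_sub_rev])
  · change ‖c j i' + (ε : ℂ) - c j i'‖ < _
    rw [hεn]
    linarith

end RotationStack

/-! ### The rotation of a stack, and the theorem -/

section Realization

theorem exists_rootsOfUnity_enumeration {n : ℕ} (hn : 0 < n) :
    ∃ c : Fin n → ℂ, Function.Injective c ∧ ∀ x, x ∈ Set.range c ↔ x ^ n = 1 := by
  have : NeZero n := ⟨hn.ne'⟩
  obtain ⟨ω, hprim⟩ : ∃ ω : ℂ, IsPrimitiveRoot ω n := ⟨_, Complex.isPrimitiveRoot_exp n hn.ne'⟩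
  refine ⟨fun i => ω ^ (i : ℕ), fun i j e =>
    Fin.ext (hprim.pow_inj i.2 j.2 e), fun x => ⟨?_, fun hx => ?_⟩⟩
  · rintro ⟨i, rfl⟩
    change (ω ^ (i : ℕ)) ^ n = 1
    rw [← pow_mul, mul_comm, pow_mul, hprim.pow_eq_one, one_pow]
  · obtain ⟨i, hi, e⟩ := hprim.eq_pow_of_pow_eq_one hx
    exact ⟨⟨i, hi⟩, e⟩

/-- The rotation of a stack of slabs whose numbers of tubes are multiples of `k`. -/
theorem exists_mappingClass_of_stack {k g b : ℕ} (hk : 2 ≤ k) (hg : 0 < g) (hb : 0 < b)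
    {m : Fin b → ℕ} (hm : ∀ j, 0 < m j) (hgm : g = ∑ j, (m j * k - 1)) {S : Type*}
    [TopologicalSpace S] (hS : IsClosedSurfaceOfGenus g S) :
    ∃ m : MappingClassGroup S, orderOf m = k ∧ IsRealizedByRotation (2 * Real.pi / k) m := by
  obtain ⟨hζ1, hprim⟩ := rotation_generator hk rfl
  set ζ := Complex.exp ((2 * Real.pi / k : ℝ) * Complex.I) with hζ
  have hn : ∀ j, 2 ≤ m j * k := fun j => hk.trans (Nat.le_mul_of_pos_left k (hm j))
  have hn0 : ∀ j, 0 < m j * k := fun j => by linarith [hn j]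
  choose c hcinj hcrange using fun j => exists_rootsOfUnity_enumeration (hn0 j)
  have hnorm : ∀ j i, ‖c j i‖ = 1 := fun j i =>
    Complex.norm_eq_one_of_pow_eq_one ((hcrange j _).1 ⟨i, rfl⟩) (hn0 j).ne'
  have htinj : ∀ j, Function.Injective fun i => ((tubeCenter (m j * k) i : ℝ) : ℂ) := by
    intro j i i' e
    by_contra hne
    have h1 := two_le_abs_tubeCenter_sub hne
    have h2 : tubeCenter (m j * k) i = tubeCenter (m j * k) i' := Complex.ofReal_injective e
    rw [h2, sub_self, abs_zero] at h1
    linarith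
  choose h R₀ r₀ hr₀ hfix hcarry using fun j => exists_homeo_moving_holes (hcinj j) (htinj j)
  have hε : ∀ᶠ ε : ℝ in 𝓝[>] 0, ∀ j, (0 < ε ∧ ε < 1 / 2 ∧ ∀ x ∈ Set.range (c j),
      ∀ y ∈ Set.range (c j), x ≠ y → 4 * ε < ‖x - y‖) ∧ ε ≤ r₀ j := by
    rw [Filter.eventually_all]
    intro j
    exact (eventually_separated (Set.finite_range (c j))).and
      (mem_nhdsWithin_of_mem_nhds (ge_mem_nhds (hr₀ j)))
  obtain ⟨ε, hε⟩ := hε.exists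
  -- A common `R` must lie beyond the supports of all straightening homeomorphisms and leave room
  -- for the collinear tubes.
  have hRex : ∀ᶠ R : ℝ in Filter.atTop, ∀ j, R₀ j ≤ R ∧ ((m j * k : ℕ) : ℝ) + b + 1 < R := by
    rw [Filter.eventually_all]
    exact fun j => (Filter.eventually_ge_atTop _).and (Filter.eventually_gt_atTop _)
  obtain ⟨R, hR⟩ := hRex.exists
  have hε0 := (hε ⟨0, hb⟩).1.1
  have hε1 := (hε ⟨0, hb⟩).1.2.1
  have hR2 : 2 < R := by
    have h1 := (hR ⟨0, hb⟩).2
    have h2 : (2 : ℝ) ≤ ((m ⟨0, hb⟩ * k : ℕ) : ℝ) := by exact_mod_cast hn _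
    linarith [Nat.cast_nonneg (α := ℝ) b]
  have hsep : ∀ j i i', i ≠ i' → 4 * ε < ‖c j i - c j i'‖ := fun j i i' hne =>
    (hε j).1.2.2 _ ⟨i, rfl⟩ _ ⟨i', rfl⟩ ((hcinj j).ne hne)
  have hcfg : ∀ j, IsHoleConfiguration R ε (c j) := fun j =>
    ⟨hε0, by linarith, fun i i' hne => by linarith [hsep j i i' hne], fun i => by
      rw [hnorm]
      linarith⟩
  have hne : ∀ j, Nonempty (Fin (m j * k)) := fun j => ⟨⟨0, hn0 j⟩⟩
  have hrot : ∀ j x, ζ * x ∈ Set.range (c j) ↔ x ∈ Set.range (c j) := fun j x => by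
    rw [hcrange, hcrange, mul_pow, mul_comm (m j) k, pow_mul, hprim.pow_eq_one, one_pow, one_mul]
  have hb0 : (0 : ℝ) < b := Nat.cast_pos.2 hb
  have hcaprot : ∀ u : ℂ, ‖u‖ = 1 → ∀ p : ℂ, ‖u * p‖ = ‖p‖ ∧
      capHeight b R (u * p) = capHeight b R p := fun u hu p => by
    have : ‖u * p‖ = ‖p‖ := by rw [norm_mul, hu, one_mul]
    exact ⟨this, by rw [capHeight, capHeight, this]⟩
  -- The piece preserved by all rotations is the open lower cap, below all slabs.
  refine exists_mappingClass_of_rotation hk hg hS (hgm ▸ tubeStack_homeomorph hb hn hε1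
      (fun j => (hR j).2) hcfg (fun j x hx => hfix j x ((hR j).1.trans hx))
      (fun j => hcarry j R ε (hR j).1 (hε j).2)) hζ ?_ (W := {q | q.2 < -b})
    (isOpen_lt continuous_snd continuous_const) ?_ ?_ ?_
  · rintro ⟨p, z⟩ (⟨h1, h2⟩ | ⟨j, h1, h2⟩)
    · exact Or.inl ⟨(hcaprot ζ hζ1 p).1.le.trans h1, h2.trans (hcaprot ζ hζ1 p).2.symm⟩
    · have h3 := rotate_invariant (ε := ε) (R := R) hζ1 (hrot j) p
      exact Or.inr ⟨j, h3.1.2 h1, h2.trans h3.2.symm⟩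
  · have h1 : (b : ℝ) < √(R ^ 2 + (b : ℝ) ^ 2) := Real.lt_sqrt_of_sq_lt (by nlinarith)
    refine ⟨(0, -√(R ^ 2 + (b : ℝ) ^ 2)), neg_lt_neg h1, Or.inl ⟨?_, ?_⟩⟩
    · change ‖(0 : ℂ)‖ ≤ R
      rw [norm_zero]
      linarith
    · change |-√(R ^ 2 + (b : ℝ) ^ 2)| = √(R ^ 2 + (b : ℝ) ^ 2 - ‖(0 : ℂ)‖ ^ 2)
      rw [abs_neg, abs_of_nonneg (Real.sqrt_nonneg _), norm_zero]
      congr 1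
      ring
  · rintro ⟨p, z⟩ ⟨hW, ⟨h1, h2⟩ | ⟨j, h1, h2⟩⟩ u hu
    · exact Or.inl ⟨(hcaprot u hu p).1.le.trans h1, h2.trans (hcaprot u hu p).2.symm⟩
    · have h3 := ((hcfg j).tubeHeight_mem h1).2
      rw [← h2] at h3
      have h4 := neg_abs_le z
      have h5 := (slab_separated h3).1
      change z < -b at hW
      change |z| ≤ b at h5
      linarith
  · intro l hl0 hlk F hF
    have hu : ‖ζ ^ l‖ = 1 := by rw [norm_pow, hζ1, one_pow]
    have hu1 : ζ ^ l ≠ 1 := hprim.pow_ne_one_of_pos_of_lt hl0.ne' hlk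
    -- The power `ζ ^ l` moves the tube of the first slab at `1` to the different tube at `ζ ^ l`.
    have hone : (1 : ℂ) ∈ Set.range (c ⟨0, hb⟩) := (hcrange _ _).2 (one_pow _)
    have hpow : ζ ^ l ∈ Set.range (c ⟨0, hb⟩) := by
      rw [hcrange, ← pow_mul, mul_comm l, mul_comm (m _) k, mul_assoc, pow_mul, hprim.pow_eq_one,
        one_pow]
    obtain ⟨i', hi'⟩ := hone
    obtain ⟨i, hi⟩ := hpow
    refine tubeStack_not_homotopic hn0 hcfg (hsep ⟨0, hb⟩) hu (i := i) (i' := i') ?_ ?_ hF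
    · intro e
      rw [e, hi'] at hi
      exact hu1 hi.symm
    · rw [hi, hi', mul_one]

end Realization

theorem lemma2p1 (k g : ℕ) (hk : 2 ≤ k) (hg : 0 < g)
    (h : (∃ a b : ℕ, g = a * k + b * (k - 1)) ∨ (∃ a : ℕ, 0 < a ∧ g = a * k + 1))
    (S : Type*) [TopologicalSpace S] (hS : IsClosedSurfaceOfGenus g S) :
    ∃ m : MappingClassGroup S,
      orderOf m = k ∧ IsRealizedByRotation (2 * Real.pi / k) m := by
  rcases h with ⟨a, b, hgab⟩ | ⟨a, ha, hga⟩
  · rcases b with _ | b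
    · have ha : 0 < a := by
        refine Nat.pos_of_ne_zero fun h0 => ?_
        rw [h0] at hgab
        omega
      exact exists_mappingClass_of_multiple hk ha (Or.inl (by rw [hgab]; ring)) hS
    -- Here `b` is one less than in the statement. One slab has `(a + 1)k` tubes and the other `b`
    -- have `k`, so the genus is `((a + 1)k - 1) + b(k - 1) = ak + (b + 1)(k - 1)`.
    · refine exists_mappingClass_of_stack hk hg b.succ_pos (m := Fin.cons (a + 1) fun _ => 1)
        (fun j => ?_) ?_ hS
      · refine Fin.cases ?_ (fun j => ?_) j
        · exact a.succ_pos
        · exact one_pos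
      · rw [Fin.sum_univ_succ, hgab]
        simp only [Fin.cons_zero, Fin.cons_succ, one_mul, Finset.sum_const, Finset.card_univ,
          Fintype.card_fin, smul_eq_mul]
        obtain ⟨k, rfl⟩ : ∃ l, k = l + 1 := ⟨k - 1, by omega⟩
        have e : (a + 1) * (k + 1) - 1 = a * (k + 1) + k := by
          rw [add_one_mul a (k + 1)]
          omega
        rw [e, Nat.add_sub_cancel]
        ring
  · exact exists_mappingClass_of_multiple hk ha (Or.inr hga) hS
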